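/- **Model.** Let $G=(V,E)$ be a connected undirected graph with $n\ge 3$ nodes and diameter $D$, and let $s\in V$ be a source that initially is the only node knowing $k\ge 1$ messages. In each synchronous round every node either broadcasts a packet or is silent. A silent node with exactly one broadcasting neighbour receives that neighbour's packet, unless a fault occurs; otherwise it receives nothing, and silence, collisions and faults are indistinguishable. Faults are independent over nodes and rounds and have constant probability $p\in[0,1)$: with *sender faults* a broadcasting node transmits noise with probability $p$, with *receiver faults* a listening node with exactly one broadcasting neighbour receives noise with probability $p$. A *coding schedule* fixes, for each node and round, a function from what the node initially knows and has received so far to "silent" or a packet, and a decoding function for each node; it *succeeds* if at the end all nodes output all $k$ messages. The *coding throughput* of $(G,s)$ is $\limsup_{k\to\infty} k/T_k$, where $T_k$ is the least number of rounds of a coding schedule, with messages and packets of $O(\log(nk))$ bits, that broadcasts any $k$ messages with success probability at least $1-1/k$. **Algorithm.** A ranked BFS tree of $G$ is a BFS tree rooted at $s$ in which leaves have rank $1$ and an inner node with maximal child rank $r$ has rank $r$ if exactly one child has rank $r$, and rank $r+1$ otherwise. A tree edge is *fast* if its ends have equal rank, and a node is *fast* if it is the parent in a fast edge. The tree is a *gathering-broadcasting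 spanning tree* (GBST) if, whenever $(u,v)$ and $(u',v')$ are fast edges (parent, child) with $u\ne u'$, $v,v'$ on the same level and of the same rank, $u$ and $v'$ are not adjacent in $G$. Let $r_{\max}$ be the largest rank, $L=\lceil\log_2 n\rceil$, $S=\lceil\log_2 L\rceil$. The *virtual distance* of a node is its distance from $s$ after adding to $G$ a directed shortcut from each node to every node reachable from it by a path of fast edges directed from parent to child. *Robust FASTBC* with parameter $c$, in its oblivious form, lets nodes broadcast in round $t$ as follows. If $t$ is odd and $\tau=(t-1)/2$, each node whose virtual distance is congruent to $\tau$ modulo $3$ broadcasts, independently, with probability $2^{-(\lfloor \tau/3\rfloor \bmod L)}$. If $t$ is even, a fast node of level $l$ and rank $r$ broadcasts iff $\lfloor l/S\rfloor-6r\equiv\lfloor (t/2)/(cS)\rfloor \pmod{6r_{\max}}$ and $l\equiv t\pmod 3$. Combined with *random linear network coding* over a fixed finite field $\mathbb F$, messages are vectors over $\mathbb F$, a packet consists of a coefficient vector in $\mathbb F^k$ and the corresponding combination of the messages, a node that broadcasts sends a uniformly random linear combination of the packets it knows, and a node decodes when its packets determine the messages. **Statement.** Every connected graph with $n\ge3$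 nodes and source $s$ has a GBST, and for every $p\in[0,1)$, in both fault models: 1. For every finite field $\mathbb F$ and every sufficiently large $c$ (depending on $p,\mathbb F$) there is a constant $C=C(p,\mathbb F,c)$ such that for all $G,s$ as above, every GBST and all $k\ge1$, Robust FASTBC with random linear network coding, run for any number $$T\ \ge\ C\,(D+k\log n\log\log n+\log^2 n\log\log n)$$ of rounds, broadcasts any $k$ messages with probability at least $1-\frac1{nk}$ (over the faults and the choices of the algorithm). 2. For messages of $a\lceil\log_2(nk)\rceil$ bits there are coding schedules with packets of $A\lceil\log_2(nk)\rceil$ bits that broadcast any $k\ge 1$ messages in at most $C'(D+k\log n\log\log n+\log^2 n\log\log n)$ rounds with probability at least $1-\frac1{nk}$. Here $A$ depends only on $a$, and $C'$ only on $a$ and $p$. 3. Consequently (with the same $a$, $A$), every such $(G,s)$ has coding throughput at least $\frac{\theta}{\log n\,\log\log n}$, where $\theta>0$ depends only on $a$ and $p$. -/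

import Mathlib

open MeasureTheory Filter

/-! ### The noisy radio network model -/

/-- Sender faults or receiver faults. -/
inductive FaultModel where
  | sender
  | receiver

/-- A static coding schedule with `T` rounds.  In round `r` node `u` applies `act r u` to its initial
knowledge (`some m` for the source, `none` for every other node) and to its reception history (one
entry per past round, newest first; `none` means that no packet was received), and either stays
silent (`none`) or broadcasts a packet.  After the last round `decode u` computes the output of `u`. -/
structure CodingSchedule (V Msgs Packet : Type) (T : ℕ) where
  act : Fin T → V → Option Msgs → List (Option Packet) → Option Packet
  decode : V → Option Msgs → List (Option Packet) → Option Msgs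

section RadioModel

open Classical in
/-- What `v` receives in one round, where `x u` is the packet broadcast by `u` (`none` if silent) and
`fault` marks the nodes with a fault in this round: `v` must be silent and have exactly one
broadcasting neighbour `u`, and the relevant node (`u` for sender faults, `v` for receiver faults)
must not be faulty.  Silence, collisions and faults cannot be distinguished by `v`. -/
noncomputable def receive {V Packet : Type} (G : SimpleGraph V) (model : FaultModel)
    (x : V → Option Packet) (fault : V → Bool) (v : V) : Option Packet :=
  if h : x v = none ∧ ∃! u, G.Adj u v ∧ x u ≠ none then
    let u := h.2.choose
    let culprit := match model with
      | FaultModel.sender => u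
      | FaultModel.receiver => v
    if fault culprit = true then none else x u
  else none

open Classical in
/-- Only the source initially knows the messages. -/
noncomputable def initialKnowledge {V Msgs : Type} (s : V) (m : Msgs) (u : V) : Option Msgs :=
  if u = s then some m else none

/-- The reception history of every node after the first `r` rounds (of at most `T`). -/
noncomputable def history {V Msgs Packet : Type} {T : ℕ} (G : SimpleGraph V) (s : V)
    (model : FaultModel) (S : CodingSchedule V Msgs Packet T) (m : Msgs)
    (fault : Fin T → V → Bool) : ℕ → V → List (Option Packet)
  | 0, _ => []
  | r + 1, v =>
    if h : r < T then
      receive G model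
        (fun u => S.act ⟨r, h⟩ u (initialKnowledge s m u) (history G s model S m fault r u))
        (fault ⟨r, h⟩) v :: history G s model S m fault r v
    else history G s model S m fault r v

/-- After all `T` rounds every node outputs all the messages. -/
def Succeeds {V Msgs Packet : Type} {T : ℕ} (G : SimpleGraph V) (s : V)
    (model : FaultModel) (S : CodingSchedule V Msgs Packet T) (m : Msgs)
    (fault : Fin T → V → Bool) : Prop :=
  ∀ u, S.decode u (initialKnowledge s m u) (history G s model S m fault T u) = some m

/-- A coin that shows `true` with probability `p` (for `0 ≤ p ≤ 1`). -/
noncomputable def coin (p : ℝ) : Measure Bool :=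
  ENNReal.ofReal p • Measure.dirac true + ENNReal.ofReal (1 - p) • Measure.dirac false

instance (p : ℝ) : IsFiniteMeasure (coin p) :=
  ⟨by simp [coin, ENNReal.add_lt_top]⟩

theorem coin_isProbabilityMeasure {p : ℝ} (h0 : 0 ≤ p) (h1 : p ≤ 1) :
    IsProbabilityMeasure (coin p) :=
  ⟨by simp [coin, ← ENNReal.ofReal_add h0 (sub_nonneg.2 h1)]⟩

/-- Independent faults with probability `p`, one for each round and node. -/
noncomputable def faultMeasure (V : Type) [Fintype V] (T : ℕ) (p : ℝ) :
    Measure (Fin T → V → Bool) :=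
  Measure.pi fun _ => Measure.pi fun _ => coin p

instance (V : Type) [Fintype V] (T : ℕ) (p : ℝ) : IsFiniteMeasure (faultMeasure V T p) := by
  unfold faultMeasure; infer_instance

/-- Bit strings of length `a * ⌈log₂ (n k)⌉`. -/
abbrev LogBits (a n k : ℕ) : Type := Fin (a * Nat.clog 2 (n * k)) → Bool

/-- The coding throughput of `(G, s)` with fault probability `p`: the limsup, as `k → ∞`, of `k`
divided by the least number of rounds of a coding schedule that broadcasts `k` messages (of
`a * ⌈log₂ (n k)⌉` bits, with packets of `A * ⌈log₂ (n k)⌉` bits) with probability at least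
`1 - 1 / k`, whatever the messages are. -/
noncomputable def codingThroughput {V : Type} [Fintype V] (G : SimpleGraph V) (s : V)
    (model : FaultModel) (p : ℝ) (a A : ℕ) : ENNReal :=
  limsup (fun k : ℕ => (k : ENNReal) /
    ⨅ T ∈ {T : ℕ | ∃ S : CodingSchedule V (Fin k → LogBits a (Fintype.card V) k)
        (LogBits A (Fintype.card V) k) T,
        ∀ m, 1 - 1 / (k : ℝ) ≤ (faultMeasure V T p).real {f | Succeeds G s model S m f}},
      (T : ENNReal)) atTop

end RadioModel

/-! ### Gathering-broadcasting spanning trees -/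

/-- A ranked breadth-first search tree of `G` rooted at `s`; `v` is a child of `u` if `v ≠ s` and
`parent v = u`, and the value `parent s` plays no role.  Leaves have rank `1`; an inner node whose
maximal child rank `r` is attained by exactly one child has rank `r`, and if it is attained by at
least two children the rank is `r + 1`. -/
structure RankedBFSTree {V : Type} (G : SimpleGraph V) (s : V) where
  parent : V → V
  rank : V → ℕ
  adj_parent : ∀ v, v ≠ s → G.Adj (parent v) v
  dist_parent : ∀ v, v ≠ s → G.dist s (parent v) + 1 = G.dist s v
  rank_leaf : ∀ u, (∀ v, v ≠ s → parent v ≠ u) → rank u = 1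
  rank_of_unique : ∀ u v, v ≠ s → parent v = u →
    (∀ w, w ≠ s → parent w = u → w ≠ v → rank w < rank v) → rank u = rank v
  rank_of_tie : ∀ u v v', v ≠ s → v' ≠ s → v ≠ v' → parent v = u → parent v' = u →
    rank v = rank v' → (∀ w, w ≠ s → parent w = u → rank w ≤ rank v) → rank u = rank v + 1

namespace RankedBFSTree

variable {V : Type} {G : SimpleGraph V} {s : V}

/-- `u` is the parent of `v` and they have the same rank. -/
def FastEdge (𝒯 : RankedBFSTree G s) (u v : V) : Prop :=
  v ≠ s ∧ 𝒯.parent v = u ∧ 𝒯.rank v = 𝒯.rank u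

/-- A node is fast if one of its children has the same rank. -/
def Fast (𝒯 : RankedBFSTree G s) (u : V) : Prop := ∃ v, 𝒯.FastEdge u v

/-- Two fast edges with distinct parents, of the same rank and on the same level, are not joined by
an edge of `G` from the parent of one to the child of the other: simultaneous transmissions along
them do not interfere. -/
def IsGBST (𝒯 : RankedBFSTree G s) : Prop :=
  ∀ u v u' v', 𝒯.FastEdge u v → 𝒯.FastEdge u' v' → u ≠ u' →
    G.dist s v = G.dist s v' → 𝒯.rank v = 𝒯.rank v' → ¬ G.Adj u v'

/-- The largest rank. -/
def maxRank [Fintype V] (𝒯 : RankedBFSTree G s) : ℕ := Finset.univ.sup 𝒯.rank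

/-- The distance from `s` in the directed graph that consists of all edges of `G`, in both
directions, and of a shortcut from each node on a fast stretch to every later node of the stretch. -/
noncomputable def virtualDist (𝒯 : RankedBFSTree G s) (v : V) : ℕ :=
  sInf {d | ∃ x : ℕ → V, x 0 = s ∧ x d = v ∧
    ∀ i < d, G.Adj (x i) (x (i + 1)) ∨ Relation.TransGen 𝒯.FastEdge (x i) (x (i + 1))}

end RankedBFSTree

/-! ### Robust FASTBC with random linear network coding -/

/-- `⌈log₂ n⌉`, the number of rounds of a Decay phase. -/
def decayLength (n : ℕ) : ℕ := Nat.clog 2 n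

/-- `⌈log₂ ⌈log₂ n⌉⌉`, the block size. -/
def blockSize (n : ℕ) : ℕ := Nat.clog 2 (Nat.clog 2 n)

/-- The transmission probability of the Decay step in round `t` (used for odd `t` only).  Three
consecutive odd rounds, one for each residue of the virtual distance modulo 3, use the same value. -/
noncomputable def decayProb (n t : ℕ) : ℝ :=
  (2 : ℝ)⁻¹ ^ ((t / 2 / 3) % decayLength n)

/-- Who broadcasts in round `t` of Robust FASTBC with parameter `c`, in its oblivious form: the
decision does not depend on what a node has received.  In odd rounds the nodes whose virtual distance
has the residue that is currently served broadcast if their Decay coin says so.  In even rounds a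
fast node of level `l` and rank `r` broadcasts if `⌊l/S⌋ - 6 r ≡ ⌊(t/2)/(c S)⌋ (mod 6 r_max)` and
`l ≡ t (mod 3)`. -/
def Broadcasts {V : Type} [Fintype V] {G : SimpleGraph V} {s : V} (𝒯 : RankedBFSTree G s) (c t : ℕ)
    (u : V) (decayCoin : Bool) : Prop :=
  let S := blockSize (Fintype.card V)
  if t % 2 = 1 then
    t / 2 ≡ 𝒯.virtualDist u [MOD 3] ∧ decayCoin = true
  else
    𝒯.Fast u ∧
      ((G.dist s u / S : ℕ) : ℤ) - 6 * (𝒯.rank u : ℤ) ≡ ((t / 2 / (c * S) : ℕ) : ℤ)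
        [ZMOD 6 * (𝒯.maxRank : ℤ)] ∧
      G.dist s u ≡ t [MOD 3]

section RLNC

variable {F : Type} [Field F]

/-- `k` messages, each a vector of length `ℓ`. -/
abbrev FieldMessages (F : Type) (k ℓ : ℕ) : Type := Fin k → Fin ℓ → F

/-- A packet is a coefficient vector together with the corresponding combination of the messages. -/
abbrev RLNCPacket (F : Type) (k ℓ : ℕ) : Type := (Fin k → F) × (Fin ℓ → F)

/-- The packets a node knows: the source has the packets `(eᵢ, mᵢ)`, and every node has the packets
it received. -/
def knownPackets {k ℓ : ℕ} (init : Option (FieldMessages F k ℓ))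
    (hist : List (Option (RLNCPacket F k ℓ))) : List (RLNCPacket F k ℓ) :=
  (match init with
    | some m => List.ofFn fun i => (Pi.single i 1, m i)
    | none => []) ++ hist.reduceOption

/-- The linear combination of a list of packets with the given coefficients (of which there are at
least as many as packets whenever this is used). -/
def combine {k ℓ N : ℕ} (α : Fin N → F) (L : List (RLNCPacket F k ℓ)) : RLNCPacket F k ℓ :=
  (List.zipWith (fun a v => a • v) (List.ofFn α) L).sum

open Classical in
/-- Decoding: output the message vector that satisfies all known linear equations, if it is
unique. -/
noncomputable def rlncDecode {k ℓ : ℕ} (L : List (RLNCPacket F k ℓ)) :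
    Option (FieldMessages F k ℓ) :=
  if h : ∃! m : FieldMessages F k ℓ, ∀ y ∈ L, ∑ i, y.1 i • m i = y.2 then some h.choose else none

/-- The random choices of the algorithm: for each round and node a Decay coin and the coefficients
of a linear combination. -/
abbrev Seed (V F : Type) (k T : ℕ) : Type := Fin T → V → Bool × (Fin (k + T) → F)

/-- All choices are independent, the coin of round `t` shows `true` with probability `decayProb n t`,
and the coefficients are uniform in `F`. -/
noncomputable def seedMeasure (V F : Type) [Fintype V] [MeasurableSpace F] (k T : ℕ) :
    Measure (Seed V F k T) :=
  Measure.pi fun t => Measure.pi fun _ =>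
    (coin (decayProb (Fintype.card V) t)).prod
      (Measure.pi fun _ => ProbabilityTheory.uniformOn Set.univ)

open Classical in
/-- Robust FASTBC with random linear network coding, run for `T` rounds: whenever a node is told to
broadcast it sends a random linear combination of the packets it knows. -/
noncomputable def robustFastbcRLNC {V : Type} [Fintype V] {G : SimpleGraph V} {s : V}
    (𝒯 : RankedBFSTree G s) (c : ℕ) {k T : ℕ} (ℓ : ℕ) (seed : Seed V F k T) :
    CodingSchedule V (FieldMessages F k ℓ) (RLNCPacket F k ℓ) T where
  act t u init hist :=
    if Broadcasts 𝒯 c t u (seed t u).1 then some (combine (seed t u).2 (knownPackets init hist))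
    else none
  decode _ init hist := rlncDecode (knownPackets init hist)

end RLNC

/-- `D + k log n log log n + log² n log log n`. -/
noncomputable def roundBound (n D k : ℕ) : ℝ :=
  D + k * Real.log n * Real.log (Real.log n) + Real.log n ^ 2 * Real.log (Real.log n)

/-! Trees. A GBST is built from the deepest level upwards, choosing the parents on each level so
that as few pairs (parent, rank of child) as possible occur; two interfering fast edges would allow
a pair to be saved (`exists_ranked_tree_from_level`). A node of rank `r` has at least `2 ^ (r - 1)`
nodes in its subtree, so ranks and virtual distances are `O(log n)`.

Coding reduces to spreading one bit. For a nonzero vector `μ` a node is informed if it knows a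
packet whose coefficient vector is not orthogonal to `μ`. A node informed about every `μ` decodes,
and a uniform combination sent by an informed node is again non-orthogonal with probability at least
`1 - 1 / |F|`. So for fixed `μ` each undisturbed transmission from an informed node succeeds with
probability at least `successRate F p`, and resampling a single round gives linear recursions for
the probabilities of being uninformed (`probUninformed_succ`). Decay rounds yield slow steps towards
smaller virtual distance; even rounds yield collision-free fast steps (`IsGBST.broadcasts_even`).

The rest of the spreading argument is deterministic (`SpreadRules.exp_decay`): the potential `K ^ vd
* z ^ (number of level blocks) * θ ^ time` dominates the probabilities, with `θ` losing only a
constant factor in `O(L S)` rounds. Hence `Δ` levels are crossed in `C (Δ + h L S)` rounds with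
additional error `exp (-H h)` (`exists_zone_progress`). With `h = k + L` this beats the union bound
over all nodes and all `|F| ^ k` vectors, which is the claim on Robust FASTBC.

For short packets a coefficient vector of length `k` is too long. The messages are cut into batches
of `g = ⌈log₂ (n k)⌉` over the field with two elements, and the batches are pipelined through strips
of levels. Only `k * 2 ^ g` test vectors remain, and a packet is described by a batch number, `g`
coefficients and a payload. A good seed can be fixed for all messages at once. For the throughput,
`k` grows while the graph is fixed, so the term linear in `k` dominates. -/

/-! ### Existence of gathering-broadcasting spanning trees -/

section Existence

open Classical in
/-- The rank of a node with children `C` of ranks `ρ`. -/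
noncomputable def rankFromChildren {V : Type} (C : Finset V) (ρ : V → ℕ) : ℕ :=
  if C = ∅ then 1
  else if (C.filter fun v => ρ v = C.sup ρ).card = 1 then C.sup ρ else C.sup ρ + 1

theorem rankFromChildren_congr {V : Type} {C : Finset V} {ρ ρ' : V → ℕ}
    (h : ∀ v ∈ C, ρ v = ρ' v) : rankFromChildren C ρ = rankFromChildren C ρ' := by
  have hs : C.sup ρ = C.sup ρ' := Finset.sup_congr rfl h
  have hf : (C.filter fun v => ρ v = C.sup ρ) = C.filter fun v => ρ' v = C.sup ρ' :=
    Finset.filter_congr fun v hv => by rw [h v hv, hs]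
  unfold rankFromChildren
  rw [hf, hs]

/-- If the maximal rank is not attained exactly once, the parent's rank exceeds those of all
children. So the child in a fast edge has no sibling of its rank. -/
theorem eq_of_rankFromChildren_eq {V : Type} {C : Finset V} {ρ : V → ℕ} {v w : V}
    (hv : v ∈ C) (hw : w ∈ C) (h : rankFromChildren C ρ = ρ v) (hwv : ρ w = ρ v) : w = v := by
  have hle : ρ v ≤ C.sup ρ := Finset.le_sup hv
  unfold rankFromChildren at h
  rw [if_neg (Finset.ne_empty_of_mem hv)] at h
  split_ifs at h with h1
  · obtain ⟨x, hx⟩ := Finset.card_eq_one.1 h1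
    have h2 : v ∈ C.filter fun v => ρ v = C.sup ρ := by simp [hv, h]
    have h3 : w ∈ C.filter fun v => ρ v = C.sup ρ := by simp [hw, h, hwv]
    rw [hx, Finset.mem_singleton] at h2 h3
    rw [h2, h3]
  · omega

theorem rankFromChildren_unique {V : Type} {C : Finset V} {ρ : V → ℕ} {v : V} (hv : v ∈ C)
    (h : ∀ w ∈ C, w ≠ v → ρ w < ρ v) : rankFromChildren C ρ = ρ v := by
  have hs : C.sup ρ = ρ v := by
    refine le_antisymm (Finset.sup_le fun w hw => ?_) (Finset.le_sup hv)
    by_cases hwv : w = v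
    · rw [hwv]
    · exact (h w hw hwv).le
  have hf : (C.filter fun w => ρ w = C.sup ρ) = {v} := by
    ext w
    simp only [Finset.mem_filter, Finset.mem_singleton, hs]
    refine ⟨fun hw => ?_, ?_⟩
    swap
    · rintro rfl; exact ⟨hv, rfl⟩
    by_contra hwv
    exact (h w hw.1 hwv).ne hw.2
  unfold rankFromChildren
  rw [if_neg (Finset.ne_empty_of_mem hv), hf, if_pos (Finset.card_singleton v), hs]

theorem rankFromChildren_tie {V : Type} {C : Finset V} {ρ : V → ℕ} {v v' : V} (hv : v ∈ C)
    (hv' : v' ∈ C) (hne : v ≠ v') (he : ρ v = ρ v') (h : ∀ w ∈ C, ρ w ≤ ρ v) :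
    rankFromChildren C ρ = ρ v + 1 := by
  have hs : C.sup ρ = ρ v := le_antisymm (Finset.sup_le h) (Finset.le_sup hv)
  unfold rankFromChildren
  rw [if_neg (Finset.ne_empty_of_mem hv), hs, if_neg]
  intro h1
  obtain ⟨x, hx⟩ := Finset.card_eq_one.1 h1
  have h2 : v ∈ C.filter fun w => ρ w = ρ v := by simp [hv]
  have h3 : v' ∈ C.filter fun w => ρ w = ρ v := by simp [hv', he]
  rw [hx, Finset.mem_singleton] at h2 h3
  exact hne (h2.trans h3.symm)

variable {V : Type} [Fintype V] {G : SimpleGraph V} {s : V}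

open Classical in
/-- The children of `u` with respect to a parent function. -/
noncomputable def childrenOf (s : V) (f : V → V) (u : V) : Finset V :=
  Finset.univ.filter fun v => v ≠ s ∧ f v = u

/-- `f` assigns to every node but the root a neighbour on the previous level. -/
def IsBFSParent (G : SimpleGraph V) (s : V) (f : V → V) : Prop :=
  ∀ v, v ≠ s → G.Adj (f v) v ∧ G.dist s (f v) + 1 = G.dist s v

theorem dist_le_dist_add_one {V : Type} {G : SimpleGraph V} (hG : G.Connected) (s : V) {u v : V}
    (h : G.Adj u v) : G.dist s v ≤ G.dist s u + 1 := by
  have h1 := hG.dist_triangle (u := s) (v := u) (w := v)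
  rwa [SimpleGraph.dist_eq_one_iff_adj.2 h] at h1

theorem exists_isBFSParent (hG : G.Connected) (s : V) : ∃ f, IsBFSParent G s f := by
  have h : ∀ v, ∃ u, v ≠ s → G.Adj u v ∧ G.dist s u + 1 = G.dist s v := by
    intro v
    by_cases hv : v = s
    · exact ⟨s, fun h => absurd hv h⟩
    · obtain ⟨p, hp⟩ := hG.exists_walk_length_eq_dist v s
      cases p with
      | nil => exact absurd rfl hv
      | @cons _ u _ hvu p =>
        refine ⟨u, fun _ => ⟨hvu.symm, ?_⟩⟩
        have h1 := SimpleGraph.dist_le p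
        have h2 := dist_le_dist_add_one hG s hvu.symm
        rw [SimpleGraph.Walk.length_cons] at hp
        rw [SimpleGraph.dist_comm] at hp h1
        omega
  choose f hf using h
  exact ⟨f, hf⟩

/-- The rank of a node depends only on the edges below it, so the parents of level `l + 1` are still
free when level `l` is ranked. They are chosen to minimise the number of pairs (parent, rank of the
child). -/
theorem exists_ranked_tree_from_level (hG : G.Connected) (s : V) (j : ℕ) (l : ℕ)
    (hl : Fintype.card V + 1 ≤ l + j) :
    ∃ (f : V → V) (ρ : V → ℕ), IsBFSParent G s f ∧
      (∀ u, l ≤ G.dist s u → ρ u = rankFromChildren (childrenOf s f u) ρ) ∧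
      ∀ v v', v ≠ s → v' ≠ s → l ≤ G.dist s (f v) → ρ v = ρ (f v) → ρ v' = ρ (f v') → f v ≠ f v' →
        G.dist s v = G.dist s v' → ρ v = ρ v' → ¬ G.Adj (f v) v' := by
  classical
  induction j generalizing l with
  | zero =>
    obtain ⟨f, hf⟩ := exists_isBFSParent hG s
    have hlt : ∀ u, G.dist s u < l := by
      intro u
      obtain ⟨p, hp, hp'⟩ := (hG.preconnected s u).exists_path_of_dist
      have := hp.length_lt
      omega
    exact ⟨f, fun _ => 0, hf, fun u hu => absurd (hlt u) (not_lt.2 hu),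
      fun v v' _ _ hv => absurd (hlt _) (not_lt.2 hv)⟩
  | succ j ih =>
    obtain ⟨f, ρ, hf, hρ, hfast⟩ := ih (l + 1) (by omega)
    let 𝓢 : Set (V → V) := {g | IsBFSParent G s g ∧ ∀ v, G.dist s v ≠ l + 1 → g v = f v}
    let img : (V → V) → Finset (V × ℕ) := fun g =>
      (Finset.univ.filter fun v => G.dist s v = l + 1).image fun v => (g v, ρ v)
    obtain ⟨g, hg, hmin⟩ := Set.exists_min_image 𝓢 (fun g => (img g).card) (Set.toFinite _)
      ⟨f, hf, fun _ _ => rfl⟩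
    have hchild : ∀ u v, v ∈ childrenOf s g u → v ≠ s ∧ g v = u ∧ G.dist s v = G.dist s u + 1 := by
      intro u v hv
      simp only [childrenOf, Finset.mem_filter, Finset.mem_univ, true_and] at hv
      exact ⟨hv.1, hv.2, by rw [← hv.2, (hg.1 v hv.1).2]⟩
    let ρ' : V → ℕ := fun u =>
      if G.dist s u = l then rankFromChildren (childrenOf s g u) ρ else ρ u
    have hρ'1 : ∀ u, G.dist s u ≠ l → ρ' u = ρ u := fun u hu => if_neg hu
    have hρ'2 : ∀ u, l ≤ G.dist s u →
        rankFromChildren (childrenOf s g u) ρ' = rankFromChildren (childrenOf s g u) ρ := by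
      intro u hu
      refine rankFromChildren_congr fun v hv => hρ'1 v ?_
      have := (hchild u v hv).2.2
      omega
    refine ⟨g, ρ', hg.1, ?_, ?_⟩
    · intro u hu
      rw [hρ'2 u hu]
      by_cases hul : G.dist s u = l
      · exact if_pos hul
      · rw [hρ'1 u hul, hρ u (by omega)]
        congr 1
        ext v
        simp only [childrenOf, Finset.mem_filter, Finset.mem_univ, true_and]
        refine and_congr_right fun hv => ?_
        by_cases hvl : G.dist s v = l + 1
        · have h1 := (hf v hv).2
          have h2 := (hg.1 v hv).2
          constructor
          · rintro rfl; omega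
          · rintro rfl; omega
        · rw [hg.2 v hvl]
    · intro v v' hv hv' hl' h1 h2 hne hd he hadj
      have dv := (hg.1 v hv).2
      have dv' := (hg.1 v' hv').2
      by_cases hul : G.dist s (g v) = l
      · rw [hρ'1 v (by omega), hρ'1 v' (by omega)] at he
        have e1 : rankFromChildren (childrenOf s g (g v)) ρ = ρ v := by
          rw [hρ'1 v (by omega)] at h1
          rw [h1]; exact (if_pos hul).symm
        have e2 : rankFromChildren (childrenOf s g (g v')) ρ = ρ v' := by
          rw [hρ'1 v' (by omega)] at h2
          rw [h2]; exact (if_pos (by omega)).symm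
        have hns : v ≠ v' := fun h => hne (by rw [h])
        -- If `g v` were adjacent to `v'`, moving `v'` below `g v` would create no new pair, since
        -- `v` has the same rank, and would delete the pair of `v'`, whose old parent has no other
        -- child of that rank. This contradicts minimality.
        have hS : Function.update g v' (g v) ∈ 𝓢 := by
          refine ⟨fun x hx => ?_, fun x hx => ?_⟩
          · by_cases hxv : x = v'
            · subst hxv
              rw [Function.update_self]
              exact ⟨hadj, by omega⟩
            · rw [Function.update_of_ne hxv]; exact hg.1 x hx
          · have hxv : x ≠ v' := by rintro rfl; omega
            rw [Function.update_of_ne hxv]; exact hg.2 x hx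
        have hlt : (img (Function.update g v' (g v))).card < (img g).card := by
          refine Finset.card_lt_card (Finset.ssubset_iff_of_subset ?_ |>.2
            ⟨(g v', ρ v'), ?_, ?_⟩)
          · intro y hy
            simp only [img, Finset.mem_image, Finset.mem_filter, Finset.mem_univ, true_and] at hy ⊢
            obtain ⟨x, hx, rfl⟩ := hy
            by_cases hxv : x = v'
            · subst hxv
              exact ⟨v, by omega, by rw [Function.update_self, he]⟩
            · exact ⟨x, hx, by rw [Function.update_of_ne hxv]⟩
          · simp only [img, Finset.mem_image, Finset.mem_filter, Finset.mem_univ, true_and]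
            exact ⟨v', by omega, rfl⟩
          · simp only [img, Finset.mem_image, Finset.mem_filter, Finset.mem_univ, true_and,
              Prod.mk.injEq, not_exists, not_and]
            intro x hx hgx hρx
            by_cases hxv : x = v'
            · subst hxv
              rw [Function.update_self] at hgx
              exact hne hgx
            · rw [Function.update_of_ne hxv] at hgx
              refine hxv (eq_of_rankFromChildren_eq (C := childrenOf s g (g v')) ?_ ?_ e2 hρx)
              · simp [childrenOf, hv']
              · have : x ≠ s := by rintro rfl; simp at hx
                simp [childrenOf, this, hgx]
        exact absurd (hmin _ hS) (not_le.2 hlt)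
      · have e3 := hg.2 v (by omega)
        have e4 := hg.2 v' (by omega)
        rw [hρ'1 v (by omega), hρ'1 v' (by omega)] at he
        rw [hρ'1 v (by omega), hρ'1 _ hul] at h1
        rw [hρ'1 v' (by omega), hρ'1 (g v') (by omega)] at h2
        rw [e3] at h1 hl' hne hadj hul dv
        rw [e4] at h2 hne
        exact hfast v v' hv hv' (by omega) h1 h2 hne hd he hadj

theorem exists_isGBST (hG : G.Connected) (s : V) : ∃ 𝒯 : RankedBFSTree G s, 𝒯.IsGBST := by
  obtain ⟨f, ρ, hf, hρ, hfast⟩ := exists_ranked_tree_from_level hG s (Fintype.card V + 1) 0 (by simp)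
  have hmem : ∀ u v, v ∈ childrenOf s f u ↔ v ≠ s ∧ f v = u := fun u v => by simp [childrenOf]
  refine ⟨⟨f, ρ, fun v hv => (hf v hv).1, fun v hv => (hf v hv).2, ?_, ?_, ?_⟩, ?_⟩
  · intro u hu
    rw [hρ u (Nat.zero_le _), rankFromChildren, if_pos]
    exact Finset.eq_empty_of_forall_notMem fun v hv =>
      hu v ((hmem u v).1 hv).1 ((hmem u v).1 hv).2
  · intro u v hv hvu h
    rw [hρ u (Nat.zero_le _)]
    exact rankFromChildren_unique ((hmem u v).2 ⟨hv, hvu⟩) fun w hw =>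
      h w ((hmem u w).1 hw).1 ((hmem u w).1 hw).2
  · intro u v v' hv hv' hne hvu hvu' he h
    rw [hρ u (Nat.zero_le _)]
    exact rankFromChildren_tie ((hmem u v).2 ⟨hv, hvu⟩) ((hmem u v').2 ⟨hv', hvu'⟩) hne he
      fun w hw => h w ((hmem u w).1 hw).1 ((hmem u w).1 hw).2
  · rintro u v u' v' ⟨hv, hvu, h1⟩ ⟨hv', hvu', h2⟩ hne hd he
    subst hvu hvu'
    exact hfast v v' hv hv' (Nat.zero_le _) h1 h2 hne hd he

end Existence

/-! ### Ranks and virtual distances -/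

namespace RankedBFSTree

variable {V : Type} [Fintype V] {G : SimpleGraph V} {s : V} (𝒯 : RankedBFSTree G s)

theorem rank_le_rank_parent {v : V} (hv : v ≠ s) : 𝒯.rank v ≤ 𝒯.rank (𝒯.parent v) := by
  classical
  have hne : (childrenOf s 𝒯.parent (𝒯.parent v)).Nonempty := ⟨v, by simp [childrenOf, hv]⟩
  obtain ⟨x, hx, hmax⟩ := Finset.exists_max_image _ 𝒯.rank hne
  simp only [childrenOf, Finset.mem_filter, Finset.mem_univ, true_and, and_imp] at hx hmax
  refine (hmax v hv rfl).trans ?_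
  by_cases h : ∃ y, y ≠ s ∧ 𝒯.parent y = 𝒯.parent v ∧ y ≠ x ∧ 𝒯.rank y = 𝒯.rank x
  · obtain ⟨y, hy, hyv, hyx, he⟩ := h
    rw [𝒯.rank_of_tie (𝒯.parent v) x y hx.1 hy hyx.symm hx.2 hyv he.symm hmax]
    omega
  · push Not at h
    rw [𝒯.rank_of_unique (𝒯.parent v) x hx.1 hx.2 fun w hw hwv hwx =>
      lt_of_le_of_ne (hmax w hw hwv) (h w hw hwv hwx)]

/-- Two children of maximal rank `r` contribute `2 * 2 ^ (r - 1) = 2 ^ r`; the summand 1 pays for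
leaves. -/
theorem two_pow_rank_le_sum (u : V) :
    2 ^ (𝒯.rank u - 1) ≤ 1 + ∑ v ∈ childrenOf s 𝒯.parent u, 2 ^ (𝒯.rank v - 1) := by
  classical
  rcases (childrenOf s 𝒯.parent u).eq_empty_or_nonempty with h | h
  · rw [𝒯.rank_leaf u fun v hv hvu => Finset.notMem_empty v
      (h ▸ (by simp [childrenOf, hv, hvu] : v ∈ childrenOf s 𝒯.parent u))]
    simp
  · obtain ⟨x, hx, hmax⟩ := Finset.exists_max_image _ 𝒯.rank h
    have hx0 := hx
    simp only [childrenOf, Finset.mem_filter, Finset.mem_univ, true_and, and_imp] at hx0 hmax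
    by_cases h : ∃ y, y ≠ s ∧ 𝒯.parent y = u ∧ y ≠ x ∧ 𝒯.rank y = 𝒯.rank x
    · obtain ⟨y, hy, hyv, hyx, he⟩ := h
      rw [𝒯.rank_of_tie u x y hx0.1 hy hyx.symm hx0.2 hyv he.symm hmax]
      have hsub : ({x, y} : Finset V) ⊆ childrenOf s 𝒯.parent u := by
        intro z hz
        simp only [Finset.mem_insert, Finset.mem_singleton] at hz
        rcases hz with rfl | rfl
        · exact hx
        · simp [childrenOf, hy, hyv]
      have h2 := Finset.sum_le_sum_of_subset (f := fun v => 2 ^ (𝒯.rank v - 1)) hsub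
      rw [Finset.sum_pair hyx.symm, he] at h2
      rcases Nat.eq_zero_or_pos (𝒯.rank x) with h0 | h0
      · simp [h0]
      · have : 2 ^ (𝒯.rank x + 1 - 1) = 2 ^ (𝒯.rank x - 1) * 2 := by
          rw [← pow_succ]; congr 1; omega
        rw [this]; omega
    · push Not at h
      rw [𝒯.rank_of_unique u x hx0.1 hx0.2 fun w hw hwv hwx =>
        lt_of_le_of_ne (hmax w hw hwv) (h w hw hwv hwx)]
      exact (Finset.single_le_sum (f := fun v => 2 ^ (𝒯.rank v - 1))
        (fun _ _ => Nat.zero_le _) hx).trans (by omega)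

theorem dist_lt_card (hG : G.Connected) (s v : V) : G.dist s v < Fintype.card V := by
  obtain ⟨p, hp, hp'⟩ := (hG.preconnected s v).exists_path_of_dist
  exact hp' ▸ hp.length_lt

theorem one_le_rank (hG : G.Connected) (u : V) : 1 ≤ 𝒯.rank u := by
  obtain ⟨j, hj⟩ : ∃ j, Fintype.card V ≤ G.dist s u + j := ⟨Fintype.card V, by omega⟩
  induction j generalizing u with
  | zero => exact absurd (dist_lt_card hG s u) (by omega)
  | succ j ih =>
    by_cases h : ∃ v, v ≠ s ∧ 𝒯.parent v = u
    · obtain ⟨v, hv, rfl⟩ := h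
      exact (ih v (by have := 𝒯.dist_parent v hv; omega)).trans (𝒯.rank_le_rank_parent hv)
    · push Not at h
      rw [𝒯.rank_leaf u h]

/-- Summing `two_pow_rank_le_sum` level by level, every node contributes its summand 1 once. At
level 0 this makes the rank of the root logarithmic. -/
theorem sum_two_pow_rank_le (hG : G.Connected) (j l : ℕ) (hl : Fintype.card V ≤ l + j) :
    ∑ u with G.dist s u = l, 2 ^ (𝒯.rank u - 1) ≤ (Finset.univ.filter fun u => l ≤ G.dist s u).card := by
  classical
  induction j generalizing l with
  | zero =>
    rw [Finset.sum_eq_zero]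
    · exact Nat.zero_le _
    · intro u hu
      have := dist_lt_card hG s u
      rw [Finset.mem_filter] at hu
      omega
  | succ j ih =>
    have h1 : ∑ u with G.dist s u = l, ∑ v ∈ childrenOf s 𝒯.parent u, 2 ^ (𝒯.rank v - 1) ≤
        ∑ v with G.dist s v = l + 1, 2 ^ (𝒯.rank v - 1) := by
      rw [← Finset.sum_biUnion]
      · refine Finset.sum_le_sum_of_subset fun v hv => ?_
        simp only [childrenOf, Finset.mem_biUnion, Finset.mem_filter, Finset.mem_univ,
          true_and] at hv ⊢
        obtain ⟨u, hu, hv, rfl⟩ := hv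
        rw [← 𝒯.dist_parent v hv, hu]
      · intro u _ u' _ hne
        refine Finset.disjoint_left.2 fun v hv hv' => hne ?_
        simp only [childrenOf, Finset.mem_filter, Finset.mem_univ, true_and] at hv hv'
        exact hv.2.symm.trans hv'.2
    have h2 : (Finset.univ.filter fun u => l ≤ G.dist s u) =
        (Finset.univ.filter fun u => G.dist s u = l) ∪
          (Finset.univ.filter fun u => l + 1 ≤ G.dist s u) := by
      ext u
      simp only [Finset.mem_filter, Finset.mem_univ, true_and, Finset.mem_union]
      omega
    have h3 : Disjoint (Finset.univ.filter fun u => G.dist s u = l)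
        (Finset.univ.filter fun u => l + 1 ≤ G.dist s u) := by
      refine Finset.disjoint_left.2 fun u hu hu' => ?_
      simp only [Finset.mem_filter, Finset.mem_univ, true_and] at hu hu'
      omega
    rw [h2, Finset.card_union_of_disjoint h3]
    refine (Finset.sum_le_sum fun u _ => 𝒯.two_pow_rank_le_sum u).trans ?_
    rw [Finset.sum_add_distrib, Finset.sum_const, smul_eq_mul, mul_one]
    exact Nat.add_le_add_left (h1.trans (ih (l + 1) (by omega))) _

theorem rank_le_rank_root (hG : G.Connected) (v : V) : 𝒯.rank v ≤ 𝒯.rank s := by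
  obtain ⟨j, hj⟩ : ∃ j, G.dist s v = j := ⟨_, rfl⟩
  induction j generalizing v with
  | zero => exact (congrArg 𝒯.rank (hG.dist_eq_zero_iff.1 hj).symm).le
  | succ j ih =>
    have hv : v ≠ s := by rintro rfl; simp at hj
    exact (𝒯.rank_le_rank_parent hv).trans (ih _ (by have := 𝒯.dist_parent v hv; omega))

theorem rank_le_clog (hG : G.Connected) (v : V) : 𝒯.rank v ≤ Nat.clog 2 (Fintype.card V) + 1 := by
  classical
  have h := 𝒯.sum_two_pow_rank_le hG (Fintype.card V) 0 (by omega)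
  have h1 : 2 ^ (𝒯.rank s - 1) ≤ Fintype.card V :=
    (Finset.single_le_sum (f := fun v => 2 ^ (𝒯.rank v - 1)) (fun _ _ => Nat.zero_le _)
      (by simp : s ∈ Finset.univ.filter fun u => G.dist s u = 0)).trans
      (h.trans (Finset.card_le_univ _))
  have h2 : Fintype.card V ≤ 2 ^ Nat.clog 2 (Fintype.card V) := Nat.le_pow_clog one_lt_two _
  have h3 := (Nat.pow_le_pow_iff_right one_lt_two).1 (h1.trans h2)
  have := 𝒯.rank_le_rank_root hG v
  omega

theorem rank_le_maxRank (v : V) : 𝒯.rank v ≤ 𝒯.maxRank := Finset.le_sup (Finset.mem_univ v)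

theorem maxRank_le_clog (hG : G.Connected) : 𝒯.maxRank ≤ Nat.clog 2 (Fintype.card V) + 1 :=
  Finset.sup_le fun v _ => 𝒯.rank_le_clog hG v

end RankedBFSTree

/-! ### Virtual distances and collision-free fast transmissions. -/

namespace RankedBFSTree

variable {V : Type} {G : SimpleGraph V} {s : V} (𝒯 : RankedBFSTree G s)

theorem virtualDist_le {v : V} {d : ℕ} (x : ℕ → V) (h0 : x 0 = s) (hd : x d = v)
    (h : ∀ i < d, G.Adj (x i) (x (i + 1)) ∨ Relation.TransGen 𝒯.FastEdge (x i) (x (i + 1))) :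
    𝒯.virtualDist v ≤ d := Nat.sInf_le ⟨x, h0, hd, h⟩

theorem exists_virtualDist_path (hG : G.Connected) (v : V) :
    ∃ x : ℕ → V, x 0 = s ∧ x (𝒯.virtualDist v) = v ∧ ∀ i < 𝒯.virtualDist v,
      G.Adj (x i) (x (i + 1)) ∨ Relation.TransGen 𝒯.FastEdge (x i) (x (i + 1)) := by
  refine Nat.sInf_mem (s := {d | ∃ x : ℕ → V, x 0 = s ∧ x d = v ∧
    ∀ i < d, G.Adj (x i) (x (i + 1)) ∨ Relation.TransGen 𝒯.FastEdge (x i) (x (i + 1))}) ?_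
  obtain ⟨p⟩ := hG.preconnected s v
  exact ⟨p.length, p.getVert, p.getVert_zero, p.getVert_length,
    fun i hi => Or.inl (p.adj_getVert_succ hi)⟩

theorem virtualDist_root : 𝒯.virtualDist s = 0 :=
  Nat.le_zero.1 (𝒯.virtualDist_le (fun _ => s) rfl rfl fun _ h => absurd h (Nat.not_lt_zero _))

theorem eq_root_of_virtualDist_eq_zero (hG : G.Connected) {v : V} (h : 𝒯.virtualDist v = 0) :
    v = s := by
  obtain ⟨x, h0, hd, -⟩ := 𝒯.exists_virtualDist_path hG v
  rw [h, h0] at hd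
  exact hd.symm

theorem virtualDist_le_add_one (hG : G.Connected) {u v : V}
    (h : G.Adj u v ∨ Relation.TransGen 𝒯.FastEdge u v) :
    𝒯.virtualDist v ≤ 𝒯.virtualDist u + 1 := by
  obtain ⟨x, h0, hd, hx⟩ := 𝒯.exists_virtualDist_path hG u
  refine 𝒯.virtualDist_le (fun i => if i ≤ 𝒯.virtualDist u then x i else v) (by simpa using h0)
    (by simp) fun i hi => ?_
  rcases Nat.lt_succ_iff_lt_or_eq.1 hi with hi | rfl
  · simpa [hi.le, Nat.succ_le_of_lt hi] using hx i hi
  · simpa [hd] using h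

theorem exists_virtualDist_pred (hG : G.Connected) {v : V} {d : ℕ} (h : 𝒯.virtualDist v = d + 1) :
    ∃ u, 𝒯.virtualDist u = d ∧ (G.Adj u v ∨ Relation.TransGen 𝒯.FastEdge u v) := by
  obtain ⟨x, h0, hd, hx⟩ := 𝒯.exists_virtualDist_path hG v
  rw [h] at hd hx
  have h1 := hx d (Nat.lt_succ_self d)
  rw [hd] at h1
  refine ⟨x d, le_antisymm (𝒯.virtualDist_le x h0 rfl fun i hi => hx i (by omega)) ?_, h1⟩
  have := 𝒯.virtualDist_le_add_one hG h1
  omega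

/-- A node other than the root has a neighbour of smaller virtual distance, or it is the child of a
fast edge whose parent has the same virtual distance. -/
theorem exists_adj_or_fastEdge (hG : G.Connected) {w : V} {d : ℕ} (h : 𝒯.virtualDist w = d + 1) :
    (∃ u, G.Adj u w ∧ 𝒯.virtualDist u = d) ∨
      (𝒯.FastEdge (𝒯.parent w) w ∧ 𝒯.virtualDist (𝒯.parent w) = d + 1) := by
  by_cases hA : ∃ u, G.Adj u w ∧ 𝒯.virtualDist u = d
  · exact Or.inl hA
  · obtain ⟨u, hu, huw⟩ := 𝒯.exists_virtualDist_pred hG h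
    rcases huw with huw | huw
    · exact absurd ⟨u, huw, hu⟩ hA
    -- The last edge of the shortcut joins `x` to `w`. As `x` is `u` or reached from `u` by a
    -- shortcut, its virtual distance is at most `d + 1`; as it is adjacent to `w`, it is at least
    -- `d`, and `d` is excluded.
    · obtain ⟨x, hux, hxw⟩ := Relation.TransGen.tail'_iff.1 huw
      have hpx : 𝒯.parent w = x := hxw.2.1
      have hadj : G.Adj x w := hpx ▸ 𝒯.adj_parent w hxw.1
      have hne : 𝒯.virtualDist x ≠ d := fun hx => hA ⟨x, hadj, hx⟩
      have h1 := 𝒯.virtualDist_le_add_one hG (Or.inl hadj)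
      have h2 : 𝒯.virtualDist x ≤ d + 1 := by
        rcases Relation.reflTransGen_iff_eq_or_transGen.1 hux with rfl | hux
        · omega
        · have := 𝒯.virtualDist_le_add_one hG (Or.inr hux)
          omega
      exact Or.inr ⟨hpx ▸ hxw, by rw [hpx]; omega⟩

/-- Along the tree path from the root, each drop of the rank costs at most two virtual steps: a
shortcut along the fast stretch and one slow edge. In `key`, `x` is a node of the stretch of `v`
from which one more shortcut leads to `v`. -/
theorem virtualDist_le_clog [Fintype V] (hG : G.Connected) (v : V) :
    𝒯.virtualDist v ≤ 2 * Nat.clog 2 (Fintype.card V) + 1 := by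
  have key : ∀ (j : ℕ) (v : V), G.dist s v = j → ∃ x, Relation.ReflTransGen 𝒯.FastEdge x v ∧
      𝒯.virtualDist x + 2 * 𝒯.rank v ≤ 2 * 𝒯.rank s := by
    intro j
    induction j with
    | zero =>
      intro v hv
      obtain rfl := hG.dist_eq_zero_iff.1 hv
      exact ⟨s, .refl, by rw [virtualDist_root]; omega⟩
    | succ j ih =>
      intro v hv
      have hvs : v ≠ s := by rintro rfl; simp at hv
      obtain ⟨x, hx, hle⟩ := ih (𝒯.parent v) (by have := 𝒯.dist_parent v hvs; omega)
      by_cases hf : 𝒯.rank v = 𝒯.rank (𝒯.parent v)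
      · exact ⟨x, hx.tail ⟨hvs, rfl, hf⟩, by rw [hf]; exact hle⟩
      · refine ⟨v, .refl, ?_⟩
        have h1 := 𝒯.rank_le_rank_parent hvs
        have h2 := 𝒯.virtualDist_le_add_one hG (Or.inl (𝒯.adj_parent v hvs))
        have h3 : 𝒯.virtualDist (𝒯.parent v) ≤ 𝒯.virtualDist x + 1 := by
          rcases Relation.reflTransGen_iff_eq_or_transGen.1 hx with h | h
          · rw [h]; omega
          · exact 𝒯.virtualDist_le_add_one hG (Or.inr h)
        omega
  obtain ⟨x, hx, hle⟩ := key _ v rfl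
  have h1 := 𝒯.rank_le_clog hG s
  have h2 := 𝒯.one_le_rank hG v
  have h3 : 𝒯.virtualDist v ≤ 𝒯.virtualDist x + 1 := by
    rcases Relation.reflTransGen_iff_eq_or_transGen.1 hx with h | h
    · rw [h]; omega
    · exact 𝒯.virtualDist_le_add_one hG (Or.inr h)
  omega

/-- In an even round the parent of a fast edge that is told to broadcast is the only broadcasting
neighbour of the child, which is silent. -/
theorem IsGBST.broadcasts_even [Fintype V] {𝒯 : RankedBFSTree G s} (hT : 𝒯.IsGBST)
    (hG : G.Connected) {c t : ℕ} (ht : t % 2 = 0) {u v : V} (huv : 𝒯.FastEdge u v)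
    (h1 : ((G.dist s u / blockSize (Fintype.card V) : ℕ) : ℤ) - 6 * (𝒯.rank u : ℤ) ≡
      ((t / 2 / (c * blockSize (Fintype.card V)) : ℕ) : ℤ) [ZMOD 6 * (𝒯.maxRank : ℤ)])
    (h2 : G.dist s u ≡ t [MOD 3]) (b : V → Bool) :
    G.Adj u v ∧ Broadcasts 𝒯 c t u (b u) ∧ ¬ Broadcasts 𝒯 c t v (b v) ∧
      ∀ x, G.Adj x v → x ≠ u → ¬ Broadcasts 𝒯 c t x (b x) := by
  obtain ⟨hv, rfl, hr⟩ := huv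
  have hadj := 𝒯.adj_parent v hv
  have hd := 𝒯.dist_parent v hv
  have hB : ∀ x, Broadcasts 𝒯 c t x (b x) ↔ 𝒯.Fast x ∧
      ((G.dist s x / blockSize (Fintype.card V) : ℕ) : ℤ) - 6 * (𝒯.rank x : ℤ) ≡
      ((t / 2 / (c * blockSize (Fintype.card V)) : ℕ) : ℤ) [ZMOD 6 * (𝒯.maxRank : ℤ)] ∧
      G.dist s x ≡ t [MOD 3] := by
    intro x
    unfold Broadcasts
    rw [if_neg (by omega)]
  simp only [hB]
  refine ⟨hadj, ⟨⟨v, hv, rfl, hr⟩, h1, h2⟩, fun h => ?_, fun x hx hne h => ?_⟩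
  · have := h.2.2
    unfold Nat.ModEq at this h2
    omega
  · obtain ⟨⟨y, hy, hyx, hry⟩, hx1, hx2⟩ := h
    -- The neighbours of `v` lie on three consecutive levels, so the residue modulo 3 singles out
    -- the level of the parent.
    have hdx : G.dist s x = G.dist s (𝒯.parent v) := by
      have e1 := dist_le_dist_add_one hG s hx.symm
      have e2 := dist_le_dist_add_one hG s hx
      unfold Nat.ModEq at hx2 h2
      omega
    have hdy := 𝒯.dist_parent y hy
    rw [hyx] at hdy
    rw [hdx] at hx1
    -- On one level the schedule makes `6 * rank` agree modulo `6 * maxRank`, and ranks lie between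
    -- 1 and `maxRank`. What remains is excluded by the GBST property.
    have hrr : 𝒯.rank x = 𝒯.rank (𝒯.parent v) := by
      have e := (h1.trans hx1.symm).dvd
      obtain ⟨q, hq⟩ := e
      have a1 := 𝒯.rank_le_maxRank x
      have a2 := 𝒯.rank_le_maxRank (𝒯.parent v)
      have a3 := 𝒯.one_le_rank hG x
      have a4 := 𝒯.one_le_rank hG (𝒯.parent v)
      have hq' : (𝒯.rank (𝒯.parent v) : ℤ) - 𝒯.rank x = 𝒯.maxRank * q := by linarith
      have hq0 : q = 0 := by
        by_contra hq0
        rcases lt_or_gt_of_ne hq0 with h | h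
        · nlinarith
        · nlinarith
      rw [hq0] at hq'
      omega
    exact hT x y (𝒯.parent v) v ⟨hy, hyx, hry⟩ ⟨hv, rfl, hr⟩ hne (by omega) (by omega) hx

end RankedBFSTree

/-! ### Spreading along slow and fast edges -/

/-- A slow step: within `6 L` rounds the value at `w` moves towards the values at the nodes of
smaller virtual distance. -/
def SlowStep {V : Type} (lev vd : V → ℕ) (f : ℕ → V → ℝ) (L t₀ t₁ : ℕ) (q : ℝ) (w : V) : Prop :=
  ∀ (t : ℕ) (B Q : ℝ), t₀ ≤ t → t + 6 * L ≤ t₁ → Q ≤ B → f t w ≤ B →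
    (∀ u, vd u + 1 = vd w → lev u ≤ lev w + 1 → f t u ≤ Q) → f (t + 6 * L) w ≤ (1 - q) * B + q * Q

/-- A fast step: in every active round of the fast edge from `par w` to `w` the value at `w` moves
towards the value at `par w`. -/
def FastStep {V : Type} (lev vd rk : V → ℕ) (par : V → V) (f : ℕ → V → ℝ) (S R c t₀ t₁ : ℕ) (ρ : ℝ)
    (w : V) : Prop :=
  lev (par w) + 1 = lev w ∧ vd (par w) = vd w ∧ rk (par w) = rk w ∧
    ∀ t, t₀ ≤ t → t < t₁ → t % 2 = 0 →
      (((lev w - 1) / S : ℕ) : ℤ) - 6 * (rk w : ℤ) ≡ ((t / 2 / (c * S) : ℕ) : ℤ)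
        [ZMOD 6 * (R : ℤ)] →
      lev w - 1 ≡ t [MOD 3] → f (t + 1) w ≤ (1 - ρ) * f t w + ρ * f t (par w)

/-- The rules for the probabilities `f t w` that `w` is uninformed after `t` rounds; the nodes up to
level `lo` are informed, and only the nodes `w` with `lev w + vd w ≤ hi` are considered. -/
structure SpreadRules {V : Type} (lev vd rk : V → ℕ) (par : V → V) (f : ℕ → V → ℝ)
    (L S R c lo hi t₀ t₁ : ℕ) (ρ q : ℝ) : Prop where
  le_one : ∀ t w, t₀ ≤ t → t ≤ t₁ → f t w ≤ 1
  succ_le : ∀ t w, t₀ ≤ t → t < t₁ → f (t + 1) w ≤ f t w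
  low : ∀ t w, t₀ ≤ t → t ≤ t₁ → lev w ≤ lo → f t w ≤ 0
  step : ∀ w, lo < lev w → lev w + vd w ≤ hi →
    SlowStep lev vd f L t₀ t₁ q w ∨ FastStep lev vd rk par f S R c t₀ t₁ ρ w

/-- Among the last `R` completed blocks of `N` rounds one has a number with a given residue. -/
theorem exists_modEq_block {N R t : ℕ} (hN : 1 ≤ N) (hR : 1 ≤ R) (ht : N * R ≤ t) (y : ℤ) :
    ∃ j : ℕ, N * (j + 1) ≤ t ∧ t ≤ N * (j + 1) + N * R ∧ y ≡ (j : ℤ) [ZMOD (R : ℕ)] := by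
  have hJR : R ≤ t / N := by rwa [Nat.le_div_iff_mul_le hN, mul_comm]
  have hRpos : (0 : ℤ) < (R : ℤ) := by omega
  have h1 := Int.emod_lt_of_pos (y - (t / N - R : ℕ)) hRpos
  have h2 := Int.emod_nonneg (y - (t / N - R : ℕ)) hRpos.ne'
  refine ⟨t / N - R + ((y - (t / N - R : ℕ)) % (R : ℤ)).toNat, ?_, ?_, ?_⟩
  · exact (Nat.mul_le_mul_left N (by omega)).trans (Nat.mul_div_le t N)
  · have h3 : t < N * (t / N + 1) := Nat.lt_mul_div_succ t hN
    rw [← mul_add]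
    exact h3.le.trans (Nat.mul_le_mul_left N (by omega))
  · rw [Nat.cast_add, Int.toNat_of_nonneg h2]
    have := (Int.mod_modEq (y - (t / N - R : ℕ)) (R : ℤ)).symm.add_left ((t / N - R : ℕ) : ℤ)
    rwa [add_sub_cancel] at this

namespace SpreadRules

variable {V : Type} {lev vd rk : V → ℕ} {par : V → V} {f : ℕ → V → ℝ}
  {L S R c lo hi t₀ t₁ : ℕ} {ρ q : ℝ}

theorem antitone (h : SpreadRules lev vd rk par f L S R c lo hi t₀ t₁ ρ q) {t t' : ℕ} (w : V)
    (h0 : t₀ ≤ t) (htt : t ≤ t') (h1 : t' ≤ t₁) : f t' w ≤ f t w := by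
  induction t', htt using Nat.le_induction with
  | base => exact le_rfl
  | succ n hn ih => exact (h.succ_le n w (h0.trans hn) h1).trans (ih (by omega))

/-- Progress along a fast stretch during one active block of rounds. -/
theorem fast_block (h : SpreadRules lev vd rk par f L S R c lo hi t₀ t₁ ρ q) (hS : 1 ≤ S)
    (hρ0 : 0 ≤ ρ) (hρ1 : ρ ≤ 1) {j d r b : ℕ} {U Q : ℝ} (hU : 0 ≤ U) (hQ : 0 ≤ Q)
    (h0 : t₀ ≤ 2 * (c * S) * j) (h1 : 2 * (c * S) * (j + 1) ≤ t₁)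
    (hact : (b : ℤ) - 6 * (r : ℤ) ≡ (j : ℤ) [ZMOD 6 * (R : ℤ)])
    (hslow : ∀ x, lo < lev x → lev x + vd x ≤ hi → vd x = d → (lev x - 1) / S = b →
      SlowStep lev vd f L t₀ t₁ q x → f (2 * (c * S) * j) x ≤ U)
    (hprev : ∀ x, lo < lev x → lev x + vd x ≤ hi → vd x = d → rk x = r → (lev x - 1) / S + 1 = b →
      f (2 * (c * S) * j) x ≤ U)
    (hall : ∀ x, lo < lev x → lev x + vd x ≤ hi → vd x = d → (lev x - 1) / S = b →
      f (2 * (c * S) * j) x ≤ Q) (i : ℕ) (hi' : 6 * i ≤ 2 * (c * S)) (x : V) (hx : lo < lev x)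
    (hxh : lev x + vd x ≤ hi) (hxd : vd x = d) (hxr : rk x = r) (hxb : (lev x - 1) / S = b) :
    f (2 * (c * S) * j + 6 * i) x ≤ U + Q * 2 ^ (lev x - b * S) * (1 - ρ / 2) ^ i := by
  have hγ : 0 ≤ 1 - ρ / 2 := by linarith
  have hexp : 2 * (c * S) * (j + 1) = 2 * (c * S) * j + 2 * (c * S) := by ring
  rw [hexp] at h1
  -- The weight 2 per level makes the recursion close exactly: `(1 - ρ) * 2 + ρ = 2 * (1 - ρ / 2)`.
  induction i generalizing x with
  | zero =>
    have e1 := hall x hx hxh hxd hxb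
    have e2 : (1 : ℝ) ≤ 2 ^ (lev x - b * S) := one_le_pow₀ one_le_two
    simp only [mul_zero, add_zero, pow_zero, mul_one]
    nlinarith
  | succ i ih =>
    set T := 2 * (c * S) * j with hT
    have hpos : 0 ≤ Q * 2 ^ (lev x - b * S) * (1 - ρ / 2) ^ (i + 1) := by positivity
    rcases h.step x hx hxh with hs | ⟨hl, hv, hr, hf⟩
    · have e1 := hslow x hx hxh hxd hxb hs
      have e2 := h.antitone x h0 (Nat.le_add_right T (6 * (i + 1))) (by omega)
      linarith
    · obtain ⟨t, ht1, ht2, ht3, ht4⟩ : ∃ t, T + 6 * i ≤ t ∧ t < T + 6 * (i + 1) ∧ t % 2 = 0 ∧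
          (lev x - 1) % 3 = t % 3 := by
        -- An even number congruent to `y` modulo 3 is congruent to `4 * y` modulo 6; this is the
        -- first such round from `T + 6 * i` on.
        refine ⟨T + 6 * i + (6 - T % 6 + 4 * ((lev x - 1) % 3)) % 6, ?_, ?_, ?_, ?_⟩
        · omega
        · omega
        · omega
        · omega
      have hcS : 0 < c * S := by
        rcases Nat.eq_zero_or_pos (c * S) with h0 | h0
        · omega
        · exact h0
      have htj : t / 2 / (c * S) = j := by
        rw [Nat.div_div_eq_div_mul]
        refine Nat.div_eq_of_lt_le ?_ ?_
        · rw [mul_comm]; exact le_trans (by omega) ht1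
        · rw [mul_comm, hexp]; omega
      have e1 := hf t (by omega) (by omega) ht3 (by rw [hxb, hxr, htj]; exact hact) ht4
      have e2 := h.antitone x (by omega : t₀ ≤ t + 1) (by omega : t + 1 ≤ T + 6 * (i + 1)) (by omega)
      have e3 := h.antitone x (by omega : t₀ ≤ T + 6 * i) ht1 (by omega)
      have e4 := h.antitone (par x) (by omega : t₀ ≤ T + 6 * i) ht1 (by omega)
      have e5 := ih (by omega) x hx hxh hxd hxr hxb
      have hb1 : b * S ≤ lev x - 1 := by rw [← hxb]; exact Nat.div_mul_le_self _ _
      have hpow : (2 : ℝ) ^ (lev x - b * S) = 2 * 2 ^ (lev (par x) - b * S) := by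
        rw [← pow_succ']; congr 1; omega
      have e6 : f (T + 6 * i) (par x) ≤
          U + Q * 2 ^ (lev (par x) - b * S) * (1 - ρ / 2) ^ i := by
        have hpos' : 0 ≤ Q * 2 ^ (lev (par x) - b * S) * (1 - ρ / 2) ^ i := by positivity
        by_cases hlo : lev (par x) ≤ lo
        · have := h.low (T + 6 * i) (par x) (by omega) (by omega) hlo
          linarith
        · by_cases hblk : b * S ≤ lev (par x) - 1
          · refine ih (by omega) (par x) (by omega) (by omega) (by omega) (by omega) ?_
            refine le_antisymm ?_ ((Nat.le_div_iff_mul_le hS).2 hblk)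
            rw [← hxb]
            exact Nat.div_le_div_right (by omega)
          -- Blocks are cut by `(lev - 1) / S`, the level of the transmitting parent, so a node on
          -- level `b * S` still belongs to the preceding block and is covered by `hprev`.
          · have hlev : lev (par x) = b * S := by omega
            have hb0 : b ≠ 0 := by rintro rfl; omega
            obtain ⟨b', rfl⟩ := Nat.exists_eq_succ_of_ne_zero hb0
            have hbb : (lev (par x) - 1) / S + 1 = b' + 1 := by
              congr 1
              rw [hlev]
              refine Nat.div_eq_of_lt_le ?_ ?_ <;> rw [Nat.succ_mul] <;> omega
            have e7 := hprev (par x) (by omega) (by omega) (by omega) (by omega) hbb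
            have e8 := h.antitone (par x) h0 (Nat.le_add_right T (6 * i)) (by omega)
            linarith
      have hγi : 0 ≤ Q * 2 ^ (lev (par x) - b * S) * (1 - ρ / 2) ^ i := by positivity
      rw [hpow] at e5 ⊢
      calc f (T + 6 * (i + 1)) x ≤ (1 - ρ) * f t x + ρ * f t (par x) := e2.trans e1
        _ ≤ (1 - ρ) * (U + Q * (2 * 2 ^ (lev (par x) - b * S)) * (1 - ρ / 2) ^ i) +
            ρ * (U + Q * 2 ^ (lev (par x) - b * S) * (1 - ρ / 2) ^ i) := by
          refine add_le_add (mul_le_mul_of_nonneg_left (e3.trans e5) (by linarith))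
            (mul_le_mul_of_nonneg_left (e4.trans e6) hρ0)
        _ = U + Q * (2 * 2 ^ (lev (par x) - b * S)) * (1 - ρ / 2) ^ (i + 1) := by ring

set_option maxHeartbeats 1000000 in
/-- Exponential decay of the probability of being uninformed. -/
theorem exp_decay (h : SpreadRules lev vd rk par f L S R c lo hi t₀ t₁ ρ q) (hS : 1 ≤ S)
    (hc : 1 ≤ c) (hL : 1 ≤ L) (hR : 1 ≤ R) (hRL : R ≤ 2 * L) (hρ0 : 0 ≤ ρ) (hρ1 : ρ ≤ 1)
    (hq0 : 0 < q) (hq1 : q ≤ 1) {θ a z K : ℝ} (hθ0 : 0 < θ) (hθ1 : θ ≤ 1)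
    (hθ : θ ^ (72 * (c * S) * L) = 1 - q / 2) (ha : a = θ ^ (2 * (c * S))) (hz : z * a ^ 2 = 1)
    (hK : K * q = 64) (hε : 2 * (2 ^ S * (1 - ρ / 2) ^ (c * S / 3)) ≤ a * (1 - a)) (t : ℕ)
    (ht0 : t₀ ≤ t) (ht1 : t ≤ t₁) (w : V) (hw : lo < lev w) (hwh : lev w + vd w ≤ hi) :
    f t w ≤ 16 * (K ^ vd w * z ^ ((lev w - 1) / S - lo / S)) * θ ^ (t - t₀) := by
  have hcS : 1 ≤ c * S := Nat.mul_pos hc hS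
  have hcSL : c * S ≤ c * S * L := Nat.le_mul_of_pos_right _ hL
  have hM : 72 * (c * S) * L = 72 * (c * S * L) := by ring
  have hLc : L ≤ c * S * L := Nat.le_mul_of_pos_left _ hcS
  rw [hM] at hθ
  have hθhalf : ∀ n, n ≤ 72 * (c * S * L) → 1 / 2 ≤ θ ^ n := by
    intro n hn
    refine le_trans ?_ (pow_le_pow_of_le_one hθ0.le hθ1 hn)
    rw [hθ]; linarith
  have ha0 : 1 / 2 ≤ a := ha ▸ hθhalf _ (by omega)
  have ha1 : a ≤ 1 := ha ▸ pow_le_one₀ hθ0.le hθ1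
  have hz1 : 1 ≤ z := by
    by_contra hz1
    push Not at hz1
    have : a ^ 2 ≤ 1 := pow_le_one₀ (by linarith) ha1
    nlinarith [sq_nonneg a, pow_pos (by linarith : 0 < a) 2]
  have ha4 : 1 / 4 ≤ a ^ 2 := by nlinarith
  have hz4 : z ≤ 4 := by nlinarith
  have hK1 : 1 ≤ K := by nlinarith
  -- `K` is the price of a virtual step and `z = a⁻²` that of a block of levels, where `a` is the
  -- time factor of one block of rounds.
  set X : V → ℝ := fun w => K ^ vd w * z ^ ((lev w - 1) / S - lo / S) with hX
  have hX1 : ∀ w, 1 ≤ X w := fun w => one_le_mul_of_one_le_of_one_le (one_le_pow₀ hK1) (one_le_pow₀ hz1)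
  -- Three constants let the induction close: 2 for targets of slow steps, 8 at the end of an active
  -- block of rounds, 16 at all times.
  suffices H : ∀ t, t₀ ≤ t → t ≤ t₁ → ∀ w, lo < lev w → lev w + vd w ≤ hi →
      (SlowStep lev vd f L t₀ t₁ q w → f t w ≤ 2 * X w * θ ^ (t - t₀)) ∧
      (∀ j : ℕ, t = 2 * (c * S) * (j + 1) →
        (((lev w - 1) / S : ℕ) : ℤ) - 6 * (rk w : ℤ) ≡ (j : ℤ) [ZMOD 6 * (R : ℤ)] →
        f t w ≤ 8 * X w * θ ^ (t - t₀)) ∧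
      f t w ≤ 16 * X w * θ ^ (t - t₀) from (H t ht0 ht1 w hw hwh).2.2
  intro t
  induction t using Nat.strong_induction_on with
  | _ t IH =>
  intro ht0 ht1 w hw hwh
  have hXw := hX1 w
  -- In this initial period the time factor is still at least `1 / 2`, so the bounds follow from `f
  -- ≤ 1`.
  by_cases hsmall : t < t₀ + 72 * (c * S * L)
  · have e1 := hθhalf (t - t₀) (by omega)
    have e2 := h.le_one t w ht0 ht1
    have e3 : 1 / 2 ≤ X w * θ ^ (t - t₀) := by nlinarith
    exact ⟨fun _ => by linarith, fun _ _ _ => by linarith, by linarith⟩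
  push Not at hsmall
  have hA : SlowStep lev vd f L t₀ t₁ q w → f t w ≤ 2 * X w * θ ^ (t - t₀) := by
    intro hs
    set t' := t - 72 * (c * S * L) with ht'
    have e1 := (IH t' (by omega) (by omega) (by omega) w hw hwh).1 hs
    have hB : 0 ≤ X w * θ ^ (t' - t₀) := by positivity
    -- Nodes of smaller virtual distance obey `q / 2` times the bound at `w`, since the factor `K =
    -- 64 / q` outweighs 16 and a possible extra block, `z ≤ 4`. The step then gains `1 - q + q ^ 2
    -- / 2 ≤ 1 - q / 2`, just what `θ` loses in the window.
    have e2 := hs t' (2 * X w * θ ^ (t' - t₀)) (q / 2 * (2 * X w * θ ^ (t' - t₀))) (by omega)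
      (by omega) (by nlinarith) e1 ?_
    · refine (h.antitone w (by omega) (by omega : t' + 6 * L ≤ t) ht1).trans (e2.trans ?_)
      have hpow : θ ^ (t - t₀) = θ ^ (t' - t₀) * (1 - q / 2) := by
        rw [← hθ, ← pow_add]; congr 1; omega
      rw [hpow]
      nlinarith [mul_nonneg hq0.le hB, mul_nonneg (sub_nonneg.2 hq1) (mul_nonneg hq0.le hB)]
    · intro u hu1 hu2
      by_cases hlo : lev u ≤ lo
      · refine (h.low t' u (by omega) (by omega) hlo).trans (by positivity)
      -- The node `u` may be one level deeper than `w`, but its virtual distance is one smaller, so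
      -- `lev + vd ≤ hi` persists.
      · have e3 := (IH t' (by omega) (by omega) (by omega) u (by omega) (by omega)).2.2
        refine e3.trans ?_
        have hXu : X u * K ≤ X w * z := by
          have h1 : K ^ vd w = K ^ vd u * K := by rw [← hu1, pow_succ]
          have h2 : (lev u - 1) / S - lo / S ≤ (lev w - 1) / S - lo / S + 1 := by
            have : (lev u - 1) / S ≤ (lev w - 1) / S + 1 := by
              rw [← Nat.add_div_right _ hS]
              exact Nat.div_le_div_right (by omega)
            omega
          have h3 := pow_le_pow_right₀ hz1 h2
          rw [pow_succ] at h3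
          simp only [hX]
          rw [h1]
          calc K ^ vd u * z ^ ((lev u - 1) / S - lo / S) * K
              = K ^ vd u * K * z ^ ((lev u - 1) / S - lo / S) := by ring
            _ ≤ K ^ vd u * K * (z ^ ((lev w - 1) / S - lo / S) * z) := by gcongr
            _ = _ := by ring
        have hXu' : 16 * X u ≤ q * X w := by
          have h1 : X u * 64 ≤ q * X w * 4 := by
            calc X u * 64 = q * (X u * K) := by rw [← hK]; ring
              _ ≤ q * (X w * z) := by gcongr
              _ ≤ q * (X w * 4) := by gcongr
              _ = _ := by ring
          linarith
        calc 16 * X u * θ ^ (t' - t₀) ≤ q * X w * θ ^ (t' - t₀) := by gcongr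
          _ = _ := by ring
  have hB : ∀ j : ℕ, t = 2 * (c * S) * (j + 1) →
      (((lev w - 1) / S : ℕ) : ℤ) - 6 * (rk w : ℤ) ≡ (j : ℤ) [ZMOD 6 * (R : ℤ)] →
      f t w ≤ 8 * X w * θ ^ (t - t₀) := by
    intro j hj hact
    have hexp : 2 * (c * S) * (j + 1) = 2 * (c * S) * j + 2 * (c * S) := by ring
    set T := 2 * (c * S) * j with hT
    have hθT : 0 ≤ X w * θ ^ (T - t₀) := by positivity
    have hXeq : ∀ x, vd x = vd w → (lev x - 1) / S = (lev w - 1) / S → X x = X w := by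
      intro x h1 h2
      simp only [hX, h1, h2]
    -- `U` covers slow targets because `2 ≤ 8 * a ^ 2`, and the preceding block of levels because `z
    -- * a ^ 2 = 1`. Time costs only the factor `a`, and by `hε` the slack `a - a ^ 2` absorbs the
    -- error term of `fast_block`.
    have e1 := h.fast_block hS hρ0 hρ1 (j := j) (d := vd w) (r := rk w) (b := (lev w - 1) / S)
      (U := 8 * X w * a ^ 2 * θ ^ (T - t₀)) (Q := 16 * X w * θ ^ (T - t₀)) (by positivity)
      (by positivity) (by omega) (by omega) hact ?_ ?_ ?_ (c * S / 3) (by omega) w hw hwh rfl rfl rfl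
    · have e2 := h.antitone w (by omega : t₀ ≤ T + 6 * (c * S / 3))
        (by omega : T + 6 * (c * S / 3) ≤ t) ht1
      have e3 : (2 : ℝ) ^ (lev w - (lev w - 1) / S * S) ≤ 2 ^ S := by
        refine pow_le_pow_right₀ one_le_two ?_
        have h1 := Nat.div_add_mod (lev w - 1) S
        have h2 := Nat.mod_lt (lev w - 1) hS
        rw [mul_comm S] at h1
        omega
      have hpow : θ ^ (t - t₀) = θ ^ (T - t₀) * a := by
        rw [ha, ← pow_add]; congr 1; omega
      have hγ : 0 ≤ (1 - ρ / 2) ^ (c * S / 3) := pow_nonneg (by linarith) _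
      rw [hpow]
      refine e2.trans (e1.trans ?_)
      calc 8 * X w * a ^ 2 * θ ^ (T - t₀) + 16 * X w * θ ^ (T - t₀) *
            2 ^ (lev w - (lev w - 1) / S * S) * (1 - ρ / 2) ^ (c * S / 3)
          ≤ 8 * X w * a ^ 2 * θ ^ (T - t₀) + 16 * X w * θ ^ (T - t₀) *
            2 ^ S * (1 - ρ / 2) ^ (c * S / 3) := by gcongr
        _ = 8 * (X w * θ ^ (T - t₀)) * (a ^ 2 + 2 * (2 ^ S * (1 - ρ / 2) ^ (c * S / 3))) := by ring
        _ ≤ 8 * (X w * θ ^ (T - t₀)) * (a ^ 2 + a * (1 - a)) := by gcongr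
        _ = _ := by ring
    · intro x hx hxh hxd hxb hs
      have e2 := (IH T (by omega) (by omega) (by omega) x hx hxh).1 hs
      rw [hXeq x hxd hxb] at e2
      nlinarith
    · intro x hx hxh hxd hxr hxb
      have hj1 : 1 ≤ j := by
        rcases Nat.eq_zero_or_pos j with h0 | h0
        · rw [h0] at hT; omega
        · exact h0
      obtain ⟨j', rfl⟩ : ∃ j', j = j' + 1 := ⟨j - 1, by omega⟩
      -- The wave advances one block of levels per block of rounds: the preceding level block was
      -- active in the preceding block of rounds.
      have e2 := (IH T (by omega) (by omega) (by omega) x hx hxh).2.1 j' hT (by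
        rw [← hxb] at hact
        rw [hxr]
        have := hact.sub_right 1
        push_cast at this ⊢
        convert this using 1 <;> ring)
      refine e2.trans ?_
      have hlo : lo / S ≤ (lev x - 1) / S := Nat.div_le_div_right (by omega)
      have hXx : X w = X x * z := by
        simp only [hX, hxd, ← hxb]
        rw [mul_assoc, ← pow_succ]
        congr 2
        omega
      rw [hXx]
      have : 8 * (X x * z) * a ^ 2 * θ ^ (T - t₀) = 8 * X x * (z * a ^ 2) * θ ^ (T - t₀) := by ring
      rw [this, hz, mul_one]
    · intro x hx hxh hxd hxb
      have e2 := (IH T (by omega) (by omega) (by omega) x hx hxh).2.2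
      rwa [hXeq x hxd hxb] at e2
  refine ⟨hA, hB, ?_⟩
  have hcR : 2 * (c * S) * (6 * R) ≤ 24 * (c * S * L) := by
    calc 2 * (c * S) * (6 * R) ≤ 2 * (c * S) * (6 * (2 * L)) := by gcongr
      _ = _ := by ring
  -- The last block of rounds with the residue of `w` ended at most one period, hence at most `24 *
  -- (c * S * L)` rounds, ago. Since then `θ` has lost at most a factor 2, which turns 8 into 16.
  obtain ⟨j, het, hte, hi2⟩ := exists_modEq_block (N := 2 * (c * S)) (R := 6 * R) (t := t)
    (by omega) (by omega) (by omega) ((((lev w - 1) / S : ℕ) : ℤ) - 6 * (rk w : ℤ))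
  set e := 2 * (c * S) * (j + 1) with he
  replace hte : t ≤ e + 24 * (c * S * L) := hte.trans (Nat.add_le_add_left hcR e)
  push_cast at hi2
  have e1 : f e w ≤ 8 * X w * θ ^ (e - t₀) := by
    rcases het.eq_or_lt with h1 | h1
    · have := hB j (by rw [← he, h1]) hi2
      rwa [← h1] at this
    · exact (IH e h1 (by omega) (by omega) w hw hwh).2.1 j he hi2
  have e2 := h.antitone w (by omega) het ht1
  have hpow : θ ^ (t - t₀) = θ ^ (e - t₀) * θ ^ (t - e) := by
    rw [← pow_add]; congr 1; omega
  have e3 := hθhalf (t - e) (by omega)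
  have e4 : 0 ≤ X w * θ ^ (e - t₀) := by positivity
  rw [hpow]
  refine e2.trans (e1.trans ?_)
  calc 8 * X w * θ ^ (e - t₀) = 16 * (X w * θ ^ (e - t₀)) * (1 / 2) := by ring
    _ ≤ 16 * (X w * θ ^ (e - t₀)) * θ ^ (t - e) := by gcongr
    _ = _ := by ring

end SpreadRules

/-- With suitable constants, `f` is exponentially small after `C (Δ + h L S)` rounds on the next `Δ`
levels. -/
theorem exists_spread_constants {ρ q : ℝ} (H : ℝ) (hρ0 : 0 < ρ) (hρ1 : ρ ≤ 1) (hq0 : 0 < q)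
    (hq1 : q ≤ 1) :
    ∃ c₀ : ℕ, ∀ c : ℕ, c₀ ≤ c → ∃ C : ℕ, 1 ≤ C ∧ ∀ (V : Type) (lev vd rk : V → ℕ) (par : V → V)
      (f : ℕ → V → ℝ) (L S R lo Δ hi t₀ t₁ h : ℕ), 1 ≤ S → 1 ≤ L → L ≤ 2 ^ S → 1 ≤ R → R ≤ 2 * L →
      SpreadRules lev vd rk par f L S R c lo hi t₀ t₁ ρ q → (∀ w, vd w ≤ 2 * L + 1) → L ≤ h →
      t₀ + C * (Δ + h * L * S) ≤ t₁ → ∀ w, lev w ≤ lo + Δ → lev w + vd w ≤ hi →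
      f t₁ w ≤ Real.exp (-H) ^ h := by
  have hγ0 : 0 ≤ 1 - ρ / 2 := by linarith
  have hγ1 : 1 - ρ / 2 < 1 := by linarith
  have hx0 : 0 < 1 - q / 2 := by linarith
  have hx1 : 1 - q / 2 < 1 := by linarith
  -- The factor 4 covers `2 ^ S` from `fast_block` and a second `2 ^ S ≥ L`, needed because the
  -- slack `1 - a` is only of order `1 / L`. This is where the doubly logarithmic block size enters.
  obtain ⟨c₁, hc₁⟩ := exists_pow_lt_of_lt_one (by positivity : 0 < q / 288 / 4) hγ1
  set K := 64 / q with hK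
  have hK1 : 1 ≤ K := by rw [hK, le_div_iff₀ hq0]; linarith
  -- Decay over `n₂ * h` windows must beat both the target `exp (-H) ^ h` and the initial potential
  -- `16 * K ^ vd ≤ (16 * K ^ 3) ^ h`.
  obtain ⟨n₂, hn₂⟩ := exists_pow_lt_of_lt_one
    (by positivity : 0 < Real.exp (-H) / (16 * K ^ 3)) hx1
  refine ⟨3 * c₁ + 1, fun c hc => ⟨8 * c + 72 * c * n₂, by omega, ?_⟩⟩
  intro V lev vd rk par f L S R lo Δ hi t₀ t₁ h hS hL hLS hR hRL hrules hvd hLh ht w hw hwh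
  have ht01 : t₀ ≤ t₁ := le_trans (Nat.le_add_right _ _) ht
  by_cases hlo : lev w ≤ lo
  · exact (hrules.low t₁ w ht01 le_rfl hlo).trans (by positivity)
  push Not at hlo
  have hc1 : 1 ≤ c := by omega
  have hcS : 1 ≤ c * S := Nat.mul_pos hc1 hS
  have hM0 : 72 * (c * S) * L ≠ 0 := by positivity
  set θ : ℝ := (1 - q / 2) ^ (((72 * (c * S) * L : ℕ) : ℝ)⁻¹) with hθd
  have hθ : θ ^ (72 * (c * S) * L) = 1 - q / 2 := Real.rpow_inv_natCast_pow hx0.le hM0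
  have hθ0 : 0 < θ := Real.rpow_pos_of_pos hx0 _
  have hθ1 : θ ≤ 1 := Real.rpow_le_one hx0.le hx1.le (by positivity)
  set a := θ ^ (2 * (c * S)) with ha
  have ha0 : 0 < a := by positivity
  have ha1 : a ≤ 1 := pow_le_one₀ hθ0.le hθ1
  have haL : a ^ (36 * L) = 1 - q / 2 := by
    rw [ha, ← pow_mul, ← hθ]; congr 1; ring
  have hahalf : 1 / 2 ≤ a := by
    calc (1 : ℝ) / 2 ≤ a ^ (36 * L) := by rw [haL]; linarith
      _ ≤ a ^ 1 := pow_le_pow_of_le_one ha0.le ha1 (by omega)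
      _ = a := pow_one a
  have hLpos : (0 : ℝ) < L := by exact_mod_cast hL
  -- Bernoulli's inequality applied to `a ^ (36 * L) = 1 - q / 2`.
  have h1a : q / (72 * L) ≤ 1 - a := by
    have := one_add_mul_le_pow (by linarith : -2 ≤ a - 1) (36 * L)
    rw [add_sub_cancel, haL] at this
    push_cast at this
    rw [div_le_iff₀ (by positivity)]
    linarith
  have hε : 2 * (2 ^ S * (1 - ρ / 2) ^ (c * S / 3)) ≤ a * (1 - a) := by
    have e1 : (1 - ρ / 2) ^ (c * S / 3) ≤ ((1 - ρ / 2) ^ c₁) ^ S := by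
      rw [← pow_mul]
      refine pow_le_pow_of_le_one hγ0 hγ1.le ?_
      rw [Nat.le_div_iff_mul_le (by norm_num)]
      calc c₁ * S * 3 = 3 * c₁ * S := by ring
        _ ≤ c * S := Nat.mul_le_mul_right S (by omega)
    have e2 : (4 * (1 - ρ / 2) ^ c₁) ^ S ≤ q / 288 := by
      have e3 : 4 * (1 - ρ / 2) ^ c₁ ≤ q / 288 := by linarith
      calc (4 * (1 - ρ / 2) ^ c₁) ^ S ≤ (4 * (1 - ρ / 2) ^ c₁) ^ 1 :=
            pow_le_pow_of_le_one (by positivity) (by linarith) hS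
        _ ≤ q / 288 := by rwa [pow_one]
    have e4 : (L : ℝ) ≤ 2 ^ S := by exact_mod_cast hLS
    have e5 : (4 : ℝ) ^ S = 2 ^ S * 2 ^ S := by rw [← mul_pow]; norm_num
    rw [mul_pow, e5] at e2
    have e6 : (L : ℝ) * (2 ^ S * (1 - ρ / 2) ^ (c * S / 3)) ≤ q / 288 := by
      refine le_trans ?_ e2
      rw [mul_assoc ((2 : ℝ) ^ S)]
      gcongr
    have e7 : 2 * (2 ^ S * (1 - ρ / 2) ^ (c * S / 3)) ≤ q / (144 * L) := by
      rw [le_div_iff₀ (by positivity)]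
      linarith
    refine e7.trans ?_
    have e8 : q / (144 * L) = 1 / 2 * (q / (72 * L)) := by field_simp; norm_num
    rw [e8]
    exact mul_le_mul hahalf h1a (by positivity) ha0.le
  have hdecay := hrules.exp_decay (z := (a ^ 2)⁻¹) (K := K) hS hc1 hL hR hRL hρ0.le hρ1 hq0 hq1 hθ0
    hθ1 hθ ha (inv_mul_cancel₀ (by positivity)) (div_mul_cancel₀ _ hq0.ne') hε t₁ ht01 le_rfl w hlo hwh
  refine hdecay.trans ?_
  set m := (lev w - 1) / S - lo / S with hm
  have hmS : m * S ≤ Δ + S := by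
    have e1 : (lev w - 1) / S ≤ (lo + Δ) / S := Nat.div_le_div_right (by omega)
    have e2 := Nat.div_mul_le_self (lo + Δ) S
    have e3 := Nat.lt_div_mul_add (a := lo) hS
    have e4 : m * S ≤ ((lo + Δ) / S - lo / S) * S := Nat.mul_le_mul_right S (by omega)
    have e5 := Nat.sub_mul ((lo + Δ) / S) (lo / S) S
    omega
  -- The first summand pays the factor `z = a⁻²` for each of `m` level blocks, the second provides
  -- the decay.
  have hN : 2 * (c * S) * 2 * m + (72 * (c * S) * L) * (n₂ * h) ≤ t₁ - t₀ := by
    have hh : 1 ≤ h := by omega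
    have e0 : S ≤ h * L * S := Nat.le_mul_of_pos_left S (Nat.mul_pos hh hL)
    calc 2 * (c * S) * 2 * m + (72 * (c * S) * L) * (n₂ * h)
        = 4 * c * (m * S) + 72 * c * n₂ * (h * L * S) := by ring
      _ ≤ 4 * c * (Δ + S) + 72 * c * n₂ * (h * L * S) := by gcongr
      _ ≤ 4 * c * (Δ + h * L * S) + 72 * c * n₂ * (h * L * S) := by gcongr
      _ ≤ (8 * c + 72 * c * n₂) * (Δ + h * L * S) := by
        have : 0 ≤ c * (Δ + h * L * S) := Nat.zero_le _
        have : 0 ≤ c * n₂ * Δ := Nat.zero_le _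
        nlinarith
      _ ≤ t₁ - t₀ := by omega
  have hθN : (a ^ 2)⁻¹ ^ m * θ ^ (t₁ - t₀) ≤ ((1 - q / 2) ^ n₂) ^ h := by
    calc (a ^ 2)⁻¹ ^ m * θ ^ (t₁ - t₀)
        ≤ (a ^ 2)⁻¹ ^ m * θ ^ (2 * (c * S) * 2 * m + (72 * (c * S) * L) * (n₂ * h)) := by
          gcongr ?_ * ?_
          exact pow_le_pow_of_le_one hθ0.le hθ1 hN
      _ = ((1 - q / 2) ^ n₂) ^ h := by
        have e1 : θ ^ (2 * (c * S) * 2 * m) = (a ^ 2) ^ m := by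
          rw [ha, ← pow_mul, ← pow_mul]; congr 1; ring
        rw [pow_add, pow_mul θ (72 * (c * S) * L), hθ, e1, ← mul_assoc, ← mul_pow,
          inv_mul_cancel₀ (by positivity), one_pow, one_mul, pow_mul]
  have hKL : 16 * K ^ vd w ≤ (16 * K ^ 3) ^ h := by
    calc 16 * K ^ vd w ≤ 16 * K ^ (3 * h) := by
          gcongr
          have := hvd w
          omega
      _ ≤ 16 ^ h * K ^ (3 * h) := by
          gcongr
          exact le_self_pow₀ (by norm_num) (by omega)
      _ = (16 * K ^ 3) ^ h := by rw [mul_pow, pow_mul]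
  calc 16 * (K ^ vd w * (a ^ 2)⁻¹ ^ m) * θ ^ (t₁ - t₀)
      = 16 * K ^ vd w * ((a ^ 2)⁻¹ ^ m * θ ^ (t₁ - t₀)) := by ring
    _ ≤ (16 * K ^ 3) ^ h * ((1 - q / 2) ^ n₂) ^ h := by gcongr
    _ = (16 * K ^ 3 * (1 - q / 2) ^ n₂) ^ h := (mul_pow _ _ _).symm
    _ ≤ Real.exp (-H) ^ h := by
      gcongr
      have := (lt_div_iff₀ (by positivity)).1 hn₂
      linarith

/-! ### Receptions and histories -/

section Histories

variable {V Packet : Type} {G : SimpleGraph V} {model : FaultModel}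

/-- The node whose fault spoils a transmission from `u` to `v`. -/
def culprit (model : FaultModel) (u v : V) : V :=
  match model with
  | FaultModel.sender => u
  | FaultModel.receiver => v

theorem receive_of_unique {x : V → Option Packet} {fault : V → Bool} {u v : V} (hv : x v = none)
    (huv : G.Adj u v) (hu : x u ≠ none) (h : ∀ u', G.Adj u' v → u' ≠ u → x u' = none) :
    receive G model x fault v = if fault (culprit model u v) = true then none else x u := by
  have hex : x v = none ∧ ∃! u, G.Adj u v ∧ x u ≠ none :=
    ⟨hv, u, ⟨huv, hu⟩, fun u' hu' => by
      by_contra hne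
      exact hu'.2 (h u' hu'.1 hne)⟩
  have hch : hex.2.choose = u := hex.2.unique hex.2.choose_spec.1 ⟨huv, hu⟩
  unfold receive
  rw [dif_pos hex]
  cases model <;> simp only [hch, culprit] <;> congr

theorem exists_of_receive_eq_some {x : V → Option Packet} {fault : V → Bool} {v : V} {y : Packet}
    (h : receive G model x fault v = some y) : ∃ u, x u = some y := by
  unfold receive at h
  split_ifs at h with h1
  dsimp only at h
  split_ifs at h with h2
  exact ⟨_, h⟩

/-- Reception depends only on who broadcasts, never on the content. This permits dropping payloads
and re-encoding packets. -/
theorem receive_map {Packet' : Type} (g : Packet → Packet') (x : V → Option Packet)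
    (fault : V → Bool) (v : V) :
    receive G model (fun u => (x u).map g) fault v = (receive G model x fault v).map g := by
  by_cases hex : x v = none ∧ ∃! u, G.Adj u v ∧ x u ≠ none
  · obtain ⟨hv, u, ⟨huv, hu⟩, huniq⟩ := hex
    have h : ∀ u', G.Adj u' v → u' ≠ u → x u' = none := fun u' h1 h2 => by
      by_contra h3
      exact h2 (huniq u' ⟨h1, h3⟩)
    rw [receive_of_unique hv huv hu h, receive_of_unique (by rw [hv]; rfl) huv
      (by simpa using hu) fun u' h1 h2 => by rw [h u' h1 h2]; rfl]
    split_ifs <;> rfl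
  · have hex' : ¬ ((x v).map g = none ∧ ∃! u, G.Adj u v ∧ (x u).map g ≠ none) := by
      simpa only [Option.map_eq_none_iff, ne_eq] using hex
    unfold receive
    rw [dif_neg hex, dif_neg hex']
    rfl

variable {s : V} {T : ℕ} {Msgs Msgs' Packet' : Type}

theorem history_succ (S : CodingSchedule V Msgs Packet T) (m : Msgs) (fault : Fin T → V → Bool)
    {r : ℕ} (hr : r < T) (v : V) :
    history G s model S m fault (r + 1) v = receive G model
      (fun u => S.act ⟨r, hr⟩ u (initialKnowledge s m u) (history G s model S m fault r u))
      (fault ⟨r, hr⟩) v :: history G s model S m fault r v := by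
  rw [history, dif_pos hr]

theorem history_subset_succ (S : CodingSchedule V Msgs Packet T) (m : Msgs)
    (fault : Fin T → V → Bool) (r : ℕ) (v : V) :
    history G s model S m fault r v ⊆ history G s model S m fault (r + 1) v := by
  rw [history]
  split_ifs
  · exact List.subset_cons_self _ _
  · exact List.Subset.refl _

theorem length_history_le (S : CodingSchedule V Msgs Packet T) (m : Msgs)
    (fault : Fin T → V → Bool) (r : ℕ) (v : V) :
    (history G s model S m fault r v).length ≤ T ∧ (history G s model S m fault r v).length ≤ r := by
  induction r with
  | zero => simp [history]
  | succ r ih =>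
    rw [history]
    split_ifs with h
    · rw [List.length_cons]; omega
    · omega

theorem history_congr {S S' : CodingSchedule V Msgs Packet T} (m : Msgs)
    {fault fault' : Fin T → V → Bool} (r : ℕ)
    (hact : ∀ i : Fin T, (i : ℕ) < r → S.act i = S'.act i)
    (hfault : ∀ i : Fin T, (i : ℕ) < r → fault i = fault' i) :
    history G s model S m fault r = history G s model S' m fault' r := by
  induction r with
  | zero => rfl
  | succ r ih =>
    have ih := ih (fun i hi => hact i (by omega)) fun i hi => hfault i (by omega)
    funext v
    by_cases hr : r < T
    · rw [history_succ _ _ _ hr, history_succ _ _ _ hr, ih, hact ⟨r, hr⟩ (Nat.lt_succ_self r),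
        hfault ⟨r, hr⟩ (Nat.lt_succ_self r)]
    · rw [history, history, dif_neg hr, dif_neg hr, ih]

/-- A schedule that simulates another one after a translation `g` of the packets has the translated
histories. -/
theorem history_map {S : CodingSchedule V Msgs Packet T} {S' : CodingSchedule V Msgs' Packet' T}
    (g : Packet → Packet') (Valid : Packet → Prop) {m : Msgs} {m' : Msgs'}
    (hact : ∀ i u hist, (∀ y, some y ∈ hist → Valid y) →
      S'.act i u (initialKnowledge s m' u) (hist.map (Option.map g)) =
        (S.act i u (initialKnowledge s m u) hist).map g ∧
      ∀ y, S.act i u (initialKnowledge s m u) hist = some y → Valid y)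
    (fault : Fin T → V → Bool) (r : ℕ) (v : V) :
    history G s model S' m' fault r v = (history G s model S m fault r v).map (Option.map g) ∧
      ∀ y, some y ∈ history G s model S m fault r v → Valid y := by
  induction r generalizing v with
  | zero => simp [history]
  | succ r ih =>
    by_cases hr : r < T
    · rw [history_succ _ _ _ hr, history_succ _ _ _ hr, List.map_cons, ← receive_map]
      refine ⟨?_, ?_⟩
      · rw [(ih v).1]
        congr 2
        funext u
        rw [(ih u).1]
        exact (hact _ u _ (ih u).2).1
      · intro y hy
        rcases List.mem_cons.1 hy with hy | hy
        · obtain ⟨u, hu⟩ := exists_of_receive_eq_some hy.symm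
          exact (hact _ u _ (ih u).2).2 y hu
        · exact (ih v).2 y hy
    · rw [history, history, dif_neg hr, dif_neg hr]
      exact ih v

end Histories

/-! ### Random linear network coding in batches -/

section BatchRLNC

variable {F : Type} [Field F] {k ℓ : ℕ}

/-- All nonzero coefficients belong to the batch `β`. -/
def InBatch (bat : Fin k → ℕ) (β : ℕ) (x : Fin k → F) : Prop := ∀ i, x i ≠ 0 → bat i = β

open Classical in
/-- Robust FASTBC with random linear network coding in batches: in round `t` the node `u` only
combines packets of the batch `sel t u`. -/
noncomputable def batchRLNC {V : Type} [Fintype V] {G : SimpleGraph V} {s : V}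
    (𝒯 : RankedBFSTree G s) (c : ℕ) {T : ℕ} (bat : Fin k → ℕ) (sel : ℕ → V → ℕ) (ℓ : ℕ)
    (seed : Seed V F k T) : CodingSchedule V (FieldMessages F k ℓ) (RLNCPacket F k ℓ) T where
  act t u init hist :=
    if Broadcasts 𝒯 c t u (seed t u).1 then
      some (combine (seed t u).2
        ((knownPackets init hist).filter fun y => InBatch bat (sel t u) y.1))
    else none
  decode _ init hist := rlncDecode (knownPackets init hist)

theorem batchRLNC_const {V : Type} [Fintype V] {G : SimpleGraph V} {s : V}
    (𝒯 : RankedBFSTree G s) (c : ℕ) {T : ℕ} (ℓ : ℕ) (seed : Seed V F k T) :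
    batchRLNC 𝒯 c (fun _ => 0) (fun _ _ => 0) ℓ seed = robustFastbcRLNC 𝒯 c ℓ seed := by
  simp [batchRLNC, robustFastbcRLNC, InBatch]

/-- The default value 0 pads a short list, so that the number of coefficients need not depend on the
number of known packets. -/
theorem sum_zipWith_ofFn {M : Type} [AddCommMonoid M] [Module F M] {N : ℕ} (α : Fin N → F)
    (L : List M) : (List.zipWith (fun a v => a • v) (List.ofFn α) L).sum =
      ∑ j, α j • L.getD j 0 := by
  induction N generalizing L with
  | zero => simp
  | succ N ih =>
    cases L with
    | nil => simp
    | cons y L =>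
      rw [List.ofFn_succ, List.zipWith_cons_cons, List.sum_cons, ih, Fin.sum_univ_succ]
      simp

theorem map_combine {ℓ N : ℕ} {M : Type} [AddCommMonoid M] [Module F M]
    (g : RLNCPacket F k ℓ →ₗ[F] M) (α : Fin N → F) (L : List (RLNCPacket F k ℓ)) :
    g (combine α L) = ∑ j, α j • (L.map g).getD j 0 := by
  rw [combine, sum_zipWith_ofFn, map_sum]
  refine Finset.sum_congr rfl fun j _ => ?_
  rw [map_smul]
  congr 1
  simp only [List.getD_eq_getElem?_getD, List.getElem?_map]
  cases L[(j : ℕ)]? <;> simp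

/-- A coefficient vector together with the combination of the messages `m` that it describes. -/
noncomputable def liftPacket (m : FieldMessages F k ℓ) :
    RLNCPacket F k 0 →ₗ[F] RLNCPacket F k ℓ where
  toFun y := (y.1, ∑ i, y.1 i • m i)
  map_add' x y := by
    ext1
    · rfl
    · simp [add_smul, Finset.sum_add_distrib]
  map_smul' a x := by
    ext1
    · rfl
    · simp [mul_smul, Finset.smul_sum]

theorem combine_map_liftPacket {N : ℕ} (m : FieldMessages F k ℓ) (α : Fin N → F)
    (L : List (RLNCPacket F k 0)) :
    combine α (L.map (liftPacket m)) = liftPacket m (combine α L) := by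
  rw [map_combine, combine, sum_zipWith_ofFn]

theorem knownPackets_map_liftPacket {V : Type} (s u : V) (m : FieldMessages F k ℓ)
    (m₀ : FieldMessages F k 0) (hist : List (Option (RLNCPacket F k 0))) :
    knownPackets (initialKnowledge s m u) (hist.map (Option.map (liftPacket m))) =
      (knownPackets (initialKnowledge s m₀ u) hist).map (liftPacket m) := by
  unfold knownPackets initialKnowledge
  rw [List.map_append, List.reduceOption_map]
  congr 1
  split_ifs with h
  · dsimp only
    rw [List.map_ofFn]
    congr 1
    funext i
    simp [liftPacket, Pi.single_apply, ite_smul]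
  · rfl

theorem mem_knownPackets_of_mem {init : Option (FieldMessages F k ℓ)}
    {hist : List (Option (RLNCPacket F k ℓ))} {y : RLNCPacket F k ℓ} (h : some y ∈ hist) :
    y ∈ knownPackets init hist :=
  List.mem_append_right _ (List.reduceOption_mem_iff.2 h)

theorem knownPackets_subset {init : Option (FieldMessages F k ℓ)}
    {hist hist' : List (Option (RLNCPacket F k ℓ))} (h : hist ⊆ hist') :
    knownPackets init hist ⊆ knownPackets init hist' := by
  intro y hy
  rcases List.mem_append.1 hy with hy | hy
  · exact List.mem_append_left _ hy
  · exact mem_knownPackets_of_mem (h (List.reduceOption_mem_iff.1 hy))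

theorem length_knownPackets_le (init : Option (FieldMessages F k ℓ))
    (hist : List (Option (RLNCPacket F k ℓ))) :
    (knownPackets init hist).length ≤ k + hist.length := by
  unfold knownPackets
  rw [List.length_append]
  refine add_le_add ?_ (List.reduceOption_length_le hist)
  cases init <;> simp

/-- A packet of the list belongs to the batch `β` and is not orthogonal to `μ`. -/
def Informed (bat : Fin k → ℕ) (β : ℕ) (μ : Fin k → F) (L : List (RLNCPacket F k ℓ)) : Prop :=
  ∃ y ∈ L, InBatch bat β y.1 ∧ ∑ i, y.1 i * μ i ≠ 0

theorem Informed.mono {bat : Fin k → ℕ} {β : ℕ} {μ : Fin k → F} {L L' : List (RLNCPacket F k ℓ)}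
    (h : Informed bat β μ L) (hL : L ⊆ L') : Informed bat β μ L' :=
  let ⟨y, hy, h⟩ := h
  ⟨y, hL hy, h⟩

/-- A node decodes if its packets are orthogonal to no nonzero vector. -/
theorem rlncDecode_eq_some {L : List (RLNCPacket F k 0)} (m : FieldMessages F k ℓ)
    (h : ∀ μ : Fin k → F, μ ≠ 0 → ∃ y ∈ L, ∑ i, y.1 i * μ i ≠ 0) :
    rlncDecode (L.map (liftPacket m)) = some m := by
  have hex : ∃! m' : FieldMessages F k ℓ, ∀ y ∈ L.map (liftPacket m), ∑ i, y.1 i • m' i = y.2 := by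
    refine ⟨m, fun y hy => ?_, fun m' hm' => ?_⟩
    · obtain ⟨x, -, rfl⟩ := List.mem_map.1 hy
      rfl
    · by_contra hne
      -- A nonzero column of the difference of two solutions would be orthogonal to all known
      -- coefficient vectors.
      obtain ⟨j, hj⟩ : ∃ j, (fun i => m' i j - m i j) ≠ 0 := by
        by_contra hall
        push Not at hall
        refine hne (funext fun i => funext fun j => ?_)
        exact sub_eq_zero.1 (congrFun (hall j) i)
      obtain ⟨y, hy, hyμ⟩ := h _ hj
      refine hyμ ?_
      have h1 := congrFun (hm' _ (List.mem_map_of_mem hy)) j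
      simp only [liftPacket, LinearMap.coe_mk, AddHom.coe_mk, Finset.sum_apply, Pi.smul_apply,
        smul_eq_mul] at h1
      simp only [mul_sub, Finset.sum_sub_distrib, h1, sub_self]
  unfold rlncDecode
  rw [dif_pos hex]
  refine congrArg some (hex.unique hex.choose_spec.1 fun y hy => ?_)
  obtain ⟨x, -, rfl⟩ := List.mem_map.1 hy
  rfl

/-! ### Runs of the batched algorithm, followed through coefficient vectors only. -/

variable {V : Type} [Fintype V] {G : SimpleGraph V} {s : V} (𝒯 : RankedBFSTree G s)
  (model : FaultModel) (c : ℕ) {T : ℕ} (bat : Fin k → ℕ) (sel : ℕ → V → ℕ)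

/-- The coefficient vectors (with empty payload) that `u` knows after `t` rounds. -/
noncomputable def coeffsKnown (ω : Seed V F k T × (Fin T → V → Bool)) (t : ℕ) (u : V) :
    List (RLNCPacket F k 0) :=
  knownPackets (initialKnowledge s (0 : FieldMessages F k 0) u)
    (history G s model (batchRLNC 𝒯 c bat sel 0 ω.1) 0 ω.2 t u)

/-- Broadcast decisions and coefficients ignore the messages, and coefficients determine payloads.
So runs with empty payload suffice, and one event of seeds and faults serves all messages. -/
theorem history_batchRLNC (seed : Seed V F k T) (fault : Fin T → V → Bool)
    (m : FieldMessages F k ℓ) (t : ℕ) (u : V) :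
    history G s model (batchRLNC 𝒯 c bat sel ℓ seed) m fault t u =
      (history G s model (batchRLNC 𝒯 c bat sel 0 seed) 0 fault t u).map
        (Option.map (liftPacket m)) := by
  refine (history_map (liftPacket m) (fun _ => True) (fun i u hist _ => ⟨?_, fun _ _ => trivial⟩)
    fault t u).1
  unfold batchRLNC
  dsimp only
  split_ifs
  · rw [knownPackets_map_liftPacket s u m 0, Option.map_some, ← combine_map_liftPacket,
      List.filter_map]
    rfl
  · rfl

theorem knownPackets_batchRLNC (seed : Seed V F k T) (fault : Fin T → V → Bool)
    (m : FieldMessages F k ℓ) (t : ℕ) (u : V) :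
    knownPackets (initialKnowledge s m u)
      (history G s model (batchRLNC 𝒯 c bat sel ℓ seed) m fault t u) =
      (coeffsKnown 𝒯 model c bat sel (seed, fault) t u).map (liftPacket m) := by
  rw [history_batchRLNC, knownPackets_map_liftPacket s u m 0]
  rfl

/-- Every node is informed about every nonzero vector of every batch. -/
def AllInformed (ω : Seed V F k T × (Fin T → V → Bool)) : Prop :=
  ∀ u β, ∀ μ : Fin k → F, μ ≠ 0 → InBatch bat β μ →
    Informed bat β μ (coeffsKnown 𝒯 model c bat sel ω T u)

/-- A nonzero vector has a nonzero restriction to some batch, and packets of that batch cannot tell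
the vector from its restriction. -/
theorem AllInformed.decode {ω : Seed V F k T × (Fin T → V → Bool)}
    (h : AllInformed 𝒯 model c bat sel ω) (m : FieldMessages F k ℓ) (u : V) :
    rlncDecode ((coeffsKnown 𝒯 model c bat sel ω T u).map (liftPacket m)) = some m := by
  classical
  refine rlncDecode_eq_some m fun μ hμ => ?_
  obtain ⟨i, hi⟩ := Function.ne_iff.1 hμ
  obtain ⟨y, hy, hyb, hyμ⟩ := h u (bat i) (fun j => if bat j = bat i then μ j else 0)
    (Function.ne_iff.2 ⟨i, by simpa using hi⟩) (fun j hj => by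
      by_contra hne
      exact hj (if_neg hne))
  refine ⟨y, hy, ?_⟩
  convert hyμ using 1
  refine Finset.sum_congr rfl fun j _ => ?_
  by_cases hj : y.1 j = 0
  · simp [hj]
  · exact congrArg (y.1 j * ·) (if_pos (hyb j hj)).symm

theorem AllInformed.succeeds {ω : Seed V F k T × (Fin T → V → Bool)}
    (h : AllInformed 𝒯 model c bat sel ω) (m : FieldMessages F k ℓ) :
    Succeeds G s model (batchRLNC 𝒯 c bat sel ℓ ω.1) m ω.2 := by
  intro u
  change rlncDecode (knownPackets _ _) = _
  rw [knownPackets_batchRLNC]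
  exact h.decode 𝒯 model c bat sel m u

variable {𝒯 model c bat sel}

theorem informed_root (ω : Seed V F k T × (Fin T → V → Bool)) (t : ℕ) {β : ℕ} {μ : Fin k → F}
    (hμ : μ ≠ 0) (hβ : InBatch bat β μ) :
    Informed bat β μ (coeffsKnown 𝒯 model c bat sel ω t s) := by
  classical
  obtain ⟨i, hi⟩ := Function.ne_iff.1 hμ
  refine ⟨(Pi.single i 1, 0), List.mem_append_left _ ?_, fun j hj => ?_, ?_⟩
  · simp only [initialKnowledge, if_true]
    exact List.mem_ofFn.2 ⟨i, rfl⟩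
  · have hji : j = i := by
      by_contra hne
      exact hj (Pi.single_eq_of_ne hne _)
    exact hji ▸ hβ i hi
  · simpa [Pi.single_apply] using hi

theorem coeffsKnown_subset_succ (ω : Seed V F k T × (Fin T → V → Bool)) (t : ℕ) (u : V) :
    coeffsKnown 𝒯 model c bat sel ω t u ⊆ coeffsKnown 𝒯 model c bat sel ω (t + 1) u :=
  knownPackets_subset (history_subset_succ _ _ _ _ _)

theorem length_coeffsKnown_le (ω : Seed V F k T × (Fin T → V → Bool)) (t : ℕ) (u : V) :
    (coeffsKnown 𝒯 model c bat sel ω t u).length ≤ k + T :=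
  (length_knownPackets_le _ _).trans (Nat.add_le_add_left (length_history_le _ _ _ _ _).1 _)

/-- Causality: knowledge before round `t` does not involve the choices and faults of round `t`,
which may thus be resampled. -/
theorem coeffsKnown_congr {ω ω' : Seed V F k T × (Fin T → V → Bool)} (t : ℕ)
    (h : ∀ i : Fin T, (i : ℕ) < t → ω.1 i = ω'.1 i ∧ ω.2 i = ω'.2 i) :
    coeffsKnown 𝒯 model c bat sel ω t = coeffsKnown 𝒯 model c bat sel ω' t := by
  funext u
  unfold coeffsKnown
  rw [history_congr 0 t (fun i hi => ?_) fun i hi => (h i hi).2]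
  unfold batchRLNC
  dsimp only
  rw [(h i hi).1]

theorem inBatch_combine {N : ℕ} {β : ℕ} (α : Fin N → F) {L : List (RLNCPacket F k ℓ)}
    (h : ∀ y ∈ L, InBatch bat β y.1) : InBatch bat β (combine α L).1 := by
  intro i hi
  by_contra hne
  refine hi ?_
  have := map_combine ((LinearMap.proj i).comp (LinearMap.fst F (Fin k → F) (Fin ℓ → F))) α L
  simp only [LinearMap.comp_apply, LinearMap.fst_apply, LinearMap.proj_apply] at this
  rw [this]
  refine Finset.sum_eq_zero fun j _ => ?_
  simp only [List.getD_eq_getElem?_getD, List.getElem?_map]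
  cases hj : L[(j : ℕ)]? with
  | none => simp
  | some y =>
    have hy := List.mem_of_getElem? hj
    have : y.1 i = 0 := by
      by_contra h0
      exact hne (h y hy i h0)
    simp [this]

open Classical in
/-- The inner products of the packets of the batch `β` known to `u` with `μ`. -/
noncomputable def testValues (L : List (RLNCPacket F k 0)) (bat : Fin k → ℕ) (β : ℕ)
    (μ : Fin k → F) (N : ℕ) (j : Fin N) : F :=
  ((L.filter fun y => InBatch bat β y.1).map fun y => ∑ i, y.1 i * μ i).getD j 0

theorem Informed.exists_testValues_ne_zero {L : List (RLNCPacket F k 0)} {β N : ℕ} {μ : Fin k → F}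
    (h : Informed bat β μ L) (hN : L.length ≤ N) : ∃ j, testValues L bat β μ N j ≠ 0 := by
  classical
  obtain ⟨y, hy, hyb, hyμ⟩ := h
  have hmem : y ∈ L.filter fun y => InBatch bat β y.1 := by simp [hy, hyb]
  obtain ⟨j, hj, hjy⟩ := List.getElem_of_mem hmem
  refine ⟨⟨j, hj.trans_le ((List.length_filter_le _ _).trans hN)⟩, ?_⟩
  unfold testValues
  simp only [List.getD_eq_getElem?_getD, List.getElem?_map, List.getElem?_eq_getElem hj, hjy]
  exact hyμ

/-- If `u` is the only broadcasting neighbour of the silent node `w`, there is no fault, and the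
coefficients chosen by `u` do not cancel, then `w` becomes informed. -/
theorem informed_succ {ω : Seed V F k T × (Fin T → V → Bool)} {t : ℕ} (ht : t < T) {u w : V}
    {β : ℕ} {μ : Fin k → F} (hadj : G.Adj u w) (hu : Broadcasts 𝒯 c t u (ω.1 ⟨t, ht⟩ u).1)
    (hw : ¬ Broadcasts 𝒯 c t w (ω.1 ⟨t, ht⟩ w).1)
    (hx : ∀ x, G.Adj x w → x ≠ u → ¬ Broadcasts 𝒯 c t x (ω.1 ⟨t, ht⟩ x).1)
    (hfault : ω.2 ⟨t, ht⟩ (culprit model u w) = false) (hsel : sel t u = β)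
    (hα : ∑ j, (ω.1 ⟨t, ht⟩ u).2 j *
      testValues (coeffsKnown 𝒯 model c bat sel ω t u) bat β μ (k + T) j ≠ 0) :
    Informed bat β μ (coeffsKnown 𝒯 model c bat sel ω (t + 1) w) := by
  classical
  have hact : ∀ x, ¬ Broadcasts 𝒯 c t x (ω.1 ⟨t, ht⟩ x).1 → ∀ init hist,
      (batchRLNC (F := F) 𝒯 c bat sel 0 ω.1).act ⟨t, ht⟩ x init hist = none :=
    fun x hx init hist => if_neg hx
  have hactu : ∀ init hist, (batchRLNC 𝒯 c bat sel 0 ω.1).act ⟨t, ht⟩ u init hist =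
      some (combine (ω.1 ⟨t, ht⟩ u).2
        ((knownPackets init hist).filter fun y => InBatch bat β y.1)) := fun init hist => by
    rw [← hsel]; exact if_pos hu
  refine ⟨combine (ω.1 ⟨t, ht⟩ u).2
    ((coeffsKnown 𝒯 model c bat sel ω t u).filter fun y => InBatch bat β y.1), ?_, ?_, ?_⟩
  · refine mem_knownPackets_of_mem ?_
    rw [history_succ _ _ _ ht, receive_of_unique (u := u) (hact w hw _ _) hadj
      (by rw [hactu]; exact Option.some_ne_none _) (fun x h1 h2 => hact x (hx x h1 h2) _ _), hfault,
      if_neg Bool.false_ne_true, hactu]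
    exact List.mem_cons_self
  · exact inBatch_combine _ fun y hy => by simpa using (List.mem_filter.1 hy).2
  · let φ : RLNCPacket F k 0 →ₗ[F] F :=
      { toFun := fun y => ∑ i, y.1 i * μ i
        map_add' := fun x y => by simp [add_mul, Finset.sum_add_distrib]
        map_smul' := fun a x => by simp [mul_assoc, Finset.mul_sum] }
    have := map_combine φ (ω.1 ⟨t, ht⟩ u).2
      ((coeffsKnown 𝒯 model c bat sel ω t u).filter fun y => InBatch bat β y.1)
    change φ _ ≠ 0
    rw [this]
    exact hα

end BatchRLNC

/-! ### Resampling one coordinate -/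

/-- The preimage of a box is a product of a box with free side `i` and the old side `i`. Resampling
one coordinate replaces conditioning on the others. -/
theorem measurePreserving_update {ι : Type*} [Fintype ι] [DecidableEq ι] {X : ι → Type*}
    [∀ i, MeasurableSpace (X i)] (μ : ∀ i, Measure (X i)) [∀ i, IsProbabilityMeasure (μ i)]
    (i : ι) :
    MeasurePreserving (fun q : (∀ j, X j) × X i => Function.update q.1 i q.2)
      ((Measure.pi μ).prod (μ i)) (Measure.pi μ) := by
  have hmeas : Measurable fun q : (∀ j, X j) × X i => Function.update q.1 i q.2 := by
    refine measurable_pi_iff.2 fun j => ?_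
    by_cases hj : j = i
    · subst hj
      simpa using measurable_snd
    · simp only [Function.update_of_ne hj]
      exact (measurable_pi_apply j).comp measurable_fst
  refine ⟨hmeas, (Measure.pi_eq fun s hs => ?_).symm⟩
  rw [Measure.map_apply hmeas (MeasurableSet.univ_pi hs)]
  have hpre : (fun q : (∀ j, X j) × X i => Function.update q.1 i q.2) ⁻¹' Set.univ.pi s =
      (Set.univ.pi (Function.update s i Set.univ)) ×ˢ s i := by
    ext q
    simp only [Set.mem_preimage, Set.mem_univ_pi, Set.mem_prod]
    constructor
    · intro h
      refine ⟨fun j => ?_, by simpa using h i⟩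
      by_cases hj : j = i
      · subst hj; simp
      · simpa [Function.update_of_ne hj] using h j
    · rintro ⟨h1, h2⟩ j
      by_cases hj : j = i
      · subst hj; simpa using h2
      · simpa [Function.update_of_ne hj] using h1 j
  rw [hpre, Measure.prod_prod, Measure.pi_pi, ← Finset.mul_prod_erase _ _ (Finset.mem_univ i),
    ← Finset.mul_prod_erase Finset.univ (fun j => μ j (s j)) (Finset.mem_univ i)]
  simp only [Function.update_self, measure_univ, one_mul]
  rw [mul_comm]
  congr 1
  refine Finset.prod_congr rfl fun j hj => ?_
  rw [Function.update_of_ne (Finset.ne_of_mem_erase hj)]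

theorem lintegral_update {ι : Type*} [Fintype ι] [DecidableEq ι] {X : ι → Type*}
    [∀ i, MeasurableSpace (X i)] (μ : ∀ i, Measure (X i)) [∀ i, IsProbabilityMeasure (μ i)]
    (i : ι) {f : (∀ j, X j) → ENNReal} (hf : Measurable f) :
    ∫⁻ x, ∫⁻ a, f (Function.update x i a) ∂μ i ∂Measure.pi μ = ∫⁻ x, f x ∂Measure.pi μ := by
  have h := measurePreserving_update μ i
  rw [← h.lintegral_comp hf, lintegral_prod]
  exact (hf.comp h.measurable).aemeasurable

/-- Resampling a coordinate of both factors of a product of two product measures. -/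
theorem lintegral_update_prod {ι : Type*} [Fintype ι] [DecidableEq ι] {X Y : ι → Type*}
    [∀ i, MeasurableSpace (X i)] [∀ i, MeasurableSpace (Y i)] (μ : ∀ i, Measure (X i))
    (ν : ∀ i, Measure (Y i)) [∀ i, IsProbabilityMeasure (μ i)] [∀ i, IsProbabilityMeasure (ν i)]
    (i : ι) {f : (∀ j, X j) × (∀ j, Y j) → ENNReal} (hf : Measurable f) :
    ∫⁻ x, ∫⁻ q, f (Function.update x.1 i q.1, Function.update x.2 i q.2) ∂(μ i).prod (ν i)
      ∂(Measure.pi μ).prod (Measure.pi ν) = ∫⁻ x, f x ∂(Measure.pi μ).prod (Measure.pi ν) := by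
  have h1 := (measurePreserving_update μ i).measurable
  have h2 := (measurePreserving_update ν i).measurable
  have hF : Measurable fun z : ((∀ j, X j) × (∀ j, Y j)) × (X i × Y i) =>
      f (Function.update z.1.1 i z.2.1, Function.update z.1.2 i z.2.2) :=
    hf.comp ((h1.comp (by fun_prop : Measurable fun z : ((∀ j, X j) × (∀ j, Y j)) × (X i × Y i) =>
      (z.1.1, z.2.1))).prodMk (h2.comp (by fun_prop : Measurable
        fun z : ((∀ j, X j) × (∀ j, Y j)) × (X i × Y i) => (z.1.2, z.2.2))))
  rw [lintegral_prod _ hf.aemeasurable, lintegral_prod _ hF.lintegral_prod_right'.aemeasurable]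
  rw [← lintegral_update μ i (f := fun x => ∫⁻ y, f (x, y) ∂Measure.pi ν)
    hf.lintegral_prod_right']
  refine lintegral_congr fun x => ?_
  have e1 : ∀ y, ∫⁻ q, f (Function.update x i q.1, Function.update y i q.2) ∂(μ i).prod (ν i) =
      ∫⁻ a, ∫⁻ b, f (Function.update x i a, Function.update y i b) ∂ν i ∂μ i := fun y =>
    lintegral_prod _ (hF.comp (measurable_prodMk_left (x := (x, y)))).aemeasurable
  simp only [e1]
  rw [lintegral_lintegral_swap]
  · refine lintegral_congr fun a => ?_
    exact lintegral_update ν i (f := fun y => f (Function.update x i a, y))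
      (hf.comp measurable_prodMk_left)
  · refine Measurable.aemeasurable ?_
    have : Measurable fun z : ((∀ j, Y j) × X i) × Y i =>
        f (Function.update x i z.1.2, Function.update z.1.1 i z.2) :=
      hF.comp (by fun_prop : Measurable fun z : ((∀ j, Y j) × X i) × Y i =>
        (((x, z.1.1), (z.1.2, z.2)) : ((∀ j, X j) × (∀ j, Y j)) × (X i × Y i)))
    exact this.lintegral_prod_right'

/-- A nontrivial linear combination with uniformly random coefficients in a finite field vanishes
with probability at most `1 / |F|`. -/
theorem uniform_linear_combination_ne_zero {F : Type} [Field F] [Fintype F] [MeasurableSpace F]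
    [DiscreteMeasurableSpace F] {N : ℕ} {z : Fin N → F} {j₀ : Fin N} (hz : z j₀ ≠ 0) :
    1 - 1 / (Fintype.card F : ℝ) ≤
      (Measure.pi fun _ : Fin N => ProbabilityTheory.uniformOn (Set.univ : Set F)).real
        {α | ∑ j, α j * z j ≠ 0} := by
  classical
  set π := Measure.pi fun _ : Fin N => ProbabilityTheory.uniformOn (Set.univ : Set F) with hπ
  have h0 : π {α | ∑ j, α j * z j = 0} ≤ ENNReal.ofReal (1 / (Fintype.card F : ℝ)) := by
    rw [← lintegral_indicator_one (MeasurableSet.of_discrete), hπ,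
      ← lintegral_update (fun _ : Fin N => ProbabilityTheory.uniformOn (Set.univ : Set F)) j₀
        Measurable.of_discrete]
    calc _ ≤ ∫⁻ _, ENNReal.ofReal (1 / (Fintype.card F : ℝ)) ∂π := by
          refine lintegral_mono fun α => ?_
          have e1 : ∀ a, ({α : Fin N → F | ∑ j, α j * z j = 0}.indicator 1
              (Function.update α j₀ a) : ENNReal) =
              {a | ∑ j, Function.update α j₀ a j * z j = 0}.indicator 1 a := fun a => rfl
          simp only [e1]
          rw [lintegral_indicator_one (MeasurableSet.of_discrete),
            ProbabilityTheory.uniformOn_univ]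
          -- With the other coefficients fixed, at most one value of the coefficient at `j₀` cancels
          -- the sum.
          have hsub : {a | ∑ j, Function.update α j₀ a j * z j = 0}.Subsingleton := by
            intro a ha b hb
            simp only [Set.mem_setOf_eq] at ha hb
            rw [← Finset.add_sum_erase _ _ (Finset.mem_univ j₀)] at ha hb
            have e2 : ∀ a, ∑ j ∈ Finset.univ.erase j₀, Function.update α j₀ a j * z j =
                ∑ j ∈ Finset.univ.erase j₀, α j * z j := fun a =>
              Finset.sum_congr rfl fun j hj => by
                rw [Function.update_of_ne (Finset.ne_of_mem_erase hj)]
            rw [e2, Function.update_self] at ha hb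
            exact mul_right_cancel₀ hz (add_right_cancel (ha.trans hb.symm))
          have hc : Measure.count {a | ∑ j, Function.update α j₀ a j * z j = 0} ≤ 1 := by
            rcases hsub.eq_empty_or_singleton with h | ⟨a, h⟩
            · rw [h]; simp
            · rw [h, Measure.count_singleton]
          rw [ENNReal.ofReal_div_of_pos (by exact_mod_cast Fintype.card_pos), ENNReal.ofReal_one,
            ENNReal.ofReal_natCast]
          exact ENNReal.div_le_div_right hc _
      _ = _ := by simp
  have h1 : π.real {α | ∑ j, α j * z j = 0} ≤ 1 / (Fintype.card F : ℝ) :=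
    ENNReal.toReal_le_of_le_ofReal (by positivity) h0
  have h2 : {α : Fin N → F | ∑ j, α j * z j ≠ 0} = {α | ∑ j, α j * z j = 0}ᶜ := rfl
  rw [h2, probReal_compl_eq_one_sub (MeasurableSet.of_discrete)]
  linarith

/-! ### One round -/

theorem decayProb_nonneg (n t : ℕ) : 0 ≤ decayProb n t := by unfold decayProb; positivity

theorem decayProb_le_one (n t : ℕ) : decayProb n t ≤ 1 := by
  unfold decayProb
  exact pow_le_one₀ (by norm_num) (by norm_num)

instance (n t : ℕ) : IsProbabilityMeasure (coin (decayProb n t)) :=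
  coin_isProbabilityMeasure (decayProb_nonneg n t) (decayProb_le_one n t)

theorem coin_real_true {p : ℝ} (h0 : 0 ≤ p) : (coin p).real {true} = p := by
  simp [coin, Measure.real, h0]

theorem coin_real_false {p : ℝ} (h1 : p ≤ 1) : (coin p).real {false} = 1 - p := by
  simp [coin, Measure.real, h1]

section OneRound

variable {F : Type} [Field F] [Fintype F] [MeasurableSpace F] [DiscreteMeasurableSpace F] {k : ℕ}

/-- The distribution of the random choices of all nodes in round `t`. -/
noncomputable def roundSeedMeasure (V F : Type) [Fintype V] [MeasurableSpace F] (N t : ℕ) :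
    Measure (V → Bool × (Fin N → F)) :=
  Measure.pi fun _ => (coin (decayProb (Fintype.card V) t)).prod
    (Measure.pi fun _ => ProbabilityTheory.uniformOn Set.univ)

instance (V : Type) [Fintype V] (N t : ℕ) :
    IsProbabilityMeasure (roundSeedMeasure V F N t) := by
  unfold roundSeedMeasure; infer_instance

instance (V : Type) [Fintype V] (T : ℕ) :
    IsProbabilityMeasure (seedMeasure V F k T) :=
  inferInstanceAs (IsProbabilityMeasure (Measure.pi fun t : Fin T =>
    roundSeedMeasure V F (k + T) t))

set_option synthInstance.maxHeartbeats 200000 in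
instance (V : Type) [Fintype V] (T : ℕ) :
    DiscreteMeasurableSpace (Seed V F k T × (Fin T → V → Bool)) := by
  haveI : Countable (Seed V F k T) := Finite.to_countable
  haveI : MeasurableSingletonClass (Seed V F k T) := inferInstance
  haveI : Countable (Fin T → V → Bool) := Finite.to_countable
  haveI : MeasurableSingletonClass (Fin T → V → Bool) := inferInstance
  haveI : MeasurableSingletonClass (Seed V F k T × (Fin T → V → Bool)) := inferInstance
  exact MeasurableSingletonClass.toDiscreteMeasurableSpace

instance (V : Type) [Fintype V] (T : ℕ) (p : ℝ) [IsProbabilityMeasure (coin p)] :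
    IsProbabilityMeasure (faultMeasure V T p) := by
  unfold faultMeasure; infer_instance

/-- The probability that the coins lie in a box, the coefficients chosen by `u` do not cancel, and
`v` has no fault. -/
theorem round_box_le {V : Type} [Fintype V] {N t : ℕ} {p : ℝ} [IsProbabilityMeasure (coin p)]
    (hp0 : 0 ≤ p) (hp1 : p ≤ 1) (B : V → Set Bool) (u v : V) {z : Fin N → F} {j₀ : Fin N}
    (hz : z j₀ ≠ 0) :
    (∏ x, (coin (decayProb (Fintype.card V) t)).real (B x)) *
        ((1 - p) * (1 - 1 / (Fintype.card F : ℝ))) ≤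
      ((roundSeedMeasure V F N t).prod (Measure.pi fun _ : V => coin p)).real
        {q | (∀ x, (q.1 x).1 ∈ B x) ∧ ∑ j, (q.1 u).2 j * z j ≠ 0 ∧ q.2 v = false} := by
  classical
  have hset : {q : (V → Bool × (Fin N → F)) × (V → Bool) |
      (∀ x, (q.1 x).1 ∈ B x) ∧ ∑ j, (q.1 u).2 j * z j ≠ 0 ∧ q.2 v = false} =
      (Set.univ.pi fun x => B x ×ˢ (if x = u then {α | ∑ j, α j * z j ≠ 0} else Set.univ)) ×ˢ
        {b | b v = false} := by
    ext q
    simp only [Set.mem_setOf_eq, Set.mem_prod, Set.mem_univ_pi, Set.mem_preimage,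
      Set.mem_singleton_iff]
    constructor
    · rintro ⟨h1, h2, h3⟩
      refine ⟨fun x => ⟨h1 x, ?_⟩, h3⟩
      split_ifs with hx
      · rw [hx]; exact h2
      · trivial
    · rintro ⟨h1, h3⟩
      refine ⟨fun x => (h1 x).1, ?_, h3⟩
      have := (h1 u).2
      rwa [if_pos rfl] at this
  have h2 : (Measure.pi fun _ : V => coin p).real {b | b v = false} = 1 - p := by
    have e := (measurePreserving_eval (fun _ : V => coin p) v).measure_preimage (s := {false})
      (MeasurableSet.of_discrete).nullMeasurableSet
    exact (congrArg ENNReal.toReal e).trans (coin_real_false hp1)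
  have h1 : (roundSeedMeasure V F N t).real
      (Set.univ.pi fun x => B x ×ˢ (if x = u then {α | ∑ j, α j * z j ≠ 0} else Set.univ)) =
      (∏ x, (coin (decayProb (Fintype.card V) t)).real (B x)) *
        (Measure.pi fun _ : Fin N => ProbabilityTheory.uniformOn (Set.univ : Set F)).real
          {α | ∑ j, α j * z j ≠ 0} := by
    unfold roundSeedMeasure
    rw [measureReal_def, Measure.pi_pi, ENNReal.toReal_prod]
    have e1 : ∀ x, (((coin (decayProb (Fintype.card V) t)).prod
        (Measure.pi fun _ : Fin N => ProbabilityTheory.uniformOn (Set.univ : Set F)))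
        (B x ×ˢ (if x = u then {α | ∑ j, α j * z j ≠ 0} else Set.univ))).toReal =
        (coin (decayProb (Fintype.card V) t)).real (B x) *
        (if x = u then (Measure.pi fun _ : Fin N =>
          ProbabilityTheory.uniformOn (Set.univ : Set F)).real {α | ∑ j, α j * z j ≠ 0} else 1) := by
      intro x
      rw [Measure.prod_prod, ENNReal.toReal_mul]
      split_ifs <;> simp [measureReal_def]
    rw [Finset.prod_congr rfl fun x _ => e1 x, Finset.prod_mul_distrib]
    simp
  rw [hset, measureReal_prod_prod, h1, h2]
  have h3 := uniform_linear_combination_ne_zero hz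
  have h4 : 0 ≤ ∏ x, (coin (decayProb (Fintype.card V) t)).real (B x) :=
    Finset.prod_nonneg fun _ _ => measureReal_nonneg
  calc _ = (∏ x, (coin (decayProb (Fintype.card V) t)).real (B x)) *
        (1 - 1 / (Fintype.card F : ℝ)) * (1 - p) := by ring
    _ ≤ _ := by
      refine mul_le_mul_of_nonneg_right (mul_le_mul_of_nonneg_left h3 h4) (by linarith)

variable {V : Type} [Fintype V] {G : SimpleGraph V} {s : V} (𝒯 : RankedBFSTree G s)
  (model : FaultModel) (c : ℕ) (T : ℕ) (bat : Fin k → ℕ) (sel : ℕ → V → ℕ) (β : ℕ) (μ : Fin k → F)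
  (p : ℝ)

/-- The probability that `w` is uninformed after `t` rounds. -/
noncomputable def probUninformed (t : ℕ) (w : V) : ℝ :=
  ((seedMeasure V F k T).prod (faultMeasure V T p)).real
    {ω | ¬ Informed bat β μ (coeffsKnown 𝒯 model c bat sel ω t w)}

variable [IsProbabilityMeasure (coin p)]

theorem probUninformed_le_one (t : ℕ) (w : V) :
    probUninformed 𝒯 model c T bat sel β μ p t w ≤ 1 := measureReal_le_one

theorem probUninformed_succ_le (t : ℕ) (w : V) :
    probUninformed 𝒯 model c T bat sel β μ p (t + 1) w ≤
      probUninformed 𝒯 model c T bat sel β μ p t w :=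
  measureReal_mono fun _ hω h => hω (h.mono (coeffsKnown_subset_succ _ _ _))

variable {𝒯 model c T bat sel β μ p}

/-- Two different nodes cannot both be the only broadcasting neighbour of `w`, so the success events
are disjoint and their probabilities add up. The past `ω` is fixed; only round `t` is random. -/
theorem round_uninformed_le (hp0 : 0 ≤ p) (hp1 : p ≤ 1) (t : ℕ) (ht : t < T) (w : V)
    (N : Finset V) (B : V → V → Set Bool)
    (hB : ∀ u ∈ N, ∀ b : V → Bool, (∀ x, b x ∈ B u x) → G.Adj u w ∧ Broadcasts 𝒯 c t u (b u) ∧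
      ¬ Broadcasts 𝒯 c t w (b w) ∧ ∀ x, G.Adj x w → x ≠ u → ¬ Broadcasts 𝒯 c t x (b x))
    (hsel : ∀ u ∈ N, sel t u = β) (ω : Seed V F k T × (Fin T → V → Bool))
    (N' : Finset V) (hN : N' ⊆ N)
    (hN' : ∀ u ∈ N', Informed bat β μ (coeffsKnown 𝒯 model c bat sel ω t u)) :
    ((roundSeedMeasure V F (k + T) t).prod (Measure.pi fun _ : V => coin p)).real
      {q | ¬ Informed bat β μ (coeffsKnown 𝒯 model c bat sel
        (Function.update ω.1 ⟨t, ht⟩ q.1, Function.update ω.2 ⟨t, ht⟩ q.2) (t + 1) w)} ≤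
      1 - ∑ u ∈ N', (∏ x, (coin (decayProb (Fintype.card V) t)).real (B u x)) *
        ((1 - p) * (1 - 1 / (Fintype.card F : ℝ))) := by
  set ν := (roundSeedMeasure V F (k + T) t).prod (Measure.pi fun _ : V => coin p) with hν
  let z : V → Fin (k + T) → F := fun u =>
    testValues (coeffsKnown 𝒯 model c bat sel ω t u) bat β μ (k + T)
  let D : V → Set ((V → Bool × (Fin (k + T) → F)) × (V → Bool)) := fun u =>
    {q | (∀ x, (q.1 x).1 ∈ B u x) ∧ ∑ j, (q.1 u).2 j * z u j ≠ 0 ∧ q.2 (culprit model u w) = false}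
  have hsub : {q | ¬ Informed bat β μ (coeffsKnown 𝒯 model c bat sel
      (Function.update ω.1 ⟨t, ht⟩ q.1, Function.update ω.2 ⟨t, ht⟩ q.2) (t + 1) w)} ⊆
      (⋃ u ∈ N', D u)ᶜ := by
    intro q hq hmem
    refine hq ?_
    simp only [Set.mem_iUnion] at hmem
    obtain ⟨u, hu, h1, h2, h3⟩ := hmem
    obtain ⟨hadj, b1, b2, b3⟩ := hB u (hN hu) (fun x => (q.1 x).1) h1
    refine informed_succ ht hadj ?_ ?_ ?_ ?_ (hsel u (hN hu)) ?_
    · simpa using b1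
    · simpa using b2
    · simpa using b3
    · simpa using h3
    · rw [coeffsKnown_congr (ω' := ω) t]
      · simpa using h2
      · intro i hi
        have : i ≠ ⟨t, ht⟩ := fun h => by rw [h] at hi; exact lt_irrefl _ hi
        exact ⟨Function.update_of_ne this _ _, Function.update_of_ne this _ _⟩
  have hdisj : Set.PairwiseDisjoint (N' : Set V) D := by
    intro u hu u' hu' hne
    refine Set.disjoint_left.2 fun q hq hq' => ?_
    have h1 := hB u (hN hu) (fun x => (q.1 x).1) hq.1
    have h2 := hB u' (hN hu') (fun x => (q.1 x).1) hq'.1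
    exact h2.2.2.2 u h1.1 hne h1.2.1
  calc ν.real _ ≤ ν.real (⋃ u ∈ N', D u)ᶜ := measureReal_mono hsub
    _ = 1 - ∑ u ∈ N', ν.real (D u) := by
      rw [probReal_compl_eq_one_sub (MeasurableSet.of_discrete),
        measureReal_biUnion_finset hdisj fun _ _ => MeasurableSet.of_discrete]
    _ ≤ _ := by
      refine sub_le_sub_left (Finset.sum_le_sum fun u hu => ?_) 1
      obtain ⟨j₀, hj₀⟩ := (hN' u hu).exists_testValues_ne_zero (length_coeffsKnown_le ω t u)
      exact round_box_le hp0 hp1 (B u) u (culprit model u w) hj₀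

/-- The recursion for the probabilities of being uninformed. -/
theorem probUninformed_succ (hp0 : 0 ≤ p) (hp1 : p ≤ 1) {t : ℕ} (ht : t < T) (w : V)
    (N : Finset V) (B : V → V → Set Bool)
    (hB : ∀ u ∈ N, ∀ b : V → Bool, (∀ x, b x ∈ B u x) → G.Adj u w ∧ Broadcasts 𝒯 c t u (b u) ∧
      ¬ Broadcasts 𝒯 c t w (b w) ∧ ∀ x, G.Adj x w → x ≠ u → ¬ Broadcasts 𝒯 c t x (b x))
    (hsel : ∀ u ∈ N, sel t u = β) (a : V → ℝ)
    (ha0 : ∀ u ∈ N, 0 ≤ a u)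
    (ha : ∀ u ∈ N, a u ≤ (∏ x, (coin (decayProb (Fintype.card V) t)).real (B u x)) *
        ((1 - p) * (1 - 1 / (Fintype.card F : ℝ)))) :
    probUninformed 𝒯 model c T bat sel β μ p (t + 1) w ≤
      (1 - ∑ u ∈ N, a u) * probUninformed 𝒯 model c T bat sel β μ p t w +
        ∑ u ∈ N, a u * probUninformed 𝒯 model c T bat sel β μ p t u := by
  classical
  set ℙ := (seedMeasure V F k T).prod (faultMeasure V T p) with hℙ
  let I : ℕ → V → Set (Seed V F k T × (Fin T → V → Bool)) := fun t w =>
    {ω | ¬ Informed bat β μ (coeffsKnown 𝒯 model c bat sel ω t w)}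
  let g : Seed V F k T × (Fin T → V → Bool) → ℝ := fun ω =>
    (1 - ∑ u ∈ N, a u) * (I t w).indicator 1 ω + ∑ u ∈ N, a u * (I t u).indicator 1 ω
  let ν := (roundSeedMeasure V F (k + T) t).prod (Measure.pi fun _ : V => coin p)
  -- If `w` is uninformed, each informed `u` in `N` contributes `a u`; if `w` is informed, it stays
  -- so and the left side is 0. Integrating over `ω` gives the recursion.
  have key : ∀ ω, ν.real {q | (Function.update ω.1 ⟨t, ht⟩ q.1, Function.update ω.2 ⟨t, ht⟩ q.2) ∈
      I (t + 1) w} ≤ g ω := by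
    intro ω
    set N' := N.filter fun u => Informed bat β μ (coeffsKnown 𝒯 model c bat sel ω t u) with hN'
    have hle := round_uninformed_le hp0 hp1 t ht w N B hB hsel ω N' (Finset.filter_subset _ _)
      (fun u hu => (Finset.mem_filter.1 hu).2)
    have hsum : ∑ u ∈ N', a u + ∑ u ∈ N, a u * (I t u).indicator 1 ω = ∑ u ∈ N, a u := by
      rw [hN', Finset.sum_filter, ← Finset.sum_add_distrib]
      refine Finset.sum_congr rfl fun u _ => ?_
      by_cases h : Informed bat β μ (coeffsKnown 𝒯 model c bat sel ω t u)
      · rw [if_pos h, Set.indicator_of_notMem (show ω ∉ I t u from fun hn => hn h)]; simp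
      · rw [if_neg h, Set.indicator_of_mem (show ω ∈ I t u from h)]; simp
    replace hle := hle.trans (sub_le_sub_left
      (Finset.sum_le_sum fun u hu => ha u (Finset.filter_subset _ _ hu)) 1)
    by_cases hw : ω ∈ I t w
    · refine hle.trans ?_
      simp only [g, Set.indicator_of_mem hw, Pi.one_apply, mul_one]
      linarith
    · have hempty : {q | (Function.update ω.1 ⟨t, ht⟩ q.1, Function.update ω.2 ⟨t, ht⟩ q.2) ∈
          I (t + 1) w} = (∅ : Set ((V → Bool × (Fin (k + T) → F)) × (V → Bool))) := by
        refine Set.eq_empty_of_forall_notMem fun q hq => hq ?_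
        refine Informed.mono ?_ (coeffsKnown_subset_succ _ _ _)
        rw [coeffsKnown_congr (ω' := ω) t]
        · exact not_not.1 hw
        · intro i hi
          have : i ≠ ⟨t, ht⟩ := fun h => by rw [h] at hi; exact lt_irrefl _ hi
          exact ⟨Function.update_of_ne this _ _, Function.update_of_ne this _ _⟩
      rw [hempty, measureReal_empty]
      simp only [g, Set.indicator_of_notMem hw, mul_zero, zero_add]
      exact Finset.sum_nonneg fun u hu => mul_nonneg (ha0 u hu)
        (Set.indicator_nonneg (fun _ _ => zero_le_one) _)
  have hint : ∀ f : Seed V F k T × (Fin T → V → Bool) → ℝ, Integrable f ℙ := fun f =>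
    Integrable.of_finite
  have hg0 : ∀ ω, 0 ≤ g ω := fun ω => measureReal_nonneg.trans (key ω)
  have h1 : ℙ (I (t + 1) w) ≤ ENNReal.ofReal (∫ ω, g ω ∂ℙ) := by
    rw [ofReal_integral_eq_lintegral_ofReal (hint g) (Eventually.of_forall hg0),
      ← lintegral_indicator_one MeasurableSet.of_discrete]
    refine (lintegral_update_prod (fun t : Fin T => roundSeedMeasure V F (k + T) t)
      (fun _ => Measure.pi fun _ : V => coin p) ⟨t, ht⟩ Measurable.of_discrete).symm.trans_le ?_
    refine lintegral_mono fun ω => ?_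
    have e1 : ∀ q : (V → Bool × (Fin (k + T) → F)) × (V → Bool), ((I (t + 1) w).indicator 1
        (Function.update ω.1 ⟨t, ht⟩ q.1, Function.update ω.2 ⟨t, ht⟩ q.2) : ENNReal) =
        {q : (V → Bool × (Fin (k + T) → F)) × (V → Bool) | (Function.update ω.1 ⟨t, ht⟩ q.1,
          Function.update ω.2 ⟨t, ht⟩ q.2) ∈ I (t + 1) w}.indicator 1 q := fun q => rfl
    simp only [e1]
    rw [lintegral_indicator_one MeasurableSet.of_discrete]
    exact ENNReal.le_ofReal_iff_toReal_le (measure_ne_top ν _) (hg0 ω) |>.2 (key ω)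
  have h2 : ∫ ω, g ω ∂ℙ = (1 - ∑ u ∈ N, a u) * ℙ.real (I t w) + ∑ u ∈ N, a u * ℙ.real (I t u) := by
    simp only [g]
    rw [integral_add (hint _) (hint _), integral_const_mul, integral_finset_sum _ fun _ _ => hint _]
    simp only [integral_const_mul, integral_indicator_one MeasurableSet.of_discrete]
  have h3 := ENNReal.toReal_le_of_le_ofReal (integral_nonneg hg0) h1
  rwa [h2] at h3

end OneRound

/-! ### The rules hold for the probabilities of being uninformed -/

/-- For some Decay probability the only broadcasting node among `m` candidates is a given one with
probability at least `1 / (16 m)`. -/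
theorem decay_bound {m : ℕ} (hm : 1 ≤ m) :
    1 / (16 * (m : ℝ)) ≤ (2 : ℝ)⁻¹ ^ Nat.log 2 m * (1 - (2 : ℝ)⁻¹ ^ Nat.log 2 m) ^ (m - 1) := by
  have h1 : 2 ^ Nat.log 2 m ≤ m := Nat.pow_log_le_self 2 (by omega)
  have h2 : m < 2 ^ (Nat.log 2 m + 1) := Nat.lt_pow_succ_log_self one_lt_two m
  have hm0 : (0 : ℝ) < m := by exact_mod_cast hm
  generalize Nat.log 2 m = i at h1 h2
  have h2' : (m : ℝ) ≤ 2 ^ (i + 1) := by exact_mod_cast h2.le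
  rcases Nat.eq_zero_or_pos i with rfl | hi
  · have : m = 1 := by omega
    subst this
    norm_num
  · obtain ⟨j, rfl⟩ : ∃ j, i = j + 1 := ⟨i - 1, by omega⟩
    set x : ℝ := 2⁻¹ ^ (j + 1) with hx
    have hx0 : 0 < x := by positivity
    have hx1 : x ≤ 1 := pow_le_one₀ (by norm_num) (by norm_num)
    have hx2 : x * 2 ^ j = 1 / 2 := by
      rw [hx, pow_succ, inv_pow]
      field_simp
    have hb : 1 / 2 ≤ (1 - x) ^ 2 ^ j := by
      have := one_add_mul_le_pow (by linarith : -2 ≤ -x) (2 ^ j)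
      push_cast at this
      rw [← sub_eq_add_neg] at this
      linarith
    have hmx : m * x ≤ 2 := by
      calc m * x ≤ 2 ^ (j + 1 + 1) * x := by gcongr
        _ = 4 * (x * 2 ^ j) := by ring
        _ = 2 := by rw [hx2]; norm_num
    have hmx1 : 1 ≤ m * x := by
      have h1' : (2 : ℝ) ^ (j + 1) ≤ m := by exact_mod_cast h1
      calc 1 = 2 * (x * 2 ^ j) := by rw [hx2]; norm_num
        _ = 2 ^ (j + 1) * x := by ring
        _ ≤ m * x := by gcongr
    -- `m - 1` is at most `4 * 2 ^ j`, and by `hb` each `2 ^ j` silent candidates cost at most a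
    -- factor 2.
    have hpow : 1 / 16 ≤ (1 - x) ^ (m - 1) := by
      calc (1 : ℝ) / 16 = (1 / 2) ^ 4 := by norm_num
        _ ≤ ((1 - x) ^ 2 ^ j) ^ 4 := by gcongr
        _ = (1 - x) ^ (2 ^ (j + 1 + 1)) := by rw [← pow_mul]; congr 1; ring
        _ ≤ (1 - x) ^ (m - 1) :=
          pow_le_pow_of_le_one (by linarith) (by linarith) (by omega)
    rw [div_le_iff₀ (by positivity)]
    calc (1 : ℝ) ≤ 16 * (m * x) * (1 / 16) := by linarith
      _ ≤ 16 * (m * x) * (1 - x) ^ (m - 1) := by gcongr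
      _ = _ := by ring

section Rules

variable {F : Type} [Field F] [Fintype F] [MeasurableSpace F] [DiscreteMeasurableSpace F] {k : ℕ}
  {V : Type} [Fintype V] {G : SimpleGraph V} {s : V} {𝒯 : RankedBFSTree G s}
  {model : FaultModel} {c T : ℕ} {bat : Fin k → ℕ} {sel : ℕ → V → ℕ} {β : ℕ} {μ : Fin k → F}
  {p : ℝ} [IsProbabilityMeasure (coin p)]

/-- The probability that a transmission is not faulty and that its coefficients do not cancel. -/
noncomputable def successRate (F : Type) [Fintype F] (p : ℝ) : ℝ :=
  (1 - p) * (1 - 1 / (Fintype.card F : ℝ))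

theorem probUninformed_fast_step (hp0 : 0 ≤ p) (hp1 : p < 1) (hG : G.Connected) (hT : 𝒯.IsGBST)
    {t : ℕ} (ht : t < T) (ht2 : t % 2 = 0) {u w : V} (huw : 𝒯.FastEdge u w) (hsel : sel t u = β)
    (h1 : ((G.dist s u / blockSize (Fintype.card V) : ℕ) : ℤ) - 6 * (𝒯.rank u : ℤ) ≡
      ((t / 2 / (c * blockSize (Fintype.card V)) : ℕ) : ℤ) [ZMOD 6 * (𝒯.maxRank : ℤ)])
    (h2 : G.dist s u ≡ t [MOD 3]) :
    probUninformed 𝒯 model c T bat sel β μ p (t + 1) w ≤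
      (1 - successRate F p) * probUninformed 𝒯 model c T bat sel β μ p t w +
        successRate F p * probUninformed 𝒯 model c T bat sel β μ p t u := by
  have hF : (1 : ℝ) / Fintype.card F ≤ 1 := by
    rw [div_le_one (by exact_mod_cast Fintype.card_pos)]
    exact_mod_cast Fintype.card_pos
  have := probUninformed_succ (𝒯 := 𝒯) (model := model) (c := c) (bat := bat) (sel := sel) (β := β)
    (μ := μ) hp0 hp1.le ht w {u} (fun _ _ => Set.univ) (fun u' hu' b _ => by
      rw [Finset.mem_singleton.1 hu']
      exact hT.broadcasts_even hG ht2 huw h1 h2 b) (fun u' hu' => by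
      rw [Finset.mem_singleton.1 hu', hsel]) (fun _ => successRate F p)
    (fun _ _ => mul_nonneg (by linarith) (by linarith)) (fun _ _ => by
      simp only [probReal_univ, Finset.prod_const_one, one_mul]
      exact le_rfl)
  simpa using this

/-- Virtual distances of adjacent nodes differ by at most 1, so modulo 3 neither `w` nor a neighbour
outside `N` is served. The Decay probability fits `N.card`: each candidate is alone with probability
at least `1 / (16 * N.card)`, and these shares sum to `1 / 16`. -/
theorem probUninformed_slow_step (hp0 : 0 ≤ p) (hp1 : p < 1) (hG : G.Connected)
    {t d : ℕ} (ht : t < T) (ht2 : t % 2 = 1) {w : V} (hw : 𝒯.virtualDist w = d + 1)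
    {N : Finset V} (hN : ∀ u, u ∈ N ↔ G.Adj u w ∧ 𝒯.virtualDist u = d) (hN1 : 1 ≤ N.card)
    (htd : t / 2 % 3 = d % 3) (hdecay : t / 2 / 3 % decayLength (Fintype.card V) = Nat.log 2 N.card)
    (hsel : ∀ u ∈ N, sel t u = β) :
    probUninformed 𝒯 model c T bat sel β μ p (t + 1) w ≤
      (1 - successRate F p / 16) * probUninformed 𝒯 model c T bat sel β μ p t w +
        ∑ u ∈ N, successRate F p / 16 / N.card *
          probUninformed 𝒯 model c T bat sel β μ p t u := by
  classical
  have hF : (1 : ℝ) / Fintype.card F ≤ 1 := by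
    rw [div_le_one (by exact_mod_cast Fintype.card_pos)]
    exact_mod_cast Fintype.card_pos
  have hr : 0 ≤ successRate F p := mul_nonneg (by linarith) (by linarith)
  have hc0 : (0 : ℝ) < N.card := by exact_mod_cast hN1
  have hB : ∀ x b, Broadcasts 𝒯 c t x b ↔ t / 2 % 3 = 𝒯.virtualDist x % 3 ∧ b = true := by
    intro x b
    unfold Broadcasts
    rw [if_pos ht2]
    rfl
  have := probUninformed_succ (𝒯 := 𝒯) (model := model) (c := c) (bat := bat) (sel := sel) (β := β)
    (μ := μ) hp0 hp1.le ht w N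
    (fun u x => if x = u then {true} else if x ∈ N then {false} else Set.univ) ?_ hsel
    (fun _ => successRate F p / 16 / N.card) (fun _ _ => by positivity) ?_
  · rw [Finset.sum_const, nsmul_eq_mul, mul_div_cancel₀ _ hc0.ne'] at this
    exact this
  · intro u hu b hb
    obtain ⟨hadj, hd⟩ := (hN u).1 hu
    simp only [hB]
    refine ⟨hadj, ⟨by rw [htd, hd], by simpa using hb u⟩, fun h => ?_, fun x hx hne h => ?_⟩
    · have := h.1
      rw [hw] at this
      omega
    · have e1 := 𝒯.virtualDist_le_add_one hG (Or.inl hx)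
      have e2 := 𝒯.virtualDist_le_add_one hG (Or.inl hx.symm)
      have e3 := h.1
      have hxN : x ∈ N := (hN x).2 ⟨hx, by omega⟩
      have e4 := hb x
      rw [if_neg hne, if_pos hxN] at e4
      rw [e4] at h
      exact absurd h.2 Bool.false_ne_true
  · intro u hu
    set x := decayProb (Fintype.card V) t with hx
    have hxv : x = (2 : ℝ)⁻¹ ^ Nat.log 2 N.card := by rw [hx, decayProb, hdecay]
    have hprod : (∏ y, (coin x).real (if y = u then {true} else if y ∈ N then {false}
        else Set.univ)) = x * (1 - x) ^ (N.card - 1) := by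
      have e1 : ∀ y, (coin x).real (if y = u then {true} else if y ∈ N then {false}
          else Set.univ) = if y ∈ N then (if y = u then x else 1 - x) else 1 := by
        intro y
        by_cases hy : y = u
        · subst hy
          rw [if_pos rfl, if_pos hu, if_pos rfl, coin_real_true (decayProb_nonneg _ _)]
        · rw [if_neg hy, if_neg hy]
          by_cases hyN : y ∈ N
          · rw [if_pos hyN, if_pos hyN, coin_real_false (decayProb_le_one _ _)]
          · rw [if_neg hyN, if_neg hyN, probReal_univ]
      rw [Finset.prod_congr rfl fun y _ => e1 y, Finset.prod_ite_mem, Finset.univ_inter,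
        ← Finset.mul_prod_erase _ _ hu, if_pos rfl, Finset.prod_congr rfl fun y hy =>
          if_neg (Finset.ne_of_mem_erase hy), Finset.prod_const, Finset.card_erase_of_mem hu]
    rw [hprod, hxv]
    have := mul_le_mul_of_nonneg_right (decay_bound hN1) hr
    refine le_trans (le_of_eq ?_) this
    field_simp

/-- All three conditions hold for the single residue `6 * i + 2 * (d % 3) + 1` modulo `6 * L`. -/
theorem exists_round_with_residue {L i d t : ℕ} (hi : i < L) :
    ∃ t', t ≤ t' ∧ t' < t + 6 * L ∧ t' % 2 = 1 ∧ t' / 2 % 3 = d % 3 ∧ t' / 2 / 3 % L = i := by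
  have h6 : 0 < 6 * L := by omega
  have h1 := Nat.mod_lt t h6
  have hr : 6 * i + 2 * (d % 3) + 1 < 6 * L := by omega
  obtain ⟨t', ht1, ht2, ht3⟩ : ∃ t', t ≤ t' ∧ t' < t + 6 * L ∧
      t' % (6 * L) = 6 * i + 2 * (d % 3) + 1 := by
    by_cases h : t % (6 * L) ≤ 6 * i + 2 * (d % 3) + 1
    · refine ⟨t - t % (6 * L) + (6 * i + 2 * (d % 3) + 1), ?_, ?_, ?_⟩
      · have := Nat.mod_le t (6 * L); omega
      · have := Nat.mod_le t (6 * L); omega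
      · rw [Nat.add_mod, (Nat.mod_eq_zero_of_dvd (Nat.dvd_sub_mod t)), zero_add, Nat.mod_mod,
          Nat.mod_eq_of_lt hr]
    · refine ⟨t - t % (6 * L) + (6 * i + 2 * (d % 3) + 1) + 6 * L, ?_, ?_, ?_⟩
      · have := Nat.mod_le t (6 * L); omega
      · have := Nat.mod_le t (6 * L); omega
      · rw [Nat.add_mod_right, Nat.add_mod, (Nat.mod_eq_zero_of_dvd (Nat.dvd_sub_mod t)), zero_add,
          Nat.mod_mod, Nat.mod_eq_of_lt hr]
  have h2 := Nat.div_add_mod t' (6 * L)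
  rw [ht3, mul_assoc] at h2
  set y := L * (t' / (6 * L)) with hy
  refine ⟨t', ht1, ht2, by omega, by omega, ?_⟩
  have h3 : t' / 2 / 3 = i + y := by omega
  rw [h3, hy, Nat.add_mul_mod_self_left, Nat.mod_eq_of_lt hi]

/-- The coefficients of the recursions sum to 1, so they survive the subtraction of `δ`, the error
inherited at the levels up to `lo`. Since `vd w ≥ 1`, the bound `lev w + vd w ≤ hi` keeps slow
senders, possibly one level below `w`, where `sel` is `β`. -/
theorem spreadRules_probUninformed (hp0 : 0 ≤ p) (hp1 : p < 1) (hG : G.Connected) (hT : 𝒯.IsGBST)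
    {lo hi t₀ t₁ : ℕ} {δ : ℝ} (hδ : 0 ≤ δ) (ht₁ : t₁ ≤ T)
    (hsel : ∀ t, t₀ ≤ t → t < t₁ → ∀ u, lo ≤ G.dist s u → G.dist s u ≤ hi → sel t u = β)
    (hlow : ∀ w, G.dist s w ≤ lo → probUninformed 𝒯 model c T bat sel β μ p t₀ w ≤ δ) :
    SpreadRules (fun w => G.dist s w) 𝒯.virtualDist 𝒯.rank 𝒯.parent
      (fun t w => probUninformed 𝒯 model c T bat sel β μ p t w - δ)
      (decayLength (Fintype.card V)) (blockSize (Fintype.card V)) 𝒯.maxRank c lo hi t₀ t₁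
      (successRate F p) (successRate F p / 16) := by
  classical
  have hF : (1 : ℝ) / Fintype.card F ≤ 1 := by
    rw [div_le_one (by exact_mod_cast Fintype.card_pos)]
    exact_mod_cast Fintype.card_pos
  have hr : 0 ≤ successRate F p := mul_nonneg (by linarith) (by linarith)
  have hr1 : successRate F p ≤ 1 := mul_le_one₀ (by linarith) (by linarith)
    (by linarith [(by positivity : 0 ≤ (1 : ℝ) / Fintype.card F)])
  have hanti : ∀ w {t t'}, t ≤ t' → probUninformed 𝒯 model c T bat sel β μ p t' w ≤
      probUninformed 𝒯 model c T bat sel β μ p t w := fun w _ _ h =>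
    antitone_nat_of_succ_le (f := fun t => probUninformed 𝒯 model c T bat sel β μ p t w)
      (fun t => probUninformed_succ_le 𝒯 model c T bat sel β μ p t w) h
  refine ⟨fun t w _ _ => ?_, fun t w _ _ => ?_, fun t w h0 _ hw => ?_, fun w hlo hhi => ?_⟩
  · linarith [probUninformed_le_one 𝒯 model c T bat sel β μ p t w]
  · exact sub_le_sub_right (probUninformed_succ_le 𝒯 model c T bat sel β μ p t w) δ
  · linarith [hlow w hw, hanti w h0]
  · have hws : w ≠ s := by rintro rfl; simp at hlo
    have hd0 : 𝒯.virtualDist w ≠ 0 := fun h => hws (𝒯.eq_root_of_virtualDist_eq_zero hG h)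
    obtain ⟨d, hd⟩ := Nat.exists_eq_succ_of_ne_zero hd0
    rw [Nat.succ_eq_add_one] at hd
    rcases 𝒯.exists_adj_or_fastEdge hG hd with ⟨u₀, hu₀, hdu₀⟩ | ⟨hfe, hdp⟩
    · left
      set N := Finset.univ.filter fun u => G.Adj u w ∧ 𝒯.virtualDist u = d with hNdef
      have hN : ∀ u, u ∈ N ↔ G.Adj u w ∧ 𝒯.virtualDist u = d := fun u => by simp [hNdef]
      have hN1 : 1 ≤ N.card := Finset.card_pos.2 ⟨u₀, (hN u₀).2 ⟨hu₀, hdu₀⟩⟩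
      have hlev : ∀ u ∈ N, lo ≤ G.dist s u ∧ G.dist s u ≤ G.dist s w + 1 := by
        intro u hu
        have e1 := dist_le_dist_add_one hG s ((hN u).1 hu).1
        have e2 := dist_le_dist_add_one hG s ((hN u).1 hu).1.symm
        omega
      intro t B Q ht0 ht1 hQB hB hQ
      dsimp only at hB hQ ⊢
      have hlog : Nat.log 2 N.card < decayLength (Fintype.card V) := by
        have e1 : 2 ^ Nat.log 2 N.card ≤ N.card := Nat.pow_log_le_self 2 (by omega)
        have e2 : N.card < Fintype.card V := Finset.card_lt_univ_of_notMem (x := w) (by simp [hN])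
        have e3 : Fintype.card V ≤ 2 ^ Nat.clog 2 (Fintype.card V) := Nat.le_pow_clog one_lt_two _
        exact (Nat.pow_lt_pow_iff_right one_lt_two).1 (e1.trans_lt (e2.trans_le e3))
      obtain ⟨t', ht1', ht2', ht3', ht4', ht5'⟩ := exists_round_with_residue (d := d) (t := t) hlog
      have e1 := probUninformed_slow_step (model := model) (c := c) (bat := bat) (μ := μ)
        hp0 hp1 hG (by omega : t' < T) ht3' hd hN hN1 ht4' ht5'
        (fun u hu => hsel t' (by omega) (by omega) u (hlev u hu).1
          (by have := (hlev u hu).2; omega))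
      have hc0 : (0 : ℝ) < N.card := by exact_mod_cast hN1
      have e2 : ∑ u ∈ N, successRate F p / 16 / N.card *
          probUninformed 𝒯 model c T bat sel β μ p t' u ≤ successRate F p / 16 * (Q + δ) := by
        calc _ ≤ ∑ u ∈ N, successRate F p / 16 / N.card * (Q + δ) := by
              refine Finset.sum_le_sum fun u hu => mul_le_mul_of_nonneg_left ?_ (by positivity)
              have := hQ u (by rw [((hN u).1 hu).2, hd]) (hlev u hu).2
              linarith [hanti u ht1']
          _ = _ := by
            rw [Finset.sum_const, nsmul_eq_mul]
            field_simp
      have e3 := hanti w (by omega : t' + 1 ≤ t + 6 * decayLength (Fintype.card V))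
      have e4 := hanti w ht1'
      have e5 : (1 - successRate F p / 16) * probUninformed 𝒯 model c T bat sel β μ p t' w ≤
          (1 - successRate F p / 16) * (B + δ) :=
        mul_le_mul_of_nonneg_left (by linarith) (by linarith)
      linarith
    · right
      have hdist := 𝒯.dist_parent w hws
      refine ⟨hdist, hdp.trans hd.symm, hfe.2.2.symm, fun t ht0 ht1 ht2 h1 h2 => ?_⟩
      have hdist' : G.dist s w - 1 = G.dist s (𝒯.parent w) := by omega
      dsimp only at h1 h2 ⊢
      rw [hdist'] at h1 h2
      rw [hfe.2.2] at h1
      have := probUninformed_fast_step (model := model) (c := c) (bat := bat) (μ := μ) hp0 hp1 hG hT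
        (by omega : t < T) ht2 hfe
        (hsel t ht0 ht1 (𝒯.parent w) (by omega) (by omega)) h1 h2
      linarith

end Rules

/-! ### Logarithms -/

theorem two_le_decayLength {n : ℕ} (hn : 3 ≤ n) : 2 ≤ decayLength n := by
  unfold decayLength
  have : Nat.clog 2 3 = 2 := by decide +kernel
  exact this ▸ Nat.clog_mono_right 2 hn

theorem one_le_blockSize {n : ℕ} (hn : 3 ≤ n) : 1 ≤ blockSize n :=
  Nat.clog_pos one_lt_two (two_le_decayLength hn)

theorem decayLength_le_two_pow (n : ℕ) : decayLength n ≤ 2 ^ blockSize n :=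
  Nat.le_pow_clog one_lt_two _

theorem clog_le_one_add_log {n : ℕ} (hn : 2 ≤ n) :
    (Nat.clog 2 n : ℝ) ≤ 1 + 3 / 2 * Real.log n := by
  have h1 : 2 ^ (Nat.clog 2 n - 1) < n := Nat.pow_pred_clog_lt_self one_lt_two hn
  have h2 : 1 ≤ Nat.clog 2 n := Nat.clog_pos one_lt_two hn
  obtain ⟨j, hj⟩ : ∃ j, Nat.clog 2 n = j + 1 := ⟨Nat.clog 2 n - 1, by omega⟩
  rw [hj, Nat.add_sub_cancel] at h1
  have h3 : (2 : ℝ) ^ j ≤ n := by exact_mod_cast h1.le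
  have h4 := Real.log_le_log (by positivity) h3
  rw [Real.log_pow] at h4
  have h5 := Real.log_two_gt_d9
  have h6 : (0 : ℝ) ≤ j := Nat.cast_nonneg j
  rw [hj]
  push_cast
  nlinarith

/-- From `log 3 = 1 + log (3 / e) ≥ 2 - e / 3`. -/
theorem one_lt_log_of_three_le {n : ℕ} (hn : 3 ≤ n) : 13 / 12 ≤ Real.log n := by
  have h1 : Real.log 3 ≤ Real.log n := Real.log_le_log (by norm_num) (by exact_mod_cast hn)
  have h2 := Real.one_sub_inv_le_log_of_pos (by positivity : 0 < 3 / Real.exp 1)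
  rw [Real.log_div (by norm_num) (by positivity), Real.log_exp, inv_div] at h2
  have := Real.exp_one_lt_d9
  linarith

/-- A positive lower bound lets additive constants be absorbed into multiples of `log log n`. -/
theorem log_log_ge {n : ℕ} (hn : 3 ≤ n) : 1 / 13 ≤ Real.log (Real.log n) := by
  have h1 := one_lt_log_of_three_le hn
  have h2 := Real.one_sub_inv_le_log_of_pos (by linarith : 0 < Real.log n)
  have h3 : (Real.log n)⁻¹ ≤ (13 / 12)⁻¹ := inv_anti₀ (by norm_num) h1
  norm_num at h3
  linarith

theorem decayLength_le_log {n : ℕ} (hn : 3 ≤ n) : (decayLength n : ℝ) ≤ 3 * Real.log n := by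
  have h1 := clog_le_one_add_log (by omega : 2 ≤ n)
  have h2 := one_lt_log_of_three_le hn
  unfold decayLength
  linarith

theorem blockSize_le_log_log {n : ℕ} (hn : 3 ≤ n) :
    (blockSize n : ℝ) ≤ 60 * Real.log (Real.log n) := by
  have h0 := two_le_decayLength hn
  have h1 := clog_le_one_add_log h0
  have h2 := one_lt_log_of_three_le hn
  have h3 := log_log_ge hn
  have h4 : Real.log (decayLength n) ≤ Real.log (3 * Real.log n) :=
    Real.log_le_log (by exact_mod_cast (by omega : 0 < decayLength n)) (decayLength_le_log hn)
  rw [Real.log_mul (by norm_num) (by linarith)] at h4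
  have h5 : Real.log 3 ≤ 3 - 1 := Real.log_le_sub_one_of_pos (by norm_num)
  change (Nat.clog 2 (decayLength n) : ℝ) ≤ _
  linarith

/-- The number of rounds that the analysis needs is within a constant factor of `roundBound`. -/
theorem rounds_le_roundBound {n : ℕ} (hn : 3 ≤ n) (D k : ℕ) :
    ((D + (k + decayLength n) * decayLength n * blockSize n : ℕ) : ℝ) ≤
      540 * roundBound n D k := by
  have h1 := decayLength_le_log hn
  have h2 := blockSize_le_log_log hn
  have h3 := one_lt_log_of_three_le hn
  have h4 := log_log_ge hn
  have h5 : (decayLength n : ℝ) * blockSize n ≤ 180 * (Real.log n * Real.log (Real.log n)) := by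
    calc (decayLength n : ℝ) * blockSize n ≤ (3 * Real.log n) * (60 * Real.log (Real.log n)) := by
          gcongr
      _ = _ := by ring
  have h6 : (decayLength n : ℝ) * (decayLength n * blockSize n) ≤
      540 * (Real.log n ^ 2 * Real.log (Real.log n)) := by
    calc (decayLength n : ℝ) * (decayLength n * blockSize n)
        ≤ (3 * Real.log n) * (180 * (Real.log n * Real.log (Real.log n))) := by gcongr
      _ = _ := by ring
  have h7 : (k : ℝ) * (decayLength n * blockSize n) ≤
      k * (180 * (Real.log n * Real.log (Real.log n))) := by gcongr
  have h8 : 0 ≤ (k : ℝ) * (Real.log n * Real.log (Real.log n)) := by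
    have : 0 ≤ Real.log n := by linarith
    have : 0 ≤ Real.log (Real.log n) := by linarith
    positivity
  have h9 : (0 : ℝ) ≤ D := Nat.cast_nonneg D
  unfold roundBound
  push_cast
  linarith

/-! ### Progress through a zone of levels -/

section Zone

/-- The common tool of both algorithms. The `2 L + 1` extra levels below the zone leave room for
slow paths, whose excursions are bounded by the virtual distance. -/
theorem exists_zone_progress (p : ℝ) (F : Type) [Field F] [Fintype F] [MeasurableSpace F]
    [DiscreteMeasurableSpace F] (hp0 : 0 ≤ p) (hp1 : p < 1) (H : ℝ) :
    ∃ c₀ : ℕ, ∀ c : ℕ, c₀ ≤ c → ∃ C : ℕ, 1 ≤ C ∧ ∀ (model : FaultModel) (V : Type) [Fintype V]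
      (G : SimpleGraph V) (s : V) (𝒯 : RankedBFSTree G s), G.Connected → 3 ≤ Fintype.card V →
      𝒯.IsGBST → ∀ (k T : ℕ) (bat : Fin k → ℕ) (sel : ℕ → V → ℕ) (β : ℕ) (μ : Fin k → F)
      (lo Δ hi t₀ t₁ h : ℕ) (δ : ℝ), 0 ≤ δ → t₁ ≤ T →
      (∀ t, t₀ ≤ t → t < t₁ → ∀ u, lo ≤ G.dist s u → G.dist s u ≤ hi → sel t u = β) →
      (∀ w, G.dist s w ≤ lo → probUninformed 𝒯 model c T bat sel β μ p t₀ w ≤ δ) →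
      decayLength (Fintype.card V) ≤ h →
      t₀ + C * (Δ + h * decayLength (Fintype.card V) * blockSize (Fintype.card V)) ≤ t₁ →
      lo + Δ + 2 * decayLength (Fintype.card V) + 1 ≤ hi → ∀ w, G.dist s w ≤ lo + Δ →
      probUninformed 𝒯 model c T bat sel β μ p t₁ w ≤ δ + Real.exp (-H) ^ h := by
  haveI := coin_isProbabilityMeasure hp0 hp1.le
  have hF0 : (0 : ℝ) < 1 / Fintype.card F := by
    have : (0 : ℝ) < Fintype.card F := by exact_mod_cast Fintype.card_pos
    positivity
  have hF1 : (1 : ℝ) / Fintype.card F < 1 := by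
    rw [div_lt_one (by exact_mod_cast Fintype.card_pos)]
    exact_mod_cast Fintype.one_lt_card
  have hr0 : 0 < successRate F p := mul_pos (by linarith) (by linarith)
  have hr1 : successRate F p ≤ 1 := mul_le_one₀ (by linarith) (by linarith) (by linarith)
  obtain ⟨c₀, hc₀⟩ := exists_spread_constants H hr0 hr1 (by linarith : 0 < successRate F p / 16)
    (by linarith)
  refine ⟨c₀, fun c hc => ?_⟩
  obtain ⟨C, hC1, hC⟩ := hc₀ c hc
  refine ⟨C, hC1, ?_⟩
  intro model V _ G s 𝒯 hG hn hT k T bat sel β μ lo Δ hi t₀ t₁ h δ hδ ht₁ hsel hlow hh ht hhi w hw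
  have hL := two_le_decayLength hn
  have hR : 1 ≤ 𝒯.maxRank := (𝒯.one_le_rank hG s).trans (𝒯.rank_le_maxRank s)
  have hR2 : 𝒯.maxRank ≤ decayLength (Fintype.card V) + 1 := 𝒯.maxRank_le_clog hG
  have hvd : ∀ w, 𝒯.virtualDist w ≤ 2 * decayLength (Fintype.card V) + 1 :=
    𝒯.virtualDist_le_clog hG
  have := hC V (fun w => G.dist s w) 𝒯.virtualDist 𝒯.rank 𝒯.parent
    (fun t w => probUninformed 𝒯 model c T bat sel β μ p t w - δ)
    (decayLength (Fintype.card V)) (blockSize (Fintype.card V)) 𝒯.maxRank lo Δ hi t₀ t₁ h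
    (one_le_blockSize hn) (by omega) (decayLength_le_two_pow _) hR (by omega)
    (spreadRules_probUninformed hp0 hp1 hG hT hδ ht₁ hsel hlow) hvd hh ht w hw
    (by have := hvd w; omega)
  linarith

variable {F : Type} [Field F] [Fintype F] [MeasurableSpace F] [DiscreteMeasurableSpace F] {k : ℕ}
  {V : Type} [Fintype V] {G : SimpleGraph V} {s : V} {𝒯 : RankedBFSTree G s}
  {model : FaultModel} {c T : ℕ} {bat : Fin k → ℕ} {sel : ℕ → V → ℕ}
  {p : ℝ}

theorem probUninformed_root (t : ℕ) {β : ℕ} {μ : Fin k → F} (hμ : μ ≠ 0) (hβ : InBatch bat β μ) :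
    probUninformed 𝒯 model c T bat sel β μ p t s = 0 := by
  have : {ω : Seed V F k T × (Fin T → V → Bool) |
      ¬ Informed bat β μ (coeffsKnown 𝒯 model c bat sel ω t s)} = ∅ :=
    Set.eq_empty_of_forall_notMem fun ω hω => hω (informed_root ω t hμ hβ)
  rw [probUninformed, this, measureReal_empty]

/-- The union bound over all nodes and all test vectors. -/
theorem le_prob_allInformed [IsProbabilityMeasure (coin p)] {ε : ℝ} (M : Finset (Fin k → F))
    (hM : ∀ (β : ℕ) (μ : Fin k → F), μ ≠ 0 → InBatch bat β μ → μ ∈ M)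
    (h : ∀ (β : ℕ) (μ : Fin k → F) (w : V), μ ≠ 0 → InBatch bat β μ →
      probUninformed 𝒯 model c T bat sel β μ p T w ≤ ε) (hε : 0 ≤ ε) :
    1 - Fintype.card V * M.card * ε ≤
      ((seedMeasure V F k T).prod (faultMeasure V T p)).real
        {ω | AllInformed 𝒯 model c bat sel ω} := by
  classical
  set ℙ := (seedMeasure V F k T).prod (faultMeasure V T p)
  -- A nonzero vector determines its batch, so the union bound needs no factor for `β`.
  have hbat : ∀ μ : Fin k → F, ∃ β, ∀ β', μ ≠ 0 → InBatch bat β' μ → β' = β := by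
    intro μ
    by_cases hμ : μ = 0
    · exact ⟨0, fun _ h => absurd hμ h⟩
    · obtain ⟨i, hi⟩ := Function.ne_iff.1 hμ
      exact ⟨bat i, fun β' _ hβ' => (hβ' i hi).symm⟩
  choose b hb using hbat
  let E : V × (Fin k → F) → Set (Seed V F k T × (Fin T → V → Bool)) := fun x =>
    {ω | x.2 ≠ 0 ∧ InBatch bat (b x.2) x.2 ∧
      ¬ Informed bat (b x.2) x.2 (coeffsKnown 𝒯 model c bat sel ω T x.1)}
  have hsub : {ω | AllInformed 𝒯 model c bat sel ω}ᶜ ⊆ ⋃ x ∈ Finset.univ ×ˢ M, E x := by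
    intro ω hω
    simp only [AllInformed, Set.mem_compl_iff, Set.mem_setOf_eq, not_forall] at hω
    obtain ⟨w, β, μ, hμ, hβ, hI⟩ := hω
    obtain rfl := hb μ β hμ hβ
    simp only [Set.mem_iUnion]
    exact ⟨(w, μ), Finset.mem_product.2 ⟨Finset.mem_univ w, hM _ μ hμ hβ⟩, hμ, hβ, hI⟩
  have hE : ∀ x, ℙ.real (E x) ≤ ε := by
    intro x
    by_cases hx : x.2 ≠ 0 ∧ InBatch bat (b x.2) x.2
    · exact (measureReal_mono fun ω hω => hω.2.2).trans (h (b x.2) x.2 x.1 hx.1 hx.2)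
    · have : E x = ∅ := Set.eq_empty_of_forall_notMem fun ω hω => hx ⟨hω.1, hω.2.1⟩
      rw [this, measureReal_empty]
      exact hε
  have h1 : ℙ.real {ω | AllInformed 𝒯 model c bat sel ω}ᶜ ≤ Fintype.card V * M.card * ε := by
    calc _ ≤ ℙ.real (⋃ x ∈ Finset.univ ×ˢ M, E x) :=
          measureReal_mono hsub (measure_ne_top _ _)
      _ ≤ ∑ x ∈ Finset.univ ×ˢ M, ℙ.real (E x) := measureReal_biUnion_finset_le _ _
      _ ≤ ∑ _x ∈ (Finset.univ : Finset V) ×ˢ M, ε := Finset.sum_le_sum fun x _ => hE x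
      _ = _ := by
        rw [Finset.sum_const, Finset.card_product, nsmul_eq_mul, Finset.card_univ, Nat.cast_mul]
  rw [probReal_compl_eq_one_sub MeasurableSet.of_discrete] at h1
  linarith

theorem dist_le_diam_of_connected (hG : G.Connected) (u v : V) : G.dist u v ≤ G.diam := by
  haveI := hG.nonempty
  exact SimpleGraph.dist_le_diam (SimpleGraph.connected_iff_ediam_ne_top.1 hG)

end Zone

/-- Robust FASTBC with random linear network coding. -/
theorem robustFastbcRLNC_succeeds (p : ℝ) (F : Type) [Field F] [Fintype F] [MeasurableSpace F]
    [DiscreteMeasurableSpace F] (hp0 : 0 ≤ p) (hp1 : p < 1) :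
    ∃ c₀ : ℕ, ∀ c : ℕ, c₀ ≤ c → ∃ C : ℝ, 0 < C ∧
      ∀ (model : FaultModel) (V : Type) [Fintype V] (G : SimpleGraph V) (s : V),
        G.Connected → 3 ≤ Fintype.card V → ∀ 𝒯 : RankedBFSTree G s, 𝒯.IsGBST →
          ∀ k ℓ T : ℕ, 1 ≤ k → C * roundBound (Fintype.card V) G.diam k ≤ T →
          ∀ m : FieldMessages F k ℓ, 1 - 1 / ((Fintype.card V : ℝ) * k) ≤
            ((seedMeasure V F k T).prod (faultMeasure V T p)).real
              {ω | Succeeds G s model (robustFastbcRLNC 𝒯 c ℓ ω.1) m ω.2} := by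
  haveI := coin_isProbabilityMeasure hp0 hp1.le
  set q := Fintype.card F with hq
  have hq0 : (0 : ℝ) < 8 * q := by
    have : (0 : ℝ) < q := by exact_mod_cast Fintype.card_pos
    positivity
  -- With `h = k + L` the error is `(8 * q) ^ (-(k + L))`. It beats the `n * q ^ k` events and
  -- leaves `1 / (n * k)`, because `n ≤ 2 ^ L` and `k ≤ 2 ^ k`.
  obtain ⟨c₀, hc₀⟩ := exists_zone_progress p F hp0 hp1 (Real.log (8 * q))
  refine ⟨c₀, fun c hc => ?_⟩
  obtain ⟨C, hC1, hC⟩ := hc₀ c hc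
  have hCpos : (0 : ℝ) < C := by exact_mod_cast hC1
  refine ⟨C * 540, by positivity, ?_⟩
  intro model V _ G s hG hn 𝒯 hT k ℓ T hk hTk m
  set n := Fintype.card V with hndef
  set L := decayLength n with hL
  set S := blockSize n with hS
  have hrounds : 0 + C * (G.diam + (k + L) * L * S) ≤ T := by
    have h1 := mul_le_mul_of_nonneg_left (rounds_le_roundBound hn G.diam k) hCpos.le
    rw [← mul_assoc] at h1
    rw [zero_add]
    exact_mod_cast h1.trans hTk
  have hprob : ∀ (β : ℕ) (μ : Fin k → F) (w : V), μ ≠ 0 → InBatch (fun _ => 0) β μ →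
      probUninformed 𝒯 model c T (fun _ => 0) (fun _ _ => 0) β μ p T w ≤
        Real.exp (-Real.log (8 * q)) ^ (k + L) := by
    intro β μ w hμ hβ
    have hβ0 : 0 = β := by
      obtain ⟨i, hi⟩ := Function.ne_iff.1 hμ
      exact hβ i hi
    have := hC model V G s 𝒯 hG hn hT k T (fun _ => 0) (fun _ _ => 0) β μ 0 G.diam
      (0 + G.diam + 2 * L + 1) 0 T (k + L) 0 le_rfl le_rfl (fun _ _ _ _ _ _ => hβ0)
      (fun w hw => by
        obtain rfl := hG.dist_eq_zero_iff.1 (Nat.le_zero.1 hw)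
        rw [probUninformed_root 0 hμ hβ]) (Nat.le_add_left _ _) hrounds le_rfl w
      (by rw [zero_add]; exact dist_le_diam_of_connected hG s w)
    rwa [zero_add] at this
  have hall := le_prob_allInformed (𝒯 := 𝒯) (model := model) (c := c) Finset.univ
    (fun _ _ _ _ => Finset.mem_univ _) hprob (by positivity)
  refine le_trans ?_ (hall.trans (measureReal_mono fun ω hω => ?_))
  · refine sub_le_sub_left ?_ 1
    rw [Real.exp_neg, Real.exp_log hq0, inv_pow, Finset.card_univ, Fintype.card_fun, Fintype.card_fin,
      ← div_eq_mul_inv, div_le_div_iff₀ (by positivity) (by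
        have : (0 : ℝ) < n := by exact_mod_cast (by omega : 0 < n)
        have : (0 : ℝ) < k := by exact_mod_cast hk
        positivity)]
    have h1 : n ≤ 2 ^ L := Nat.le_pow_clog one_lt_two _
    have h2 : k ≤ 2 ^ k := Nat.lt_two_pow_self.le
    have h3 : n * q ^ k * (n * k) ≤ (8 * q) ^ (k + L) := by
      calc n * q ^ k * (n * k) ≤ 2 ^ L * q ^ k * (2 ^ L * 2 ^ k) := by gcongr
        _ = (2 * q) ^ k * 4 ^ L := by
          rw [mul_pow, show (4 : ℕ) = 2 * 2 from rfl, mul_pow]; ring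
        _ ≤ (8 * q) ^ k * (8 * q) ^ L := by
          have : 1 ≤ q := Fintype.card_pos
          gcongr <;> omega
        _ = _ := (pow_add _ _ _).symm
    have h4 : ((n * q ^ k * (n * k) : ℕ) : ℝ) ≤ ((8 * q) ^ (k + L) : ℕ) := by exact_mod_cast h3
    push_cast at h4 ⊢
    rw [one_mul]
    exact h4
  · have := hω.succeeds 𝒯 model c (fun _ => 0) (fun _ _ => 0) m
    rwa [batchRLNC_const] at this

/-! ### Translating schedules -/

section Translation

variable {V Msgs Msgs' Packet Packet' : Type} {G : SimpleGraph V} {s : V} {T : ℕ}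
  {model : FaultModel}

/-- A schedule whose packets are all valid can be run with encoded packets and messages. -/
theorem exists_translated_schedule (S : CodingSchedule V Msgs Packet T) (Valid : Packet → Prop)
    (enc : Packet → Packet') (dec : Packet' → Packet) (hdec : ∀ y, Valid y → dec (enc y) = y)
    (φ : Msgs' ≃ Msgs)
    (hvalid : ∀ m i u hist, (∀ y, some y ∈ hist → Valid y) →
      ∀ y, S.act i u (initialKnowledge s m u) hist = some y → Valid y) :
    ∃ S' : CodingSchedule V Msgs' Packet' T, ∀ m fault,
      Succeeds G s model S (φ m) fault → Succeeds G s model S' m fault := by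
  classical
  let S' : CodingSchedule V Msgs' Packet' T :=
    { act := fun i u init hist =>
        (S.act i u (init.map φ) (hist.map (Option.map dec))).map enc
      decode := fun u init hist =>
        (S.decode u (init.map φ) (hist.map (Option.map dec))).map φ.symm }
  have hinit : ∀ m u, (initialKnowledge s m u).map φ = initialKnowledge s (φ m) u := by
    intro m u
    unfold initialKnowledge
    split_ifs <;> rfl
  have hhist : ∀ hist : List (Option Packet), (∀ y, some y ∈ hist → Valid y) →
      (hist.map (Option.map enc)).map (Option.map dec) = hist := by
    intro hist h
    rw [List.map_map]
    conv_rhs => rw [← List.map_id hist]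
    refine List.map_congr_left fun x hx => ?_
    cases x with
    | none => rfl
    | some y => exact congrArg some (hdec y (h y hx))
  refine ⟨S', fun m fault hS u => ?_⟩
  have hmap := history_map (G := G) (model := model) (S := S) (S' := S') enc Valid (m := φ m)
    (m' := m) (fun i u hist h => ⟨by
      change (S.act i u _ _).map enc = _
      rw [hinit, hhist hist h], hvalid (φ m) i u hist h⟩) fault T u
  change (S.decode u _ _).map φ.symm = _
  rw [hmap.1, hhist _ hmap.2, hinit, hS u, Option.map_some, φ.symm_apply_apply]

end Translation

/-- The range of a function on `X` can be encoded in any type with at least as many elements. -/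
theorem exists_encoding {X Y Z : Type} [Fintype X] [Fintype Y] [Nonempty X] (Φ : X → Z)
    (h : Fintype.card X ≤ Fintype.card Y) :
    ∃ (enc : Z → Y) (dec : Y → Z), ∀ x, dec (enc (Φ x)) = Φ x := by
  obtain ⟨e⟩ := Function.Embedding.nonempty_of_card_le h
  refine ⟨fun z => e (Function.invFun Φ z), fun y => Φ (Function.invFun e y), fun x => ?_⟩
  exact (congrArg Φ (Function.leftInverse_invFun e.injective _)).trans
    (Function.invFun_eq (f := Φ) ⟨x, rfl⟩)

/-- A suitable value of the first coordinate preserves the probability of an event. -/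
theorem exists_le_measureReal_section {X Y : Type*} [MeasurableSpace X] [MeasurableSpace Y]
    (μ : Measure X) (ν : Measure Y) [IsProbabilityMeasure μ] [IsProbabilityMeasure ν]
    {E : Set (X × Y)} (hE : MeasurableSet E) {r : ℝ} (h : r ≤ (μ.prod ν).real E) :
    ∃ x, r ≤ ν.real {y | (x, y) ∈ E} := by
  obtain ⟨x, hx⟩ := exists_lintegral_le (μ := μ) (f := fun x => ν (Prod.mk x ⁻¹' E))
    (by
      rw [← Measure.prod_apply hE]
      exact measure_ne_top _ _)
  rw [← Measure.prod_apply hE] at hx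
  exact ⟨x, h.trans (ENNReal.toReal_mono (measure_ne_top _ _) hx)⟩

/-! ### Pipelined batches -/

section Batches

variable {F : Type} [Field F] {k : ℕ}

/-- The vector with entries `f` in the batch `β` of size `g`. -/
def batchVector (g β : ℕ) (f : Fin g → F) (i : Fin k) : F :=
  if h : 0 < g ∧ (i : ℕ) / g = β then f ⟨i % g, Nat.mod_lt _ h.1⟩ else 0

/-- A batch number and `g` field elements suffice; this gives both the short encoding and the small
union bound. -/
theorem exists_eq_batchVector {g β : ℕ} (hg : 0 < g) (hk : 0 < k) {μ : Fin k → F}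
    (hμ : InBatch (fun i => (i : ℕ) / g) β μ) :
    ∃ (b : Fin k) (f : Fin g → F), μ = batchVector g b f := by
  by_cases h0 : μ = 0
  · refine ⟨⟨0, hk⟩, 0, ?_⟩
    funext i
    rw [h0, batchVector]
    split_ifs <;> rfl
  · obtain ⟨i₀, hi₀⟩ := Function.ne_iff.1 h0
    have hβ := hμ i₀ hi₀
    have hβk : β < k := hβ ▸ (Nat.div_le_self _ _).trans_lt i₀.2
    refine ⟨⟨β, hβk⟩, fun r => if h : g * β + r < k then μ ⟨g * β + r, h⟩ else 0, ?_⟩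
    funext i
    unfold batchVector
    dsimp only
    split_ifs with h1 h2
    · congr 1
      ext1
      change (i : ℕ) = g * β + i % g
      rw [← h1.2, Nat.div_add_mod]
    · rw [← h1.2, Nat.div_add_mod] at h2
      exact absurd i.2 h2
    · by_contra hne
      exact h1 ⟨hg, hμ i hne⟩

theorem card_filter_inBatch_le [Fintype F] {g : ℕ} (hg : 0 < g) (hk : 0 < k)
    [DecidablePred fun μ : Fin k → F => ∃ β, InBatch (fun i => (i : ℕ) / g) β μ] :
    (Finset.univ.filter fun μ : Fin k → F => ∃ β, InBatch (fun i => (i : ℕ) / g) β μ).card ≤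
      k * Fintype.card F ^ g := by
  classical
  calc _ ≤ ((Finset.univ : Finset (Fin k × (Fin g → F))).image
        fun x => batchVector (k := k) g x.1 x.2).card := by
        refine Finset.card_le_card fun μ hμ => ?_
        obtain ⟨β, hβ⟩ := (Finset.mem_filter.1 hμ).2
        obtain ⟨b, f, rfl⟩ := exists_eq_batchVector hg hk hβ
        exact Finset.mem_image.2 ⟨(b, f), Finset.mem_univ _, rfl⟩
    _ ≤ _ := Finset.card_image_le
    _ = _ := by
      rw [Finset.card_univ, Fintype.card_prod, Fintype.card_fin, Fintype.card_fun, Fintype.card_fin]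

variable [Fintype F] [MeasurableSpace F] [DiscreteMeasurableSpace F]
  {V : Type} [Fintype V] {G : SimpleGraph V} {s : V} {𝒯 : RankedBFSTree G s}
  {model : FaultModel} {c T : ℕ} {bat : Fin k → ℕ} {sel : ℕ → V → ℕ} {p : ℝ}

theorem probUninformed_anti [IsProbabilityMeasure (coin p)] {β : ℕ} {μ : Fin k → F} (w : V) :
    Antitone fun t => probUninformed 𝒯 model c T bat sel β μ p t w :=
  antitone_nat_of_succ_le fun t => probUninformed_succ_le _ _ _ _ _ _ _ _ _ t w

/-- In phase `τ` (of `N` rounds) the strip `i` of `Δ` levels works on this batch: the batch `β`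
crosses the strips `j` and `j + 1` in phase `2 β + j`. -/
noncomputable def pipelineBatch (G : SimpleGraph V) (s : V) (Δ N t : ℕ) (u : V) : ℕ :=
  (t / N + 1 - G.dist s u / Δ) / 2

/-- Batches start two phases apart, so each owns two adjacent strips: the one it crosses, and the
next one as a buffer for slow paths. -/
theorem pipelineBatch_eq {Δ N t β j : ℕ} {u : V} (h1 : (2 * β + j) * N ≤ t)
    (h2 : t < (2 * β + j + 1) * N) (h3 : j * Δ ≤ G.dist s u) (h4 : G.dist s u < (j + 2) * Δ) :
    pipelineBatch G s Δ N t u = β := by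
  have e1 : t / N = 2 * β + j := Nat.div_eq_of_lt_le h1 h2
  have hΔ : 0 < Δ := by
    rcases Nat.eq_zero_or_pos Δ with h | h
    · subst h; omega
    · exact h
  have e2 : j ≤ G.dist s u / Δ := (Nat.le_div_iff_mul_le hΔ).2 h3
  have e3 : G.dist s u / Δ < j + 2 := (Nat.div_lt_iff_lt_mul hΔ).2 h4
  unfold pipelineBatch
  omega

end Batches

/-- Robust FASTBC with random linear network coding in pipelined batches of
`g = ⌈log₂ (n k)⌉` messages over the field with two elements. -/
theorem exists_pipelined_batches (p : ℝ) (F : Type) [Field F] [Fintype F] [MeasurableSpace F]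
    [DiscreteMeasurableSpace F] (hF : Fintype.card F = 2) (hp0 : 0 ≤ p) (hp1 : p < 1) :
    ∃ (c : ℕ) (C : ℝ), 0 < C ∧ ∀ (model : FaultModel) (V : Type) [Fintype V] (G : SimpleGraph V)
      (s : V), G.Connected → 3 ≤ Fintype.card V → ∀ 𝒯 : RankedBFSTree G s, 𝒯.IsGBST →
      ∀ k : ℕ, 1 ≤ k → ∃ (T : ℕ) (sel : ℕ → V → ℕ),
        (T : ℝ) ≤ C * roundBound (Fintype.card V) G.diam k ∧
        1 - 1 / ((Fintype.card V : ℝ) * k) ≤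
          ((seedMeasure V F k T).prod (faultMeasure V T p)).real
            {ω | AllInformed 𝒯 model c
              (fun i => (i : ℕ) / Nat.clog 2 (Fintype.card V * k)) sel ω} := by
  classical
  haveI := coin_isProbabilityMeasure hp0 hp1.le
  obtain ⟨c, hc₀⟩ := exists_zone_progress p F hp0 hp1 (Real.log 16)
  obtain ⟨C, hC1, hC⟩ := hc₀ c le_rfl
  have hCpos : (0 : ℝ) < C := by exact_mod_cast hC1
  refine ⟨c, C * 21 * 540, by positivity, ?_⟩
  intro model V _ G s hG hn 𝒯 hT k hk
  set n := Fintype.card V with hndef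
  set L := decayLength n with hL
  set S := blockSize n with hS
  set g := Nat.clog 2 (n * k) with hg
  set D := G.diam with hD
  have hL2 : 2 ≤ L := two_le_decayLength hn
  have hS1 : 1 ≤ S := one_le_blockSize hn
  have hLg : L ≤ g := Nat.clog_mono_right 2 (Nat.le_mul_of_pos_right n hk)
  have hgLk : g ≤ L + k := by
    refine Nat.clog_le_of_le_pow ?_
    rw [pow_add]
    exact Nat.mul_le_mul (Nat.le_pow_clog one_lt_two _) Nat.lt_two_pow_self.le
  have hnk : n * k ≤ 2 ^ g := Nat.le_pow_clog one_lt_two _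
  have hg0 : 0 < g := by omega
  set Q := g * L * S with hQ
  have hQL : L ≤ Q := by
    calc L = 1 * L * 1 := by ring
      _ ≤ g * L * S := by gcongr; omega
  set Δ := 6 * Q with hΔ
  set N := C * (Δ + Q) with hN
  set J := D / Δ + 1 with hJ
  set T := (2 * ((k - 1) / g) + J) * N with hTdef
  set ε : ℝ := Real.exp (-Real.log 16) ^ g with hε
  have hεpos : 0 < ε := by positivity
  set bat : Fin k → ℕ := fun i => (i : ℕ) / g with hbat
  set sel := pipelineBatch G s Δ N with hsel
  have hbatle : ∀ i : Fin k, bat i ≤ (k - 1) / g := fun i =>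
    Nat.div_le_div_right (by have := i.2; omega)
  have hphase : ∀ (β : ℕ) (μ : Fin k → F), μ ≠ 0 → InBatch bat β μ → ∀ j ≤ J, ∀ w,
      G.dist s w ≤ j * Δ →
      probUninformed 𝒯 model c T bat sel β μ p ((2 * β + j) * N) w ≤ j * ε := by
    intro β μ hμ hβ
    have hβle : β ≤ (k - 1) / g := by
      obtain ⟨i, hi⟩ := Function.ne_iff.1 hμ
      exact (hβ i hi) ▸ hbatle i
    intro j
    induction j with
    | zero =>
      intro _ w hw
      rw [zero_mul] at hw
      obtain rfl := hG.dist_eq_zero_iff.1 (Nat.le_zero.1 hw)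
      rw [probUninformed_root _ hμ hβ, Nat.cast_zero, zero_mul]
    | succ j ih =>
      intro hj w hw
      have hlt : (2 * β + (j + 1)) * N ≤ T := Nat.mul_le_mul_right N (by omega)
      have e1 : (2 * β + (j + 1)) * N = (2 * β + j) * N + N := by ring
      have e2 : (j + 2) * Δ = j * Δ + Δ + Δ := by ring
      -- The error `j * ε` of the strips already crossed enters as `δ`; the last admissible level is
      -- the end of the buffer strip.
      have := hC model V G s 𝒯 hG hn hT k T bat sel β μ (j * Δ) Δ ((j + 2) * Δ - 1)
        ((2 * β + j) * N) ((2 * β + (j + 1)) * N) g (j * ε) (by positivity) hlt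
        (fun t h1 h2 u h3 h4 => pipelineBatch_eq h1 h2 h3 (by omega))
        (ih (by omega)) hLg (by rw [e1])
        (show j * Δ + Δ + 2 * L + 1 ≤ (j + 2) * Δ - 1 by omega) w (by
          have : (j + 1) * Δ = j * Δ + Δ := by ring
          omega)
      push_cast
      linarith
  have hprob : ∀ (β : ℕ) (μ : Fin k → F) (w : V), μ ≠ 0 → InBatch bat β μ →
      probUninformed 𝒯 model c T bat sel β μ p T w ≤ J * ε := by
    intro β μ w hμ hβ
    have hβle : β ≤ (k - 1) / g := by
      obtain ⟨i, hi⟩ := Function.ne_iff.1 hμ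
      exact (hβ i hi) ▸ hbatle i
    refine (probUninformed_anti w (Nat.mul_le_mul_right N (by omega))).trans
      (hphase β μ hμ hβ J le_rfl w ?_)
    have h1 := dist_le_diam_of_connected hG s w
    have h2 : D < Δ * (D / Δ + 1) := Nat.lt_mul_div_succ D (by omega)
    rw [Nat.mul_comm J]
    exact h1.trans h2.le
  refine ⟨T, sel, ?_, ?_⟩
  · have h1 : (k - 1) / g * g ≤ k - 1 := Nat.div_mul_le_self _ _
    have h2 : D / Δ * Δ ≤ D := Nat.div_mul_le_self _ _
    have h3 : T ≤ C * 21 * (D + (k + L) * L * S) := by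
      have e1 : T = C * (14 * ((k - 1) / g * g * L * S) + 7 * (D / Δ * Q) + 7 * (g * L * S)) := by
        rw [hTdef, hN, hJ, hΔ, hQ]; ring
      have e2 : 6 * (D / Δ * Q) ≤ D := by
        calc 6 * (D / Δ * Q) = D / Δ * Δ := by rw [hΔ]; ring
          _ ≤ D := h2
      have e3 : (k - 1) / g * g * L * S ≤ (k + L) * L * S := by gcongr; omega
      have e4 : g * L * S ≤ (k + L) * L * S := by gcongr; omega
      rw [e1, mul_assoc C 21]
      refine Nat.mul_le_mul_left C ?_
      omega
    have h4 := mul_le_mul_of_nonneg_left (rounds_le_roundBound hn D k)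
      (by positivity : (0 : ℝ) ≤ C * 21)
    rw [← mul_assoc] at h4
    exact le_trans (by exact_mod_cast h3) h4
  · refine le_trans ?_ (le_prob_allInformed (𝒯 := 𝒯) (model := model) (c := c)
      (Finset.univ.filter fun μ : Fin k → F => ∃ β, InBatch bat β μ)
      (fun β μ _ hβ => Finset.mem_filter.2 ⟨Finset.mem_univ _, β, hβ⟩) hprob (by positivity))
    have hcard := card_filter_inBatch_le (F := F) hg0 hk
    rw [hF] at hcard
    have hDn : D < n := by
      haveI := hG.nonempty
      obtain ⟨u, v, huv⟩ := G.exists_dist_eq_diam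
      rw [hD, ← huv]
      exact RankedBFSTree.dist_lt_card hG u v
    have hJn : J ≤ n := by
      have := Nat.div_le_self D Δ
      omega
    have hε' : ε = 1 / (16 : ℝ) ^ g := by
      rw [hε, Real.exp_neg, Real.exp_log (by norm_num), inv_pow, one_div]
    have hn0 : (0 : ℝ) < n := by exact_mod_cast (by omega : 0 < n)
    have hk0 : (0 : ℝ) < k := by exact_mod_cast hk
    refine sub_le_sub_left ?_ 1
    -- The base 16 provides four factors `2 ^ g`: one for the vectors within a batch and three for
    -- powers of `n * k`, which cover nodes, batches, strips and the target.
    have h1 : n * (k * 2 ^ g) * n * (n * k) ≤ 16 ^ g := by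
      calc n * (k * 2 ^ g) * n * (n * k) ≤ n * (k * 2 ^ g) * (n * k) * (n * k) := by
            gcongr
            exact Nat.le_mul_of_pos_right n hk
        _ = (n * k) * (n * k) * (n * k) * 2 ^ g := by ring
        _ ≤ 2 ^ g * 2 ^ g * 2 ^ g * 2 ^ g := by gcongr
        _ = 16 ^ g := by rw [← mul_pow, ← mul_pow, ← mul_pow]; norm_num
    have h2 : ((n * (k * 2 ^ g) * n * (n * k) : ℕ) : ℝ) ≤ ((16 ^ g : ℕ) : ℝ) := by
      exact_mod_cast h1
    push_cast at h2
    calc (n : ℝ) * _ * (J * ε) ≤ n * (k * 2 ^ g) * (n * ε) := by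
          have h3 : ((Finset.univ.filter fun μ : Fin k → F => ∃ β, InBatch bat β μ).card : ℝ) ≤
            (k * 2 ^ g : ℕ) := by exact_mod_cast hcard
          push_cast at h3
          gcongr
      _ = n * (k * 2 ^ g) * n / 16 ^ g := by rw [hε']; ring
      _ ≤ 1 / (n * k) := by
        rw [div_le_div_iff₀ (by positivity) (by positivity), one_mul]
        exact h2

/-- Coding schedules with packets of `O(log (n k))` bits. -/
theorem exists_codingSchedule (a : ℕ) (p : ℝ) (F : Type) [Field F] [Fintype F] [MeasurableSpace F]
    [DiscreteMeasurableSpace F] (hF : Fintype.card F = 2) (hp0 : 0 ≤ p) (hp1 : p < 1) :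
    ∃ C : ℝ, 0 < C ∧ ∀ (model : FaultModel) (V : Type) [Fintype V] (G : SimpleGraph V) (s : V),
      G.Connected → 3 ≤ Fintype.card V → ∀ k : ℕ, 1 ≤ k →
      ∃ (T : ℕ) (S : CodingSchedule V (Fin k → LogBits a (Fintype.card V) k)
          (LogBits (a + 2) (Fintype.card V) k) T),
        (T : ℝ) ≤ C * roundBound (Fintype.card V) G.diam k ∧
        ∀ m, 1 - 1 / ((Fintype.card V : ℝ) * k) ≤
          (faultMeasure V T p).real {f | Succeeds G s model S m f} := by
  classical
  haveI := coin_isProbabilityMeasure hp0 hp1.le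
  obtain ⟨c, C, hC0, hC⟩ := exists_pipelined_batches p F hF hp0 hp1
  refine ⟨C, hC0, fun model V _ G s hG hn k hk => ?_⟩
  obtain ⟨𝒯, hT⟩ := exists_isGBST hG s
  obtain ⟨T, sel, hTle, hprob⟩ := hC model V G s hG hn 𝒯 hT k hk
  -- `AllInformed` does not mention the messages, so one fixed seed serves all of them.
  obtain ⟨seed, hseed⟩ := exists_le_measureReal_section _ _ MeasurableSet.of_discrete hprob
  set g := Nat.clog 2 (Fintype.card V * k) with hg
  have hnk : Fintype.card V * k ≤ 2 ^ g := Nat.le_pow_clog one_lt_two _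
  have hkg : k ≤ 2 ^ g := (Nat.le_mul_of_pos_left k (by omega)).trans hnk
  have hg0 : 0 < g := Nat.clog_pos one_lt_two (by nlinarith)
  set ℓ := a * g with hℓ
  haveI : Nonempty (Fin k) := ⟨⟨0, hk⟩⟩
  -- The batch number takes `g` bits, the coefficients `g` and the payload `a * g`; hence `A = a +
  -- 2`.
  obtain ⟨enc, dec, hdec⟩ := exists_encoding (Y := LogBits (a + 2) (Fintype.card V) k)
    (fun x : Fin k × (Fin g → F) × (Fin ℓ → F) =>
      ((batchVector g x.1 x.2.1, x.2.2) : RLNCPacket F k ℓ)) (by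
    simp only [Fintype.card_prod, Fintype.card_fun, Fintype.card_fin, hF, Fintype.card_bool]
    calc k * (2 ^ g * 2 ^ ℓ) ≤ 2 ^ g * (2 ^ g * 2 ^ ℓ) := by gcongr
      _ = 2 ^ ((a + 2) * g) := by rw [hℓ, ← pow_add, ← pow_add]; congr 1; ring)
  have e : Bool ≃ F := Fintype.equivOfCardEq (by rw [hF, Fintype.card_bool])
  obtain ⟨S', hS'⟩ := exists_translated_schedule (G := G) (s := s) (model := model)
    (batchRLNC 𝒯 c (fun i => (i : ℕ) / g) sel ℓ seed)
    (fun y => ∃ β, InBatch (fun i : Fin k => (i : ℕ) / g) β y.1) enc dec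
    (fun y ⟨β, hy⟩ => by
      obtain ⟨b, f, hbf⟩ := exists_eq_batchVector hg0 hk hy
      have := hdec (b, f, y.2)
      dsimp only at this
      rwa [← hbf] at this)
    (Equiv.piCongrRight fun _ : Fin k => Equiv.piCongrRight fun _ : Fin ℓ => e)
    (fun m i u hist _ y hy => by
      unfold batchRLNC at hy
      dsimp only at hy
      split_ifs at hy
      · obtain rfl := Option.some_injective _ hy
        exact ⟨_, inBatch_combine _ fun y hy => by simpa using (List.mem_filter.1 hy).2⟩)
  refine ⟨T, S', hTle, fun m => hseed.trans (measureReal_mono fun f hf => ?_)⟩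
  exact hS' m f (AllInformed.succeeds 𝒯 model c _ sel hf _)

/-! ### Throughput -/

/-- For a fixed graph and large `k`, the terms of `roundBound` without `k` are at most the linear
one, so `T ≤ 2 * C * k * log n * log log n`. -/
theorem le_codingThroughput {V : Type} [Fintype V] (G : SimpleGraph V) (s : V) (model : FaultModel)
    {p C : ℝ} (hC : 0 < C) (a A : ℕ) (hn : 3 ≤ Fintype.card V)
    (h : ∀ k : ℕ, 1 ≤ k → ∃ (T : ℕ) (S : CodingSchedule V (Fin k → LogBits a (Fintype.card V) k)
        (LogBits A (Fintype.card V) k) T),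
      (T : ℝ) ≤ C * roundBound (Fintype.card V) G.diam k ∧
      ∀ m, 1 - 1 / ((Fintype.card V : ℝ) * k) ≤
        (faultMeasure V T p).real {f | Succeeds G s model S m f}) :
    ENNReal.ofReal (1 / (2 * C) / (Real.log (Fintype.card V) *
      Real.log (Real.log (Fintype.card V)))) ≤ codingThroughput G s model p a A := by
  set n := Fintype.card V with hndef
  set x := Real.log n * Real.log (Real.log n) with hx
  have hlog := one_lt_log_of_three_le hn
  have hloglog := log_log_ge hn
  have hx0 : 0 < x := mul_pos (by linarith) (by linarith)
  refine le_limsup_of_frequently_le (Eventually.frequently ?_)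
  have hlim : Tendsto (fun k : ℕ => (k : ℝ) * x) atTop atTop :=
    tendsto_natCast_atTop_atTop.atTop_mul_const hx0
  filter_upwards [eventually_ge_atTop 1,
    hlim.eventually_ge_atTop (G.diam + Real.log n * x)] with k hk hkx
  obtain ⟨T, S, hT, hS⟩ := h k hk
  have hk0 : (0 : ℝ) < k := by exact_mod_cast hk
  have hn1 : (1 : ℝ) ≤ n := by exact_mod_cast (by omega : 1 ≤ n)
  have hmem : T ∈ {T : ℕ | ∃ S : CodingSchedule V (Fin k → LogBits a n k) (LogBits A n k) T,
      ∀ m, 1 - 1 / (k : ℝ) ≤ (faultMeasure V T p).real {f | Succeeds G s model S m f}} := by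
    refine ⟨S, fun m => le_trans ?_ (hS m)⟩
    refine sub_le_sub_left (one_div_le_one_div_of_le hk0 ?_) 1
    exact le_mul_of_one_le_left hk0.le hn1
  refine le_trans ?_ (ENNReal.div_le_div_left (iInf₂_le T hmem) _)
  rw [ENNReal.le_div_iff_mul_le (Or.inr (by exact_mod_cast (by omega : k ≠ 0)))
    (Or.inr (ENNReal.natCast_ne_top k)), ← ENNReal.ofReal_natCast T, ← ENNReal.ofReal_natCast k,
    ← ENNReal.ofReal_mul (by positivity)]
  refine ENNReal.ofReal_le_ofReal ?_
  have h1 : roundBound n G.diam k = G.diam + Real.log n * x + k * x := by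
    rw [roundBound, hx]; ring
  have h2 : (T : ℝ) ≤ 2 * C * (k * x) := by
    rw [h1] at hT
    nlinarith
  calc 1 / (2 * C) / x * T ≤ 1 / (2 * C) / x * (2 * C * (k * x)) := by gcongr
    _ = k := by field_simp

theorem mainTheorem11 :
    -- Robust FASTBC with random linear network coding over a finite field `F`
    (∀ (p : ℝ) (F : Type) [Field F] [Fintype F] [MeasurableSpace F] [DiscreteMeasurableSpace F],
      0 ≤ p → p < 1 →
      ∃ c₀ : ℕ, ∀ c : ℕ, c₀ ≤ c → ∃ C : ℝ, 0 < C ∧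
        ∀ (model : FaultModel) (V : Type) [Fintype V] (G : SimpleGraph V) (s : V),
          G.Connected → 3 ≤ Fintype.card V →
          (∃ 𝒯 : RankedBFSTree G s, 𝒯.IsGBST) ∧
          ∀ 𝒯 : RankedBFSTree G s, 𝒯.IsGBST →
            ∀ k ℓ T : ℕ, 1 ≤ k → C * roundBound (Fintype.card V) G.diam k ≤ T →
            ∀ m : FieldMessages F k ℓ,
              1 - 1 / ((Fintype.card V : ℝ) * k) ≤
                ((seedMeasure V F k T).prod (faultMeasure V T p)).real
                  {ω | Succeeds G s model (robustFastbcRLNC 𝒯 c ℓ ω.1) m ω.2}) ∧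
    -- schedules with messages and packets of `O(log (n k))` bits, and the throughput
    (∀ a : ℕ, ∃ A : ℕ, ∀ p : ℝ, 0 ≤ p → p < 1 →
      ∃ C θ : ℝ, 0 < C ∧ 0 < θ ∧
        ∀ (model : FaultModel) (V : Type) [Fintype V] (G : SimpleGraph V) (s : V),
          G.Connected → 3 ≤ Fintype.card V →
          (∀ k : ℕ, 1 ≤ k →
            ∃ (T : ℕ) (S : CodingSchedule V (Fin k → LogBits a (Fintype.card V) k)
                (LogBits A (Fintype.card V) k) T),
              (T : ℝ) ≤ C * roundBound (Fintype.card V) G.diam k ∧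
              ∀ m, 1 - 1 / ((Fintype.card V : ℝ) * k) ≤
                (faultMeasure V T p).real {f | Succeeds G s model S m f}) ∧
          ENNReal.ofReal (θ / (Real.log (Fintype.card V) *
              Real.log (Real.log (Fintype.card V)))) ≤
            codingThroughput G s model p a A) := by
  refine ⟨fun p F _ _ _ _ hp0 hp1 => ?_, fun a => ⟨a + 2, fun p hp0 hp1 => ?_⟩⟩
  · obtain ⟨c₀, hc₀⟩ := robustFastbcRLNC_succeeds p F hp0 hp1
    refine ⟨c₀, fun c hc => ?_⟩
    obtain ⟨C, hC0, hC⟩ := hc₀ c hc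
    exact ⟨C, hC0, fun model V _ G s hG hn => ⟨exists_isGBST hG s, hC model V G s hG hn⟩⟩
  · haveI : Fact (Nat.Prime 2) := ⟨Nat.prime_two⟩
    letI : MeasurableSpace (ZMod 2) := ⊤
    haveI : DiscreteMeasurableSpace (ZMod 2) := ⟨fun _ => trivial⟩
    obtain ⟨C, hC0, hC⟩ := exists_codingSchedule a p (ZMod 2) (ZMod.card 2) hp0 hp1
    refine ⟨C, 1 / (2 * C), hC0, by positivity, fun model V _ G s hG hn => ?_⟩
    have h := hC model V G s hG hn
    exact ⟨h, le_codingThroughput G s model hC0 a (a + 2) hn h⟩
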